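/- Setting. Let $X$ be a complex Banach space, $A$ a closed linear operator in $X$ with dense domain $\mathcal D(A)$, and $G\subset\mathbb C$ open. For $c\in G$ and $0<\nu<\operatorname{dist}(c,\partial G)$ (the distance being $\infty$ if $\partial G=\emptyset$) let $\mathrm{Exp}_{A-c,\nu}(X)$ be the space of all $v\in\bigcap_k\mathcal D((A-c)^k)$ with $\|v\|_{c,\nu}:=\sup_{k\ge0}\nu^{-k}\|(A-c)^kv\|<\infty$. Let $\mathrm{Exp}_{A,G}(X)\subset X$ be the set of all finite sums of elements of these spaces, with the locally convex inductive limit topology of the normed spaces $(\mathrm{Exp}_{A-c,\nu}(X),\|\cdot\|_{c,\nu})$, and let $\mathrm{Exp}'=\mathrm{Exp}'_{A^*,G^*}(X^*)$ be the space of continuous linear functionals on $\mathrm{Exp}_{A,G}(X)$, with the topology of pointwise convergence; continuity, derivatives and integrals of $\mathrm{Exp}'$-valued functions, and absolute continuity, are understood in this topology, i.e. after testing with each $v\in\mathrm{Exp}_{A,G}(X)$ (derivatives being again $\mathrm{Exp}'$-valued). For $b$ analytic on $G$ put $$b(A)\sum_i u_i=\sum_i\sum_{n\ge0}\frac{b^{(n)}(c_i)}{n!}(A-c_i)^nu_i\quad\text{for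 finite sums of } u_i\in\mathrm{Exp}_{A-c_i,\nu_i}(X),\qquad \langle b(A^*)\varphi,v\rangle=\langle\varphi,b(A)v\rangle ,$$ for $\varphi\in\mathrm{Exp}'$, $v\in \mathrm{Exp}_{A,G}(X)$. Assume that no $\zeta\notin G$ is an eigenvalue of $A$ with an eigenvector in $\mathrm{Exp}_{A,G}(X)$ (this is necessary for the formula for $b(A)$ to be independent of the representation, as $b(z)=1/(\zeta-z)$ shows). Let $m\ge1$ be an integer, $\mu\in(m-1,m]$, $\lambda$ a finite measure on $[0,m-1]$, and $f(\alpha,z)$ continuous on $[0,m-1]\times G$ and analytic in $z\in G$. Let $J^\beta y(t)=\frac1{\Gamma(\beta)}\int_0^t(t-s)^{\beta-1}y(s)\,ds$ for $\beta>0$. For $\alpha\ge0$ and $n=\lceil\alpha\rceil$ let $D_*^\alpha y=J^{n-\alpha}y^{(n)}$ if $\alpha<n$ and $D_*^\alpha y=y^{(n)}$ if $\alpha=n$; for $0\le\beta<1$ let $D_+^\beta y=\frac d{dt}J^{1-\beta}y$. Put, for real large $s$ and $z\in G$, $$\Delta(s,z)=s^\mu+\int_{[0,m-1]}f(\alpha,z)s^\alpha\,\lambda(d\alpha),\qquad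 c_\beta(\cdot,z)=\mathcal L^{-1}\Big[\frac{s^\beta}{\Delta(s,z)}\Big]\quad(\beta\le\mu-1),$$ where $\mathcal L^{-1}[F]$ is the continuous function on $[0,\infty)$ whose Laplace transform is $F(s)$ for all large real $s$, and $$S_k(t,z)=c_{\mu-k-1}(t,z)+\int_{(k,m-1]}f(\alpha,z)\,c_{\alpha-k-1}(t,z)\,\lambda(d\alpha),\quad k=0,\dots,m-1.$$ Theorem. Let $\mathrm{Exp}_{A,G}(X)$ be dense in $X$, let $\varphi_0^*,\dots,\varphi_{m-1}^*\in\mathrm{Exp}'$, let $h^*:[0,\infty)\to\mathrm{Exp}'$ be absolutely continuous on $[0,T]$ for every $T>0$, and let $D_+^{m-\mu}h^*$ exist for $t>0$ and extend to a continuous function $[0,\infty)\to\mathrm{Exp}'$. Then the Cauchy problem $$D_*^\mu u^*(t)+\int_{[0,m-1]}f(\alpha,A^*)D_*^\alpha u^*(t)\,\lambda(d\alpha)=h^*(t),\ t>0,\qquad (u^*)^{(k)}(0+)=\varphi_k^*,\ k=0,\dots,m-1,$$ is meaningful and has a unique weak solution. Here meaningful means: for all $b$ analytic on $G$, $b(A)$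 is a well-defined continuous linear operator on $\mathrm{Exp}_{A,G}(X)$ (so that $b(A^*)$ is well defined on $\mathrm{Exp}'$); restriction embeds $X^*$ in $\mathrm{Exp}'$, and the weak extension for $b(z)=z$ extends the adjoint of $A$; the functions $c_\beta$ and $S_k$ exist, the integrals defining $S_k(t,z)$ converge absolutely, and $S_k(t,\cdot)$ is analytic on $G$ for all $t\ge0$. A weak solution is a function $u^*\in C^{(m)}[t>0;\mathrm{Exp}']\cap C^{(m-1)}[t\ge0;\mathrm{Exp}']$ that satisfies the initial conditions in $\mathrm{Exp}'$ and for which, for all $t>0$ and $v\in\mathrm{Exp}_{A,G}(X)$, the expressions below exist (as absolutely convergent integrals) and $$D_*^\mu\langle u^*(\cdot),v\rangle(t)+\int_{[0,m-1]}D_*^\alpha\langle f(\alpha,A^*)u^*(\cdot),v\rangle(t)\,\lambda(d\alpha)=\langle h^*(t),v\rangle .$$ The solution is given for all $t\ge0$ by $$u^*(t)=\sum_{k=0}^{m-1}S_k(t,A^*)\varphi_k^*+\int_0^tS_{m-1}(t-\tau,A^*)\,D_+^{m-\mu}h^*(\tau)\,d\tau .$$ -/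

import Mathlib

open Set Filter Topology MeasureTheory

noncomputable section

namespace FracCauchy

/-! ### Vectors of exponential type -/

/-- The operator `A - c I`, with the domain of `A`. -/
def shift {X : Type*} [NormedAddCommGroup X] [NormedSpace ℂ X] (A : X →ₗ.[ℂ] X) (c : ℂ) :
    X →ₗ.[ℂ] X :=
  ⟨A.domain, A.toFun - c • A.domain.subtype⟩

/-- `w 0` lies in the domain of every power of `B`, and `w k = B ^ k (w 0)`. -/
def IsOrbit {X : Type*} [NormedAddCommGroup X] [NormedSpace ℂ X] (B : X →ₗ.[ℂ] X)
    (w : ℕ → X) : Prop :=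
  ∀ k, ∃ h : w k ∈ B.domain, B ⟨w k, h⟩ = w (k + 1)

/-- `v` lies in the domain of every power of `B` and `‖B ^ k v‖ ≤ C ν ^ k` for all `k`, i.e.
the norm `sup_k ν ^ (-k) ‖B ^ k v‖` of `v` in the space of vectors of exponential type `ν` is
at most `C`. -/
def ExpBound {X : Type*} [NormedAddCommGroup X] [NormedSpace ℂ X] (B : X →ₗ.[ℂ] X)
    (ν C : ℝ) (v : X) : Prop :=
  ∃ w : ℕ → X, w 0 = v ∧ IsOrbit B w ∧ ∀ k, ‖w k‖ ≤ C * ν ^ k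

/-- The space `Exp_{B, ν}(X)` of vectors of exponential type `ν` for `B`. -/
def expType {X : Type*} [NormedAddCommGroup X] [NormedSpace ℂ X] (B : X →ₗ.[ℂ] X)
    (ν : ℝ) : Submodule ℂ X where
  carrier := {v | ∃ C, ExpBound B ν C v}
  zero_mem' := by
    refine ⟨0, fun _ => 0, rfl, fun k => ⟨B.domain.zero_mem, ?_⟩, fun k => by simp⟩
    exact B.map_zero
  add_mem' := by
    rintro a b ⟨C, w, rfl, hw, hC⟩ ⟨C', w', rfl, hw', hC'⟩
    refine ⟨C + C', fun k => w k + w' k, rfl, fun k => ?_, fun k => ?_⟩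
    · obtain ⟨h, e⟩ := hw k
      obtain ⟨h', e'⟩ := hw' k
      refine ⟨B.domain.add_mem h h', ?_⟩
      change _ = w (k + 1) + w' (k + 1)
      rw [← e, ← e', ← B.map_add]
      rfl
    · rw [add_mul]
      exact (norm_add_le _ _).trans (add_le_add (hC k) (hC' k))
  smul_mem' := by
    rintro c a ⟨C, w, rfl, hw, hC⟩
    refine ⟨‖c‖ * C, fun k => c • w k, rfl, fun k => ?_, fun k => ?_⟩
    · obtain ⟨h, e⟩ := hw k
      refine ⟨B.domain.smul_mem c h, ?_⟩
      change _ = c • w (k + 1)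
      rw [← e, ← B.map_smul]
      rfl
    · rw [norm_smul, mul_assoc]
      exact mul_le_mul_of_nonneg_left (hC k) (norm_nonneg c)

/-- `c ∈ G` and `0 < ν < dist (c, ∂G)`; the distance is `∞` when `∂G = ∅`. -/
def Admissible (G : Set ℂ) (c : ℂ) (ν : ℝ) : Prop :=
  c ∈ G ∧ 0 < ν ∧ ENNReal.ofReal ν < Metric.infEDist c (frontier G)

/-- `Exp_{A, G}(X)` as a subspace of `X`: the finite sums of vectors `u_c ∈ Exp_{A - c, ν}(X)`
with `c ∈ G` and `ν < dist (c, ∂G)`. -/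
def expSubmodule {X : Type*} [NormedAddCommGroup X] [NormedSpace ℂ X] (A : X →ₗ.[ℂ] X)
    (G : Set ℂ) : Submodule ℂ X :=
  ⨆ (c : ℂ) (ν : ℝ) (_ : Admissible G c ν), expType (shift A c) ν

/-- `Exp_{A, G}(X)`; a type of its own, since it does not carry the subspace topology of `X`. -/
def ExpSpace {X : Type*} [NormedAddCommGroup X] [NormedSpace ℂ X] (A : X →ₗ.[ℂ] X)
    (G : Set ℂ) : Type _ :=
  expSubmodule A G

instance {X : Type*} [NormedAddCommGroup X] [NormedSpace ℂ X] (A : X →ₗ.[ℂ] X) (G : Set ℂ) :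
    AddCommGroup (ExpSpace A G) :=
  inferInstanceAs (AddCommGroup (expSubmodule A G))

instance {X : Type*} [NormedAddCommGroup X] [NormedSpace ℂ X] (A : X →ₗ.[ℂ] X) (G : Set ℂ) :
    Module ℂ (ExpSpace A G) :=
  inferInstanceAs (Module ℂ (expSubmodule A G))

/-- The inclusion of `Exp_{A, G}(X)` in `X`. -/
def val {X : Type*} [NormedAddCommGroup X] [NormedSpace ℂ X] (A : X →ₗ.[ℂ] X) (G : Set ℂ) :
    ExpSpace A G →ₗ[ℂ] X :=
  (expSubmodule A G).subtype

/-- The seminorm `p` on `Exp_{A, G}(X)` is continuous on each of the normed spaces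
`Exp_{A - c, ν}(X)`, `c ∈ G`, `ν < dist (c, ∂G)`. -/
def IsStepContinuous {X : Type*} [NormedAddCommGroup X] [NormedSpace ℂ X] (A : X →ₗ.[ℂ] X)
    (G : Set ℂ) (p : Seminorm ℂ (ExpSpace A G)) : Prop :=
  ∀ c ν, Admissible G c ν → ∃ K : ℝ, ∀ (C : ℝ) (u : ExpSpace A G),
    ExpBound (shift A c) ν C (val A G u) → p u ≤ K * C

/-- The family of all the seminorms that are continuous on the spaces `Exp_{A - c, ν}(X)`. -/
def stepSeminorms {X : Type*} [NormedAddCommGroup X] [NormedSpace ℂ X] (A : X →ₗ.[ℂ] X)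
    (G : Set ℂ) :
    SeminormFamily ℂ (ExpSpace A G) {p : Seminorm ℂ (ExpSpace A G) // IsStepContinuous A G p} :=
  fun p => p.1

/-- The locally convex inductive limit topology of the spaces `Exp_{A - c, ν}(X)`. -/
instance {X : Type*} [NormedAddCommGroup X] [NormedSpace ℂ X] (A : X →ₗ.[ℂ] X) (G : Set ℂ) :
    TopologicalSpace (ExpSpace A G) :=
  (stepSeminorms A G).moduleFilterBasis.topology

theorem withSeminorms {X : Type*} [NormedAddCommGroup X] [NormedSpace ℂ X] (A : X →ₗ.[ℂ] X)
    (G : Set ℂ) : WithSeminorms (stepSeminorms A G) :=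
  ⟨rfl⟩

theorem continuous_of_step {X : Type*} [NormedAddCommGroup X] [NormedSpace ℂ X]
    (A : X →ₗ.[ℂ] X) (G : Set ℂ) {Y : Type*} [NormedAddCommGroup Y] [NormedSpace ℂ Y]
    (φ : ExpSpace A G →ₗ[ℂ] Y)
    (h : ∀ c ν, Admissible G c ν → ∃ K : ℝ, ∀ (C : ℝ) (u : ExpSpace A G),
      ExpBound (shift A c) ν C (val A G u) → ‖φ u‖ ≤ K * C) : Continuous φ := by
  have := (withSeminorms A G).topologicalAddGroup
  refine (norm_withSeminorms ℂ Y).continuous_of_continuous_comp φ fun _ => ?_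
  exact (withSeminorms A G).continuous_seminorm ⟨(normSeminorm ℂ Y).comp φ, h⟩

theorem continuous_val {X : Type*} [NormedAddCommGroup X] [NormedSpace ℂ X]
    (A : X →ₗ.[ℂ] X) (G : Set ℂ) : Continuous (val A G) := by
  refine continuous_of_step A G _ fun c ν _ => ⟨1, ?_⟩
  rintro C u ⟨w, hw, -, hC⟩
  simpa [hw] using hC 0

/-- `Exp'_{A*, G*}(X*)`: the space of continuous linear functionals on `Exp_{A, G}(X)`, with the
topology of pointwise convergence. -/
abbrev ExpDual {X : Type*} [NormedAddCommGroup X] [NormedSpace ℂ X] (A : X →ₗ.[ℂ] X)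
    (G : Set ℂ) : Type _ :=
  WeakDual ℂ (ExpSpace A G)

/-- The restriction to `Exp_{A, G}(X)` of a functional on `X`. -/
def restrictDual {X : Type*} [NormedAddCommGroup X] [NormedSpace ℂ X] (A : X →ₗ.[ℂ] X)
    (G : Set ℂ) (x : X →L[ℂ] ℂ) : ExpDual A G :=
  StrongDual.toWeakDual (x.comp ⟨val A G, continuous_val A G⟩)

/-! ### The operator calculus -/

/-- `T` is the operator `g(A)` on `Exp_{A, G}(X)`: it is linear and continuous, and on
`Exp_{A - c, ν}(X)` it is given by `T u = ∑ n, g^(n)(c) / n! (A - c)^n u`. -/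
def IsFunCalc {X : Type*} [NormedAddCommGroup X] [NormedSpace ℂ X] (A : X →ₗ.[ℂ] X)
    (G : Set ℂ) (g : ℂ → ℂ) (T : ExpSpace A G →L[ℂ] ExpSpace A G) : Prop :=
  ∀ (c : ℂ) (ν C : ℝ) (w : ℕ → X), Admissible G c ν → IsOrbit (shift A c) w →
    (∀ k, ‖w k‖ ≤ C * ν ^ k) → ∀ u : ExpSpace A G, val A G u = w 0 →
      HasSum (fun n : ℕ => (iteratedDeriv n g c / (n.factorial : ℂ)) • w n) (val A G (T u))

open Classical in
/-- The operator `g(A)` on `Exp_{A, G}(X)` (zero if there is no such operator). -/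
def funCalc {X : Type*} [NormedAddCommGroup X] [NormedSpace ℂ X] (A : X →ₗ.[ℂ] X)
    (G : Set ℂ) (g : ℂ → ℂ) : ExpSpace A G →L[ℂ] ExpSpace A G :=
  if h : ∃ T, IsFunCalc A G g T then h.choose else 0

/-- The weak extension `g(A*)` : `⟨g(A*) φ, v⟩ = ⟨φ, g(A) v⟩`. -/
def weakExt {X : Type*} [NormedAddCommGroup X] [NormedSpace ℂ X] (A : X →ₗ.[ℂ] X)
    (G : Set ℂ) (g : ℂ → ℂ) (φ : ExpDual A G) : ExpDual A G :=
  StrongDual.toWeakDual ((WeakDual.toStrongDual φ).comp (funCalc A G g))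

/-! ### Fractional derivatives -/

/-- The fractional integral of order `β > 0` with terminal point `0`. -/
def fracIntegral (β : ℝ) (y : ℝ → ℂ) (t : ℝ) : ℂ :=
  (1 / Real.Gamma β : ℝ) • ∫ s in (0 : ℝ)..t, ((t - s) ^ (β - 1) : ℝ) • y s

/-- The Caputo--Djrbashian derivative of order `α ≥ 0` at `t > 0`. -/
def caputo (α : ℝ) (y : ℝ → ℂ) (t : ℝ) : ℂ :=
  if α = (⌈α⌉₊ : ℝ) then iteratedDeriv ⌈α⌉₊ y t
  else fracIntegral (⌈α⌉₊ - α) (iteratedDeriv ⌈α⌉₊ y) t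

/-- For `0 ≤ β < 1`: the Riemann--Liouville derivative `D_+^β h = (d/dt) J^{1 - β} h` (which is
`h` itself for `β = 0` and continuous `h`) of the `Exp'`-valued function `h`, taken in the weak
topology, exists on `t > 0` and extends to the continuous function `g` on `t ≥ 0`. -/
def IsRLDeriv {X : Type*} [NormedAddCommGroup X] [NormedSpace ℂ X] (A : X →ₗ.[ℂ] X)
    (G : Set ℂ) (β : ℝ) (h g : ℝ → ExpDual A G) : Prop :=
  ContinuousOn g (Ici 0) ∧
    ∀ v : ExpSpace A G, ∀ t > 0,
      HasDerivAt (fracIntegral (1 - β) fun s => h s v) (g t v) t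

/-! ### The solution operators -/

/-- `y` is continuous on `t ≥ 0` and `F` is its Laplace transform, on some half-line. -/
def IsInvLaplace (F : ℝ → ℂ) (y : ℝ → ℂ) : Prop :=
  ContinuousOn y (Ici 0) ∧ ∃ s₀ : ℝ, ∀ s > s₀,
    IntegrableOn (fun t => (Real.exp (-(s * t)) : ℂ) * y t) (Ioi 0) ∧
      ∫ t in Ioi (0 : ℝ), (Real.exp (-(s * t)) : ℂ) * y t = F s

open Classical in
/-- The inverse Laplace transform of `F` (zero if there is none that is continuous on `t ≥ 0`). -/
def invLaplace (F : ℝ → ℂ) : ℝ → ℂ :=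
  if h : ∃ y, IsInvLaplace F y then h.choose else 0

/-- `Δ(s, z) = s ^ μ + ∫_{[0, m - 1]} f(α, z) s ^ α λ(dα)`. -/
def charFun (m : ℕ) (μ : ℝ) (lam : Measure ℝ) (f : ℝ → ℂ → ℂ) (s : ℝ) (z : ℂ) : ℂ :=
  ((s ^ μ : ℝ) : ℂ) + ∫ α in Icc (0 : ℝ) (m - 1), f α z * ((s ^ α : ℝ) : ℂ) ∂lam

/-- `c_β(t, z)`, the inverse Laplace transform of `s ^ β / Δ(s, z)`. -/
def cFun (m : ℕ) (μ : ℝ) (lam : Measure ℝ) (f : ℝ → ℂ → ℂ) (β t : ℝ) (z : ℂ) : ℂ :=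
  invLaplace (fun s => ((s ^ β : ℝ) : ℂ) / charFun m μ lam f s z) t

/-- `S_k(t, z) = c_{μ - k - 1}(t, z) + ∫_{(k, m - 1]} f(α, z) c_{α - k - 1}(t, z) λ(dα)`. -/
def solSymbol (m : ℕ) (μ : ℝ) (lam : Measure ℝ) (f : ℝ → ℂ → ℂ) (k : ℕ) (t : ℝ) (z : ℂ) : ℂ :=
  cFun m μ lam f (μ - k - 1) t z +
    ∫ α in Ioc (k : ℝ) (m - 1), f α z * cFun m μ lam f (α - k - 1) t z ∂lam

/-! ### Weak solutions -/

/-- `u` is a weak solution of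
`D_*^μ u(t) + ∫_{[0, m - 1]} f(α, A*) D_*^α u(t) λ(dα) = h(t)`, `t > 0`,
`u^(k)(0+) = φ_k`, `k = 0, …, m - 1`:
it belongs to `C^(m)[t > 0; Exp'] ∩ C^(m-1)[t ≥ 0; Exp']`, and equation and initial
conditions hold in the (weak) topology of `Exp'`, i.e. tested against the elements of
`Exp_{A, G}(X)`. The function `d k` is the derivative `u^(k)`. -/
def IsWeakSolution {X : Type*} [NormedAddCommGroup X] [NormedSpace ℂ X] (A : X →ₗ.[ℂ] X)
    (G : Set ℂ) (m : ℕ) (μ : ℝ) (lam : Measure ℝ) (f : ℝ → ℂ → ℂ)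
    (φ : Fin m → ExpDual A G) (h : ℝ → ExpDual A G) (u : ℝ → ExpDual A G) : Prop :=
  (∃ d : ℕ → ℝ → ExpDual A G, d 0 = u ∧
    (∀ k < m, ContinuousOn (d k) (Ici 0)) ∧ ContinuousOn (d m) (Ioi 0) ∧
    (∀ k < m, ∀ t > 0, ∀ v : ExpSpace A G, HasDerivAt (fun s => d k s v) (d (k + 1) t v) t) ∧
    (∀ k : Fin m, d k 0 = φ k)) ∧
  ∀ t > 0, ∀ v : ExpSpace A G,
    (μ < m → IntervalIntegrable
      (fun s => ((t - s) ^ (m - μ - 1) : ℝ) • iteratedDeriv m (fun r => u r v) s) volume 0 t) ∧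
    IntegrableOn (fun α => caputo α (fun s => weakExt A G (f α) (u s) v) t)
      (Icc (0 : ℝ) (m - 1)) lam ∧
    caputo μ (fun s => u s v) t +
      ∫ α in Icc (0 : ℝ) (m - 1), caputo α (fun s => weakExt A G (f α) (u s) v) t ∂lam = h t v

end FracCauchy

end

/-! The problem is reduced to one linear Volterra equation, solved once in an abstract commutative
Banach algebra `𝓐` and then read off in several concrete algebras.

Volterra equation. For a continuous family F(α) in `𝓐` let K(t) = ∫ F(α) t^(μ-α-1)/Γ(μ-α) λ(dα).
Then Δ(s) = s^μ (1 + LK(s)), L the Laplace transform, so dividing by Δ amounts to inverting 1 + K⋆.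
The Neumann series yields q with q + K⋆q = K (`exists_resolventKernel`): K is O(t^(δ-1) e^(σt)), and
convolution with K acts on functions O(t^(δ-1) e^((σ+τ)t)) with norm O(τ^(-δ)), which is small for
large τ. Hence s^(μ-γ)/Δ is the transform of t^(γ-1)/Γ(γ) minus the convolution of this kernel with
q (`laplace_resSol`); this gives the c_β and S_k. Write w = u^(m) and g = D_+^(m-μ) h. By Taylor's
formula D_*^α u is a sum of multiples of t^(k-α) φ_k over k ≥ α, plus J^(m-α) w. The Cauchy problem
therefore reads J^(m-μ)(w + K⋆w + ∑ Q_k φ_k) = h = J^(m-μ) g with explicit kernels Q_k. It is solved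
by w = r - q⋆r, r = g - ∑ Q_k φ_k (`solDeriv_volterra`, `solCaputo_equation`), and m integrations of
w give the representation formula (`solFun_eq`, `sum_solFun_add_integral`).

Choice of algebra. `𝓐` = ℂ gives the symbols at a fixed z; the algebra of a closed disc gives
analyticity of S_k(t, ·); the continuous functions on a circle give the solution in Exp'.

Operator calculus. A vector in Exp_{A-c,ν} is the head of an orbit, and the orbits form a Banach
space on which A - c is a bounded operator of norm at most ν. There b(A) is a power series, equal to
a Cauchy integral of the resolvent. To see that b(A) does not depend on how a vector is decomposed,
suppose that finitely many such vectors add up to 0 and let R(ζ) be the sum of their resolvents, so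
(ζ - A) R = 0. Off G the eigenvector hypothesis forces R and all its derivatives to vanish; near
infinity closedness of A forces R = 0. So R vanishes off a compact part of G, and the integral of b
R against ∂χ/∂z̄, for a cutoff χ, which computes the sum of the b(A)-values, is zero
(`IsCalcValue.eq_zero`).

Transfer. On a space of orbits ⟨T, b(A) x⟩ is a fixed functional, the circle integral, applied to
the product of b with the symbol z ↦ ⟨T, (z - A)⁻¹ x⟩ (`sphereInt_mul_resSymb`). The symbols of the
data are continuous functions on the circle, so the equation is solved in that algebra and mapped to
scalars (`solVal_funCalc_toExp`, `solVal_equation`). Banach–Steinhaus on the spaces of orbits keeps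
values and derivatives in Exp'.

Uniqueness. The derivative of order m-1 of a difference of two solutions satisfies a homogeneous
Volterra equation of positive order m's complement, 1 - (m-μ), on each space of orbits, where the
operators f(α, A) are uniformly bounded; an exponentially weighted norm forces it to vanish
(`eq_zero_of_volterra`). -/

set_option linter.unusedSectionVars false

noncomputable section

namespace FracCauchy

/-! ### Functions with a weak singularity at `0` and their convolution -/

/-- `y` vanishes on `t ≤ 0`, is continuous on `t > 0`, and is `O(t ^ (δ - 1))` on bounded
intervals, for some `δ > 0`. -/
structure Mild {V : Type*} [NormedAddCommGroup V] (y : ℝ → V) : Prop where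
  zero : ∀ t ≤ 0, y t = 0
  cont : ContinuousOn y (Ioi 0)
  bound : ∃ δ > 0, ∀ T, ∃ C, ∀ t ∈ Ioc 0 T, ‖y t‖ ≤ C * t ^ (δ - 1 : ℝ)

theorem Mild.bound' {V : Type*} [NormedAddCommGroup V] {y : ℝ → V} (hy : Mild y) :
    ∃ δ > 0, ∀ T, ∃ C ≥ 0, ∀ t ∈ Ioc 0 T, ‖y t‖ ≤ C * t ^ (δ - 1 : ℝ) := by
  obtain ⟨δ, hδ, h⟩ := hy.bound
  refine ⟨δ, hδ, fun T => ?_⟩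
  obtain ⟨C, hC⟩ := h T
  refine ⟨|C|, abs_nonneg C, fun t ht => (hC t ht).trans ?_⟩
  exact mul_le_mul_of_nonneg_right (le_abs_self C) (Real.rpow_nonneg ht.1.le _)

theorem rpow_sub_one_le {a b T t : ℝ} (hab : a ≤ b) (ht : t ∈ Ioc 0 T) :
    t ^ (b - 1) ≤ T ^ (b - a) * t ^ (a - 1) := by
  rw [show b - 1 = (b - a) + (a - 1) by ring, Real.rpow_add ht.1]
  exact mul_le_mul_of_nonneg_right (Real.rpow_le_rpow ht.1.le ht.2 (by linarith))
    (Real.rpow_nonneg ht.1.le _)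

theorem bound_of_le {V : Type*} [NormedAddCommGroup V] {y : ℝ → V} {a b : ℝ} (hab : a ≤ b)
    (h : ∀ T, ∃ C ≥ 0, ∀ t ∈ Ioc 0 T, ‖y t‖ ≤ C * t ^ (b - 1 : ℝ)) (T : ℝ) :
    ∃ C ≥ 0, ∀ t ∈ Ioc 0 T, ‖y t‖ ≤ C * t ^ (a - 1 : ℝ) := by
  rcases le_or_gt T 0 with hT | hT
  · exact ⟨0, le_rfl, fun t ht => absurd (ht.1.trans_le ht.2) (not_lt.2 hT)⟩
  obtain ⟨C, hC, h⟩ := h T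
  refine ⟨C * T ^ (b - a), by positivity, fun t ht => (h t ht).trans ?_⟩
  rw [mul_assoc]
  exact mul_le_mul_of_nonneg_left (rpow_sub_one_le hab ht) hC

theorem Mild.common_bound {V W : Type*} [NormedAddCommGroup V] [NormedAddCommGroup W]
    {x : ℝ → V} {y : ℝ → W} (hx : Mild x) (hy : Mild y) :
    ∃ δ > 0, ∀ T, ∃ C ≥ 0, ∀ t ∈ Ioc 0 T,
      ‖x t‖ ≤ C * t ^ (δ - 1 : ℝ) ∧ ‖y t‖ ≤ C * t ^ (δ - 1 : ℝ) := by
  obtain ⟨a, ha, h⟩ := hx.bound'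
  obtain ⟨b, hb, h'⟩ := hy.bound'
  refine ⟨min a b, lt_min ha hb, fun T => ?_⟩
  obtain ⟨C, hC, h⟩ := bound_of_le (min_le_left a b) h T
  obtain ⟨C', hC', h'⟩ := bound_of_le (min_le_right a b) h' T
  refine ⟨max C C', le_max_of_le_left hC, fun t ht => ⟨(h t ht).trans ?_, (h' t ht).trans ?_⟩⟩
  · exact mul_le_mul_of_nonneg_right (le_max_left _ _) (Real.rpow_nonneg ht.1.le _)
  · exact mul_le_mul_of_nonneg_right (le_max_right _ _) (Real.rpow_nonneg ht.1.le _)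

theorem mild_zero {V : Type*} [NormedAddCommGroup V] : Mild (fun _ => 0 : ℝ → V) :=
  ⟨fun _ _ => rfl, continuousOn_const, 1, one_pos, fun _ => ⟨0, fun _ _ => by simp⟩⟩

theorem Mild.add {V : Type*} [NormedAddCommGroup V] {x y : ℝ → V} (hx : Mild x) (hy : Mild y) :
    Mild fun t => x t + y t := by
  obtain ⟨δ, hδ, h⟩ := hx.common_bound hy
  refine ⟨fun t ht => by simp [hx.zero t ht, hy.zero t ht], hx.cont.add hy.cont, δ, hδ,
    fun T => ?_⟩
  obtain ⟨C, -, h⟩ := h T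
  refine ⟨C + C, fun t ht => (norm_add_le _ _).trans ?_⟩
  rw [add_mul]
  exact add_le_add (h t ht).1 (h t ht).2

theorem Mild.comp_of_le {V W : Type*} [NormedAddCommGroup V] [NormedAddCommGroup W] {x : ℝ → V}
    (hx : Mild x) {f : V → W} (hf : Continuous f) (K : ℝ) (hK : ∀ v, ‖f v‖ ≤ K * ‖v‖) :
    Mild fun t => f (x t) := by
  obtain ⟨δ, hδ, h⟩ := hx.bound'
  have h0 : f 0 = 0 := by simpa using hK 0
  refine ⟨fun t ht => by simp [hx.zero t ht, h0], hf.comp_continuousOn hx.cont, δ, hδ,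
    fun T => ?_⟩
  obtain ⟨C, hC, h⟩ := h T
  refine ⟨|K| * C, fun t ht => (hK _).trans ?_⟩
  rw [mul_assoc]
  exact mul_le_mul (le_abs_self K) (h t ht) (norm_nonneg _) (abs_nonneg _)

theorem Mild.neg {V : Type*} [NormedAddCommGroup V] {x : ℝ → V} (hx : Mild x) :
    Mild fun t => -x t :=
  hx.comp_of_le continuous_neg 1 (by simp)

theorem Mild.sub {V : Type*} [NormedAddCommGroup V] {x y : ℝ → V} (hx : Mild x) (hy : Mild y) :
    Mild fun t => x t - y t := by
  simpa only [sub_eq_add_neg] using hx.add hy.neg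

theorem Mild.norm {V : Type*} [NormedAddCommGroup V] {x : ℝ → V} (hx : Mild x) :
    Mild fun t => ‖x t‖ :=
  hx.comp_of_le continuous_norm 1 (by simp)

theorem Mild.clm {V W : Type*} [NormedAddCommGroup V] [NormedAddCommGroup W] [NormedSpace ℝ V]
    [NormedSpace ℝ W] {x : ℝ → V} (hx : Mild x) (L : V →L[ℝ] W) : Mild fun t => L (x t) :=
  hx.comp_of_le L.continuous ‖L‖ L.le_opNorm

theorem Mild.mul_const {𝓐 : Type*} [NormedCommRing 𝓐] {x : ℝ → 𝓐}
    (hx : Mild x) (a : 𝓐) : Mild fun t => x t * a :=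
  hx.comp_of_le (continuous_mul_const a) ‖a‖ fun v => by rw [mul_comm ‖a‖]; exact norm_mul_le _ _

theorem Mild.sum {V ι : Type*} [NormedAddCommGroup V] {x : ι → ℝ → V} (s : Finset ι)
    (hx : ∀ i ∈ s, Mild (x i)) : Mild fun t => ∑ i ∈ s, x i t := by
  classical
  induction s using Finset.induction_on with
  | empty => simpa using mild_zero
  | insert i s hi ih =>
    simp only [Finset.sum_insert hi]
    exact (hx i (Finset.mem_insert_self i s)).add
      (ih fun j hj => hx j (Finset.mem_insert_of_mem hj))

theorem Mild.measurable {V : Type*} [NormedAddCommGroup V] {x : ℝ → V} (hx : Mild x) :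
    AEStronglyMeasurable x volume := by
  have h1 : AEStronglyMeasurable x (volume.restrict (Ioi 0)) :=
    hx.cont.aestronglyMeasurable measurableSet_Ioi
  have h2 : AEStronglyMeasurable x (volume.restrict (Iic 0)) := by
    refine (aestronglyMeasurable_const (b := (0 : V))).congr ?_
    filter_upwards [ae_restrict_mem measurableSet_Iic] with t ht using (hx.zero t ht).symm
  have h3 := aestronglyMeasurable_union_iff.2 ⟨h2, h1⟩
  rwa [Iic_union_Ioi, Measure.restrict_univ] at h3

theorem integrableOn_rpow_sub_one {δ : ℝ} (hδ : 0 < δ) (T : ℝ) :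
    IntegrableOn (fun t : ℝ => t ^ (δ - 1)) (Ioc 0 T) := by
  rcases le_or_gt T 0 with hT | hT
  · simp [Ioc_eq_empty (not_lt.2 hT)]
  rw [← intervalIntegrable_iff_integrableOn_Ioc_of_le hT.le]
  exact intervalIntegral.intervalIntegrable_rpow' (by linarith)

theorem Mild.integrableOn {V : Type*} [NormedAddCommGroup V] {x : ℝ → V} (hx : Mild x) (T : ℝ) :
    IntegrableOn x (Iic T) := by
  obtain ⟨δ, hδ, h⟩ := hx.bound
  obtain ⟨C, h⟩ := h T
  have h1 : IntegrableOn x (Ioc 0 T) := by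
    refine Integrable.mono' ((integrableOn_rpow_sub_one hδ T).const_mul C)
      hx.measurable.restrict ?_
    filter_upwards [ae_restrict_mem measurableSet_Ioc] with t ht using h t ht
  have h2 : IntegrableOn x (Iic 0) :=
    (integrable_zero _ _ _).congr (by
      filter_upwards [ae_restrict_mem measurableSet_Iic] with t ht using (hx.zero t ht).symm)
  refine (h2.union h1).mono_set fun t ht => ?_
  rcases le_or_gt t 0 with h0 | h0
  · exact Or.inl h0
  · exact Or.inr ⟨h0, ht⟩

theorem integrableOn_beta {a b : ℝ} (ha : 0 < a) (hb : 0 < b) :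
    IntegrableOn (fun r : ℝ => r ^ (a - 1) * (1 - r) ^ (b - 1)) (Ioo 0 1) := by
  have h := Complex.betaIntegral_convergent (u := a) (v := b) (by simpa) (by simpa)
  rw [intervalIntegrable_iff_integrableOn_Ioo_of_le zero_le_one] at h
  refine h.norm.congr ?_
  filter_upwards [ae_restrict_mem measurableSet_Ioo] with r hr
  have h1 : (0 : ℝ) < 1 - r := by linarith [hr.2]
  rw [norm_mul, show ((1 : ℂ) - r) = ((1 - r : ℝ) : ℂ) by push_cast; ring,
    Complex.norm_cpow_eq_rpow_re_of_pos hr.1, Complex.norm_cpow_eq_rpow_re_of_pos h1]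
  simp

section Conv

variable {𝓐 : Type*} [NormedCommRing 𝓐]

/-- Both factors vanish on t ≤ 0, so the whole-line convolution is the causal one over (0, t). -/
theorem cv_integrand_eq_zero {x y : ℝ → 𝓐} (hx : Mild x) (hy : Mild y) {t s : ℝ}
    (h : s ∉ Ioo 0 t) : x s * y (t - s) = 0 := by
  rcases le_or_gt s 0 with h0 | h0
  · rw [hx.zero s h0, zero_mul]
  · rw [hy.zero (t - s) (by by_contra h'; exact h ⟨h0, by linarith⟩), mul_zero]

theorem cv_scaled_bound {x y : ℝ → 𝓐} {a b t r C C' : ℝ} (hC : 0 ≤ C)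
    (ht : 0 < t) (hr : r ∈ Ioo (0 : ℝ) 1)
    (h : ∀ s ∈ Ioc 0 t, ‖x s‖ ≤ C * s ^ (a - 1)) (h' : ∀ s ∈ Ioc 0 t, ‖y s‖ ≤ C' * s ^ (b - 1)) :
    ‖x (t * r) * y (t * (1 - r))‖ ≤
      C * C' * t ^ (a + b - 2) * (r ^ (a - 1) * (1 - r) ^ (b - 1)) := by
  have h1 : 0 < 1 - r := by linarith [hr.2]
  have e1 := h (t * r) ⟨mul_pos ht hr.1, by nlinarith [hr.2]⟩
  have e2 := h' (t * (1 - r)) ⟨mul_pos ht h1, by nlinarith [hr.1]⟩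
  refine (norm_mul_le _ _).trans ((mul_le_mul e1 e2 (norm_nonneg _) ?_).trans_eq ?_)
  · exact mul_nonneg hC (Real.rpow_nonneg (mul_pos ht hr.1).le _)
  · rw [Real.mul_rpow ht.le hr.1.le, Real.mul_rpow ht.le h1.le,
      show a + b - 2 = (a - 1) + (b - 1) by ring, Real.rpow_add ht]
    ring

theorem cv_scaled_measurable {x y : ℝ → 𝓐} (hx : Mild x) (hy : Mild y) {t : ℝ} (ht : 0 < t) :
    AEStronglyMeasurable (fun r => x (t * r) * y (t * (1 - r))) (volume.restrict (Ioo 0 1)) := by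
  refine ContinuousOn.aestronglyMeasurable (ContinuousOn.mul ?_ ?_) measurableSet_Ioo
  · exact hx.cont.comp (by fun_prop) fun r hr => mul_pos ht hr.1
  · exact hy.cont.comp (by fun_prop) fun r hr => mul_pos ht (by linarith [hr.2])

variable [NormedAlgebra ℝ 𝓐]

/-- The convolution of `𝓐`-valued functions. -/
def cv (x y : ℝ → 𝓐) : ℝ → 𝓐 :=
  MeasureTheory.convolution x y (ContinuousLinearMap.mul ℝ 𝓐) volume

theorem cv_apply (x y : ℝ → 𝓐) (t : ℝ) : cv x y t = ∫ s, x s * y (t - s) := rfl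

theorem cv_comm (x y : ℝ → 𝓐) : cv x y = cv y x := by
  ext t
  rw [cv_apply, cv_apply, ← integral_sub_left_eq_self _ volume t]
  simp [mul_comm]

/-- The substitution s = t r fixes the domain of integration; continuity in t and the power bound
then both follow by domination with one beta density. -/
theorem cv_scaled {x y : ℝ → 𝓐} (hx : Mild x) (hy : Mild y) {t : ℝ} (ht : 0 < t) :
    cv x y t = t • ∫ r in Ioo (0 : ℝ) 1, x (t * r) * y (t * (1 - r)) := by
  have h := Measure.integral_comp_mul_left (fun s => x s * y (t - s)) t
  rw [cv_apply, setIntegral_eq_integral_of_forall_compl_eq_zero]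
  · rw [show (fun r => x (t * r) * y (t * (1 - r))) = fun r => x (t * r) * y (t - t * r) by
      ext r; ring_nf, h, abs_of_pos (inv_pos.2 ht), smul_smul, mul_inv_cancel₀ ht.ne', one_smul]
  · intro r hr
    have := cv_integrand_eq_zero hx hy (t := t) (s := t * r) fun h => hr
      ⟨by by_contra h'; exact absurd h.1 (not_lt.2 (mul_nonpos_of_nonneg_of_nonpos ht.le
        (not_lt.1 h'))), by
        have := h.2; by_contra h'; nlinarith⟩
    rw [← this]; ring_nf

theorem Mild.integrable_cv {x y : ℝ → 𝓐} (hx : Mild x) (hy : Mild y) (t : ℝ) :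
    Integrable fun s => x s * y (t - s) := by
  rcases le_or_gt t 0 with ht | ht
  · refine (integrable_zero ℝ 𝓐 volume).congr (Eventually.of_forall fun s => ?_)
    exact (cv_integrand_eq_zero hx hy (by simp [Ioo_eq_empty (not_lt.2 ht)])).symm
  obtain ⟨a, ha, h⟩ := hx.bound'
  obtain ⟨b, hb, h'⟩ := hy.bound'
  obtain ⟨C, hC, h⟩ := h t
  obtain ⟨C', hC', h'⟩ := h' t
  rw [← integrable_comp_mul_left_iff _ ht.ne', ← integrableOn_iff_integrable_of_support_subset
    (s := Ioo 0 1)]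
  · refine Integrable.mono' ((integrableOn_beta ha hb).const_mul (C * C' * t ^ (a + b - 2))) ?_ ?_
    · refine (cv_scaled_measurable hx hy ht).congr (Eventually.of_forall fun r => ?_)
      ring_nf
    · filter_upwards [ae_restrict_mem measurableSet_Ioo] with r hr
      have := cv_scaled_bound (x := x) (y := y) hC ht hr h h'
      rwa [show t * (1 - r) = t - t * r by ring] at this
  · intro r hr
    by_contra h0
    refine hr (cv_integrand_eq_zero hx hy fun h => h0 ⟨pos_of_mul_pos_right h.1 ht.le, ?_⟩)
    have := h.2; by_contra h'; nlinarith

/-- The orders of the singularities add: after rescaling, the bounds t^(a-1) and t^(b-1) give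
t^(a+b-1) times a beta integral. Continuity at a positive time is dominated convergence on (0, 1).
-/
theorem Mild.cv {x y : ℝ → 𝓐} (hx : Mild x) (hy : Mild y) : Mild (cv x y) := by
  obtain ⟨a, ha, h⟩ := hx.bound'
  obtain ⟨b, hb, h'⟩ := hy.bound'
  refine ⟨fun t ht => ?_, fun t₀ ht₀ => ContinuousAt.continuousWithinAt ?_, a + b, by positivity,
    fun T => ?_⟩
  · rw [cv_apply, integral_eq_zero_of_ae (Eventually.of_forall fun s => ?_)]
    exact cv_integrand_eq_zero hx hy (by simp [Ioo_eq_empty (not_lt.2 ht)])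
  · replace ht₀ : 0 < t₀ := ht₀
    obtain ⟨C, hC, h⟩ := h (2 * t₀)
    obtain ⟨C', hC', h'⟩ := h' (2 * t₀)
    have hev : ∀ᶠ t in 𝓝 t₀, t ∈ Icc (t₀ / 2) (2 * t₀) :=
      Icc_mem_nhds (by linarith) (by linarith)
    have hcont : ContinuousOn (fun t : ℝ => t ^ (a + b - 2)) (Icc (t₀ / 2) (2 * t₀)) :=
      fun t ht => (Real.continuousAt_rpow_const _ _ (Or.inl (by
        have := ht.1; linarith))).continuousWithinAt
    obtain ⟨M, hM⟩ := isCompact_Icc.exists_bound_of_continuousOn hcont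
    have hEq : FracCauchy.cv x y =ᶠ[𝓝 t₀]
        fun t => t • ∫ r in Ioo (0 : ℝ) 1, x (t * r) * y (t * (1 - r)) := by
      filter_upwards [lt_mem_nhds ht₀] with t ht using cv_scaled hx hy ht
    refine ContinuousAt.congr ?_ hEq.symm
    refine continuousAt_id.smul (continuousAt_of_dominated
      (bound := fun r => C * C' * M * (r ^ (a - 1) * (1 - r) ^ (b - 1))) ?_ ?_ ?_ ?_)
    · filter_upwards [lt_mem_nhds ht₀] with t ht using cv_scaled_measurable hx hy ht
    · filter_upwards [hev, lt_mem_nhds ht₀] with t ht ht0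
      filter_upwards [ae_restrict_mem measurableSet_Ioo] with r hr
      have h1 : 0 < 1 - r := by linarith [hr.2]
      refine (cv_scaled_bound hC ht0 hr (fun s hs => h s ⟨hs.1, hs.2.trans ht.2⟩)
        fun s hs => h' s ⟨hs.1, hs.2.trans ht.2⟩).trans ?_
      refine mul_le_mul_of_nonneg_right (mul_le_mul_of_nonneg_left
        ((le_abs_self _).trans (hM t ht)) (by positivity)) ?_
      exact mul_nonneg (Real.rpow_nonneg hr.1.le _) (Real.rpow_nonneg h1.le _)
    · exact (integrableOn_beta ha hb).const_mul _
    · filter_upwards [ae_restrict_mem measurableSet_Ioo] with r hr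
      have h1 : 0 < 1 - r := by linarith [hr.2]
      refine ContinuousAt.mul ?_ ?_
      · exact ContinuousAt.comp (f := fun t : ℝ => t * r)
          (hx.cont.continuousAt (Ioi_mem_nhds (mul_pos ht₀ hr.1))) (by fun_prop)
      · exact ContinuousAt.comp (f := fun t : ℝ => t * (1 - r))
          (hy.cont.continuousAt (Ioi_mem_nhds (mul_pos ht₀ h1))) (by fun_prop)
  · obtain ⟨C, hC, h⟩ := h T
    obtain ⟨C', hC', h'⟩ := h' T
    refine ⟨C * C' * ∫ r in Ioo (0 : ℝ) 1, r ^ (a - 1) * (1 - r) ^ (b - 1), fun t ht => ?_⟩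
    have ht0 := ht.1
    have key : ‖∫ r in Ioo (0 : ℝ) 1, x (t * r) * y (t * (1 - r))‖ ≤
        ∫ r in Ioo (0 : ℝ) 1, C * C' * t ^ (a + b - 2) * (r ^ (a - 1) * (1 - r) ^ (b - 1)) := by
      refine norm_integral_le_of_norm_le ((integrableOn_beta ha hb).const_mul _) ?_
      filter_upwards [ae_restrict_mem measurableSet_Ioo] with r hr
      exact cv_scaled_bound hC ht0 hr (fun s hs => h s ⟨hs.1, hs.2.trans ht.2⟩)
        fun s hs => h' s ⟨hs.1, hs.2.trans ht.2⟩
    rw [integral_const_mul] at key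
    rw [cv_scaled hx hy ht0, norm_smul, Real.norm_of_nonneg ht0.le]
    refine (mul_le_mul_of_nonneg_left key ht0.le).trans_eq ?_
    rw [show a + b - 1 = (a + b - 2) + 1 by ring, Real.rpow_add ht0, Real.rpow_one]
    ring

theorem cv_add {x y z : ℝ → 𝓐} (hx : Mild x) (hy : Mild y) (hz : Mild z) :
    cv x (fun t => y t + z t) = fun t => cv x y t + cv x z t := by
  ext t
  simp only [cv_apply, mul_add]
  exact integral_add (hx.integrable_cv hy t) (hx.integrable_cv hz t)

theorem cv_sub {x y z : ℝ → 𝓐} (hx : Mild x) (hy : Mild y) (hz : Mild z) :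
    cv x (fun t => y t - z t) = fun t => cv x y t - cv x z t := by
  ext t
  simp only [cv_apply, mul_sub]
  exact integral_sub (hx.integrable_cv hy t) (hx.integrable_cv hz t)

theorem cv_sum {ι : Type*} {x : ℝ → 𝓐} {y : ι → ℝ → 𝓐} (s : Finset ι) (hx : Mild x)
    (hy : ∀ i ∈ s, Mild (y i)) :
    cv x (fun t => ∑ i ∈ s, y i t) = fun t => ∑ i ∈ s, cv x (y i) t := by
  ext t
  simp only [cv_apply, Finset.mul_sum]
  exact integral_finsetSum _ fun i hi => hx.integrable_cv (hy i hi) t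

theorem cv_mul_const [CompleteSpace 𝓐] {x y : ℝ → 𝓐} (hx : Mild x) (hy : Mild y) (a : 𝓐) :
    cv x (fun t => y t * a) = fun t => cv x y t * a := by
  ext t
  simp only [cv_apply, ← mul_assoc]
  exact ((ContinuousLinearMap.mul ℝ 𝓐).flip a).integral_comp_comm (hx.integrable_cv hy t)

/-- Fubini; absolute convergence of the triple integral is the same statement for the norms, which
are again mild. -/
theorem cv_assoc [CompleteSpace 𝓐] {x y z : ℝ → 𝓐} (hx : Mild x) (hy : Mild y) (hz : Mild z) :
    cv (cv x y) z = cv x (cv y z) := by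
  ext t
  refine convolution_assoc _ _ _ _ (fun a b c => mul_assoc a b c) hx.measurable hy.measurable
    hz.measurable (Eventually.of_forall fun s => hx.integrable_cv hy s)
    (Eventually.of_forall fun s => hy.norm.integrable_cv hz.norm s) ?_
  exact hx.norm.integrable_cv (hy.norm.cv hz.norm) t

theorem map_cv {𝓑 : Type*} [NormedCommRing 𝓑] [NormedAlgebra ℝ 𝓑] [CompleteSpace 𝓐]
    [CompleteSpace 𝓑] (χ : 𝓐 →L[ℝ] 𝓑) (hχ : ∀ a b, χ (a * b) = χ a * χ b) {x y : ℝ → 𝓐}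
    (hx : Mild x) (hy : Mild y) (t : ℝ) :
    χ (cv x y t) = cv (fun s => χ (x s)) (fun s => χ (y s)) t := by
  simp only [cv_apply, ← hχ]
  exact (χ.integral_comp_comm (hx.integrable_cv hy t)).symm

end Conv

/-! ### Power kernels -/

/-- The kernel `t ^ (γ - 1) / Γ(γ)` of the fractional integral of order `γ`, on `t > 0`. -/
def powKer (γ t : ℝ) : ℝ := if 0 < t then t ^ (γ - 1) / Real.Gamma γ else 0

theorem powKer_of_pos {γ t : ℝ} (ht : 0 < t) : powKer γ t = t ^ (γ - 1) / Real.Gamma γ :=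
  if_pos ht

theorem powKer_of_nonpos {γ t : ℝ} (ht : t ≤ 0) : powKer γ t = 0 := if_neg (not_lt.2 ht)

theorem powKer_nonneg {γ : ℝ} (hγ : 0 < γ) (t : ℝ) : 0 ≤ powKer γ t := by
  unfold powKer
  split_ifs with h
  · exact div_nonneg (Real.rpow_nonneg h.le _) (Real.Gamma_pos_of_pos hγ).le
  · exact le_rfl

theorem continuousOn_inv_Gamma : ContinuousOn (fun γ : ℝ => (Real.Gamma γ)⁻¹) (Ioi 0) := by
  intro γ (hγ : 0 < γ)
  refine ContinuousAt.continuousWithinAt (ContinuousAt.inv₀ ?_ (Real.Gamma_pos_of_pos hγ).ne')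
  refine (Real.differentiableAt_Gamma fun k => ?_).continuousAt
  have : (0 : ℝ) ≤ k := k.cast_nonneg
  intro h
  linarith

theorem continuousOn_powKer :
    ContinuousOn (fun p : ℝ × ℝ => powKer p.1 p.2) (Ioi 0 ×ˢ Ioi 0) := by
  have h : ContinuousOn (fun p : ℝ × ℝ => p.2 ^ (p.1 - 1) * (Real.Gamma p.1)⁻¹)
      (Ioi 0 ×ˢ Ioi 0) := by
    refine ContinuousOn.mul ?_ (continuousOn_inv_Gamma.comp continuousOn_fst fun p hp => hp.1)
    exact ContinuousOn.rpow continuousOn_snd (continuousOn_fst.sub continuousOn_const)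
      fun p hp => Or.inl (ne_of_gt hp.2)
  exact h.congr fun p hp => by rw [powKer_of_pos hp.2, div_eq_mul_inv]

theorem mild_powKer {γ : ℝ} (hγ : 0 < γ) : Mild (powKer γ) := by
  refine ⟨fun t ht => powKer_of_nonpos ht, ?_, γ, hγ, fun T => ⟨(Real.Gamma γ)⁻¹, fun t ht => ?_⟩⟩
  · exact continuousOn_powKer.comp (f := fun t : ℝ => (γ, t)) (by fun_prop) fun t ht => ⟨hγ, ht⟩
  · rw [Real.norm_of_nonneg (powKer_nonneg hγ t), powKer_of_pos ht.1, div_eq_inv_mul]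

/-- The kernels with exponents in a compact interval have a common bound. -/
theorem exists_powKer_le {δ b : ℝ} (hδ : 0 < δ) :
    ∃ B ≥ 0, ∀ γ ∈ Icc δ b, ∀ t > 0, powKer γ t ≤ B * (t ^ (δ - 1) * Real.exp ((b - δ) * t)) := by
  obtain ⟨B, hB⟩ := isCompact_Icc.exists_bound_of_continuousOn
    (continuousOn_inv_Gamma.mono fun γ (hγ : γ ∈ Icc δ b) => hδ.trans_le hγ.1)
  refine ⟨|B|, abs_nonneg B, fun γ hγ t ht => ?_⟩
  rw [powKer_of_pos ht, div_eq_mul_inv, mul_comm]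
  refine mul_le_mul ((le_abs_self _).trans ((hB γ hγ).trans (le_abs_self B))) ?_
    (Real.rpow_nonneg ht.le _) (abs_nonneg B)
  rw [show γ - 1 = (δ - 1) + (γ - δ) by ring, Real.rpow_add ht]
  refine mul_le_mul_of_nonneg_left ?_ (Real.rpow_nonneg ht.le _)
  -- The excess power t^(γ-δ) is absorbed into an exponential, so that one bound serves both
  -- integrability at 0 and Laplace transforms at infinity.
  have h1 : t ≤ Real.exp t := by linarith [Real.add_one_le_exp t]
  calc t ^ (γ - δ) ≤ Real.exp t ^ (γ - δ) := Real.rpow_le_rpow ht.le h1 (by linarith [hγ.1])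
    _ = Real.exp (t * (γ - δ)) := (Real.exp_mul _ _).symm
    _ ≤ _ := Real.exp_le_exp.2 (by rw [mul_comm]; gcongr; exact hγ.2)

theorem integral_beta {a b : ℝ} (ha : 0 < a) (hb : 0 < b) :
    ∫ r in Ioo (0 : ℝ) 1, r ^ (a - 1) * (1 - r) ^ (b - 1) =
      Real.Gamma a * Real.Gamma b / Real.Gamma (a + b) := by
  have h1 := ProbabilityTheory.beta_eq_betaIntegralReal a b ha hb
  rw [ProbabilityTheory.beta] at h1
  rw [h1, Complex.betaIntegral, intervalIntegral.integral_of_le zero_le_one,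
      ← integral_Ioc_eq_integral_Ioo, ← RCLike.re_to_complex, ← integral_re]
  · refine setIntegral_congr_fun measurableSet_Ioc fun x ⟨hx1, hx₂⟩ ↦ ?_
    norm_cast
    rw [← Complex.ofReal_cpow, ← Complex.ofReal_cpow, RCLike.re_to_complex,
      Complex.re_mul_ofReal, Complex.ofReal_re]
    all_goals linarith
  · convert! Complex.betaIntegral_convergent (u := a) (v := b) (by simpa) (by simpa)
    rw [intervalIntegrable_iff_integrableOn_Ioc_of_le (by simp), IntegrableOn]

/-- The semigroup law J^a J^b = J^(a+b) is Euler's beta integral. -/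
theorem cv_powKer {a b : ℝ} (ha : 0 < a) (hb : 0 < b) :
    cv (powKer a) (powKer b) = powKer (a + b) := by
  ext t
  rcases le_or_gt t 0 with ht | ht
  · rw [((mild_powKer ha).cv (mild_powKer hb)).zero t ht, powKer_of_nonpos ht]
  rw [cv_scaled (mild_powKer ha) (mild_powKer hb) ht]
  have hEq : ∀ r ∈ Ioo (0 : ℝ) 1, powKer a (t * r) * powKer b (t * (1 - r)) =
      t ^ (a + b - 2) / (Real.Gamma a * Real.Gamma b) * (r ^ (a - 1) * (1 - r) ^ (b - 1)) := by
    intro r hr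
    have h1 : 0 < 1 - r := by linarith [hr.2]
    rw [powKer_of_pos (mul_pos ht hr.1), powKer_of_pos (mul_pos ht h1), Real.mul_rpow ht.le hr.1.le,
      Real.mul_rpow ht.le h1.le, show a + b - 2 = (a - 1) + (b - 1) by ring, Real.rpow_add ht]
    ring
  rw [setIntegral_congr_fun measurableSet_Ioo hEq, integral_const_mul, integral_beta ha hb,
    powKer_of_pos ht, show a + b - 1 = (a + b - 2) + 1 by ring, Real.rpow_add ht, Real.rpow_one,
    smul_eq_mul]
  have := (Real.Gamma_pos_of_pos ha).ne'
  have := (Real.Gamma_pos_of_pos hb).ne'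
  field_simp

section Alg

variable {𝓐 : Type*} [NormedCommRing 𝓐] [NormedAlgebra ℝ 𝓐]

variable (𝓐) in
/-- The kernel of the fractional integral of order `γ`, with values in the algebra `𝓐`. -/
def pk (γ t : ℝ) : 𝓐 := algebraMapCLM ℝ 𝓐 (powKer γ t)

theorem pk_mul (γ t : ℝ) (a : 𝓐) : pk 𝓐 γ t * a = powKer γ t • a :=
  (Algebra.smul_def _ _).symm

theorem mul_pk (γ t : ℝ) (a : 𝓐) : a * pk 𝓐 γ t = powKer γ t • a := by
  rw [mul_comm, pk_mul]

theorem mild_pk {γ : ℝ} (hγ : 0 < γ) : Mild (pk 𝓐 γ) := (mild_powKer hγ).clm (algebraMapCLM ℝ 𝓐)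

theorem cv_pk [CompleteSpace 𝓐] {a b : ℝ} (ha : 0 < a) (hb : 0 < b) :
    cv (pk 𝓐 a) (pk 𝓐 b) = pk 𝓐 (a + b) := by
  ext t
  have := map_cv (algebraMapCLM ℝ 𝓐) (fun _ _ => map_mul (algebraMap ℝ 𝓐) _ _)
    (mild_powKer ha) (mild_powKer hb) t
  rw [cv_powKer ha hb] at this
  exact this.symm

theorem pk_cv_apply {x : ℝ → 𝓐} (hx : Mild x) (γ : ℝ) {t : ℝ} (ht : 0 ≤ t) :
    cv (pk 𝓐 γ) x t = ∫ s in (0 : ℝ)..t, powKer γ (t - s) • x s := by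
  rw [cv_comm, cv_apply, intervalIntegral.integral_of_le ht, integral_Ioc_eq_integral_Ioo,
    setIntegral_eq_integral_of_forall_compl_eq_zero]
  · simp only [mul_pk]
  · intro s hs
    rcases le_or_gt s 0 with h0 | h0
    · rw [hx.zero s h0, smul_zero]
    · rw [powKer_of_nonpos (by by_contra h'; exact hs ⟨h0, by linarith⟩), zero_smul]

theorem pk_one_cv {x : ℝ → 𝓐} (hx : Mild x) (t : ℝ) :
    cv (pk 𝓐 1) x t = ∫ s in (0 : ℝ)..t, x s := by
  rcases le_or_gt t 0 with ht | ht
  · rw [((mild_pk one_pos).cv hx).zero t ht, intervalIntegral.integral_zero_ae]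
    refine Eventually.of_forall fun s hs => hx.zero s ?_
    rw [uIoc_of_ge ht] at hs
    exact hs.2
  · rw [pk_cv_apply hx 1 ht.le, intervalIntegral.integral_of_le ht.le,
      intervalIntegral.integral_of_le ht.le, integral_Ioc_eq_integral_Ioo,
      integral_Ioc_eq_integral_Ioo]
    refine setIntegral_congr_fun measurableSet_Ioo fun s hs => ?_
    rw [powKer_of_pos (by linarith [hs.2])]
    simp

end Alg

/-! ### Primitives of mild functions, and derivatives of fractional integrals -/

theorem Mild.intervalIntegrable {V : Type*} [NormedAddCommGroup V] {x : ℝ → V}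
    (hx : Mild x) (a b : ℝ) : IntervalIntegrable x volume a b := by
  rw [intervalIntegrable_iff]
  refine (hx.integrableOn (max a b)).mono_set fun s hs => ?_
  rw [uIoc] at hs
  exact hs.2

theorem Mild.continuous_primitive {V : Type*} [NormedAddCommGroup V] [NormedSpace ℝ V] {x : ℝ → V}
    (hx : Mild x) : Continuous fun t => ∫ s in (0 : ℝ)..t, x s :=
  intervalIntegral.continuous_primitive hx.intervalIntegrable 0

theorem Mild.hasDerivAt_primitive {V : Type*} [NormedAddCommGroup V] [NormedSpace ℝ V]
    [CompleteSpace V] {x : ℝ → V} (hx : Mild x) {t : ℝ} (ht : 0 < t) :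
    HasDerivAt (fun t => ∫ s in (0 : ℝ)..t, x s) (x t) t :=
  intervalIntegral.integral_hasDerivAt_right (hx.intervalIntegrable 0 t)
    (hx.cont.stronglyMeasurableAtFilter isOpen_Ioi t ht) (hx.cont.continuousAt (Ioi_mem_nhds ht))

section Alg

variable {𝓐 : Type*} [NormedCommRing 𝓐] [NormedAlgebra ℝ 𝓐] [CompleteSpace 𝓐]

theorem continuous_pk_cv {x : ℝ → 𝓐} (hx : Mild x) : Continuous (cv (pk 𝓐 1) x) := by
  rw [show cv (pk 𝓐 1) x = fun t => ∫ s in (0 : ℝ)..t, x s from funext fun t => pk_one_cv hx t]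
  exact hx.continuous_primitive

theorem continuous_pk_nat_cv {x : ℝ → 𝓐} (hx : Mild x) (n : ℕ) :
    Continuous (cv (pk 𝓐 (n + 1)) x) := by
  rcases n.eq_zero_or_pos with rfl | hn
  · simpa using continuous_pk_cv hx
  · have hn' : (0 : ℝ) < n := by exact_mod_cast hn
    rw [add_comm, ← cv_pk one_pos hn', cv_assoc (mild_pk one_pos) (mild_pk hn') hx]
    exact continuous_pk_cv ((mild_pk hn').cv hx)

theorem hasDerivAt_pk_one_cv {x : ℝ → 𝓐} (hx : Mild x) {t : ℝ} (ht : 0 < t) :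
    HasDerivAt (cv (pk 𝓐 1) x) (x t) t := by
  rw [show cv (pk 𝓐 1) x = fun t => ∫ s in (0 : ℝ)..t, x s from funext fun t => pk_one_cv hx t]
  exact hx.hasDerivAt_primitive ht

theorem hasDerivAt_pk_cv {x : ℝ → 𝓐} (hx : Mild x) {γ : ℝ} (hγ : 0 < γ) {t : ℝ} (ht : 0 < t) :
    HasDerivAt (cv (pk 𝓐 (γ + 1)) x) (cv (pk 𝓐 γ) x t) t := by
  rw [add_comm, ← cv_pk one_pos hγ, cv_assoc (mild_pk one_pos) (mild_pk hγ) hx]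
  exact hasDerivAt_pk_one_cv ((mild_pk hγ).cv hx) ht

/-! ### Distributed kernels -/

/-- The kernel `∫_S F(α) t ^ (a - α - 1) / Γ(a - α) λ(dα)`. -/
def distKer (lam : Measure ℝ) (F : ℝ → 𝓐) (S : Set ℝ) (a t : ℝ) : 𝓐 :=
  ∫ α in S, F α * pk 𝓐 (a - α) t ∂lam

variable {lam : Measure ℝ} [IsFiniteMeasure lam] {F : ℝ → 𝓐} {S : Set ℝ} {M a : ℝ}

/-- The exponents a - α stay in [a - M, a], away from 0, so the worst singularity t^(a-M-1) bounds
the integrand uniformly in α. -/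
theorem exists_norm_integrand_le (hF : Continuous F) (hS : S ⊆ Icc 0 M) (ha : M < a) :
    ∃ B ≥ 0, ∀ α ∈ S, ∀ t > 0, ‖F α * pk 𝓐 (a - α) t‖ ≤
      B * (t ^ (a - M - 1) * Real.exp (M * t)) := by
  obtain ⟨B, hB0, hB⟩ := exists_powKer_le (δ := a - M) (b := a) (by linarith)
  obtain ⟨C, hC⟩ := isCompact_Icc.exists_bound_of_continuousOn (hF.continuousOn (s := Icc 0 M))
  refine ⟨B * |C|, by positivity, fun α hα t ht => ?_⟩
  have h1 := hS hα
  have h2 := hB (a - α) ⟨by linarith [h1.2], by linarith [h1.1]⟩ t ht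
  rw [show a - (a - M) = M by ring] at h2
  rw [mul_pk, norm_smul, Real.norm_of_nonneg (powKer_nonneg (by linarith [h1.2]) t)]
  have h3 := (hC α h1).trans (le_abs_self C)
  calc _ ≤ B * (t ^ (a - M - 1) * Real.exp (M * t)) * |C| :=
        mul_le_mul h2 h3 (norm_nonneg _) (mul_nonneg hB0 (mul_nonneg
          (Real.rpow_nonneg ht.le _) (Real.exp_nonneg _)))
    _ = _ := by ring

theorem continuousOn_integrand (hF : Continuous F) (hS : S ⊆ Icc 0 M) (ha : M < a) :
    ContinuousOn (fun p : ℝ × ℝ => F p.2 * pk 𝓐 (a - p.2) p.1) (Ioi 0 ×ˢ S) := by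
  simp only [mul_pk]
  refine ContinuousOn.smul (f := fun p : ℝ × ℝ => powKer (a - p.2) p.1) ?_ (by fun_prop)
  refine continuousOn_powKer.comp (f := fun p : ℝ × ℝ => (a - p.2, p.1)) (by fun_prop) ?_
  rintro ⟨t, α⟩ ⟨ht, hα⟩
  exact ⟨by have := (hS hα).2; simp only [mem_Ioi]; linarith, ht⟩

theorem integrableOn_integrand (hF : Continuous F) (hSm : MeasurableSet S) (hS : S ⊆ Icc 0 M)
    (ha : M < a) (t : ℝ) : IntegrableOn (fun α => F α * pk 𝓐 (a - α) t) S lam := by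
  rcases le_or_gt t 0 with ht | ht
  · simp [mul_pk, powKer_of_nonpos ht]
  obtain ⟨B, -, hB⟩ := exists_norm_integrand_le hF hS ha
  refine Integrable.mono' (integrable_const (B * (t ^ (a - M - 1) * Real.exp (M * t)))) ?_ ?_
  · refine ContinuousOn.aestronglyMeasurable ?_ hSm
    exact (continuousOn_integrand hF hS ha).comp (f := fun α => (t, α)) (by fun_prop)
      fun α hα => ⟨ht, hα⟩
  · filter_upwards [ae_restrict_mem hSm] with α hα using hB α hα t ht

theorem exists_norm_distKer_le (hF : Continuous F) (hSm : MeasurableSet S) (hS : S ⊆ Icc 0 M)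
    (ha : M < a) : ∃ B ≥ 0, ∀ t > 0, ‖distKer lam F S a t‖ ≤
      B * (t ^ (a - M - 1) * Real.exp (M * t)) := by
  obtain ⟨B, hB0, hB⟩ := exists_norm_integrand_le hF hS ha
  refine ⟨B * (lam.restrict S).real univ, by positivity, fun t ht => ?_⟩
  refine (norm_integral_le_of_norm_le_const (C := B * (t ^ (a - M - 1) * Real.exp (M * t))) ?_).trans_eq
    (by ring)
  filter_upwards [ae_restrict_mem hSm] with α hα using hB α hα t ht

theorem mild_distKer (hF : Continuous F) (hSm : MeasurableSet S) (hM : 0 ≤ M) (hS : S ⊆ Icc 0 M)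
    (ha : M < a) : Mild (distKer lam F S a) := by
  refine ⟨fun t ht => ?_, fun t₀ ht₀ => ContinuousAt.continuousWithinAt ?_, a - M, by linarith,
    fun T => ?_⟩
  · simp [distKer, mul_pk, powKer_of_nonpos ht]
  · replace ht₀ : 0 < t₀ := ht₀
    obtain ⟨B, hB0, hB⟩ := exists_norm_integrand_le hF hS ha
    have hev : ∀ᶠ t in 𝓝 t₀, t ∈ Icc (t₀ / 2) (2 * t₀) :=
      Icc_mem_nhds (by linarith) (by linarith)
    have hcont : ContinuousOn (fun t : ℝ => t ^ (a - M - 1) * Real.exp (M * t))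
        (Icc (t₀ / 2) (2 * t₀)) := fun t ht => ContinuousAt.continuousWithinAt
      ((Real.continuousAt_rpow_const _ _ (Or.inl (by
        have := ht.1; linarith))).mul (by fun_prop))
    obtain ⟨C, hC⟩ := isCompact_Icc.exists_bound_of_continuousOn hcont
    refine continuousAt_of_dominated (bound := fun _ => B * C) ?_ ?_ (integrable_const _) ?_
    · exact Eventually.of_forall fun t => (integrableOn_integrand hF hSm hS ha t).1
    · filter_upwards [hev, lt_mem_nhds ht₀] with t ht ht0
      filter_upwards [ae_restrict_mem hSm] with α hα
      exact (hB α hα t ht0).trans (mul_le_mul_of_nonneg_left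
        ((le_abs_self _).trans (hC t ht)) hB0)
    · filter_upwards [ae_restrict_mem hSm] with α hα
      refine ((continuousOn_integrand hF hS ha).comp (s := Ioi 0) (f := fun t => (t, α))
        (by fun_prop) fun t ht => ⟨ht, hα⟩).continuousAt (Ioi_mem_nhds ht₀)
  · obtain ⟨B, hB0, hB⟩ := exists_norm_distKer_le (lam := lam) hF hSm hS ha
    refine ⟨B * Real.exp (M * T), fun t ht => (hB t ht.1).trans ?_⟩
    rw [mul_assoc, mul_comm (Real.exp _)]
    refine mul_le_mul_of_nonneg_left (mul_le_mul_of_nonneg_left (Real.exp_le_exp.2 ?_)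
      (Real.rpow_nonneg ht.1.le _)) hB0
    exact mul_le_mul_of_nonneg_left ht.2 hM

/-- The Fubini hypothesis for convolving a distributed kernel: the uniform bound in α dominates the
integrand by a function of s alone, and `lam` is finite. -/
theorem integrable_prod_integrand (hF : Continuous F) (hSm : MeasurableSet S) (hM : 0 ≤ M)
    (hS : S ⊆ Icc 0 M) (ha : M < a) {y : ℝ → 𝓐} (hy : Mild y) (t : ℝ) :
    Integrable (Function.uncurry fun s α => F α * pk 𝓐 (a - α) s * y (t - s))
      ((volume.restrict (Ioo 0 t)).prod (lam.restrict S)) := by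
  obtain ⟨B, hB0, hB⟩ := exists_norm_integrand_le hF hS ha
  have hdom : Integrable (fun p : ℝ × ℝ => (B * Real.exp (M * t)) *
      ‖(powKer (a - M) p.1 * Real.Gamma (a - M)) * ‖y (t - p.1)‖‖)
      ((volume.restrict (Ioo 0 t)).prod (lam.restrict S)) := by
    refine (Integrable.comp_fst (f := fun s => B * Real.exp (M * t) *
      ‖(powKer (a - M) s * Real.Gamma (a - M)) * ‖y (t - s)‖‖) ?_ _)
    -- The factor Γ(a - M) turns the kernel back into s^(a-M-1) on s > 0, written as a mild function
    -- so that its convolution with the norm of `y` converges.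
    have h1 := (((mild_powKer (γ := a - M) (by linarith)).mul_const (Real.Gamma (a - M))).integrable_cv
      hy.norm t).integrableOn (s := Ioo 0 t)
    exact h1.norm.const_mul _
  refine Integrable.mono' hdom ?_ ?_
  · rw [Measure.prod_restrict]
    refine ContinuousOn.aestronglyMeasurable ?_ (measurableSet_Ioo.prod hSm)
    refine ContinuousOn.mul ((continuousOn_integrand hF hS ha).mono
      (prod_mono_left fun s hs => hs.1)) ?_
    exact hy.cont.comp (f := fun p : ℝ × ℝ => t - p.1) (by fun_prop)
      fun p hp => sub_pos.2 hp.1.2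
  · rw [Measure.prod_restrict]
    filter_upwards [ae_restrict_mem (measurableSet_Ioo.prod hSm)] with p hp
    have h0 : 0 < p.1 := hp.1.1
    have hG := (Real.Gamma_pos_of_pos (show 0 < a - M by linarith))
    rw [norm_mul, norm_norm, powKer_of_pos h0, div_mul_cancel₀ _ hG.ne',
      Real.norm_of_nonneg (Real.rpow_nonneg h0.le _), ← mul_assoc]
    refine (norm_mul_le _ _).trans (mul_le_mul_of_nonneg_right ((hB p.2 hp.2 p.1 h0).trans ?_)
      (norm_nonneg _))
    rw [mul_assoc, mul_comm (Real.exp _)]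
    refine mul_le_mul_of_nonneg_left (mul_le_mul_of_nonneg_left (Real.exp_le_exp.2 ?_)
      (Real.rpow_nonneg h0.le _)) hB0
    exact mul_le_mul_of_nonneg_left hp.1.2.le hM

theorem mul_cv_eq_integral (hS : S ⊆ Icc 0 M) (ha : M < a) {y : ℝ → 𝓐} (hy : Mild y) (t : ℝ) {α : ℝ}
    (hα : α ∈ S) : F α * cv (pk 𝓐 (a - α)) y t =
      ∫ s in Ioo 0 t, F α * pk 𝓐 (a - α) s * y (t - s) := by
  have hpos : 0 < a - α := by linarith [(hS hα).2]
  rw [cv_apply, setIntegral_eq_integral_of_forall_compl_eq_zero]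
  · simp only [mul_assoc]
    exact (((ContinuousLinearMap.mul ℝ 𝓐) (F α)).integral_comp_comm
      ((mild_pk hpos).integrable_cv hy t)).symm
  · intro s hs
    rw [mul_assoc, cv_integrand_eq_zero (mild_pk hpos) hy hs, mul_zero]

theorem integrableOn_mul_cv (hF : Continuous F) (hSm : MeasurableSet S) (hM : 0 ≤ M)
    (hS : S ⊆ Icc 0 M) (ha : M < a) {y : ℝ → 𝓐} (hy : Mild y) (t : ℝ) :
    IntegrableOn (fun α => F α * cv (pk 𝓐 (a - α)) y t) S lam := by
  refine IntegrableOn.congr_fun ?_ (fun α hα => (mul_cv_eq_integral hS ha hy t hα).symm) hSm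
  exact (integrable_prod_integrand hF hSm hM hS ha hy t).integral_prod_right

theorem distKer_cv (hF : Continuous F) (hSm : MeasurableSet S) (hM : 0 ≤ M) (hS : S ⊆ Icc 0 M)
    (ha : M < a) {y : ℝ → 𝓐} (hy : Mild y) (t : ℝ) :
    cv (distKer lam F S a) y t = ∫ α in S, F α * cv (pk 𝓐 (a - α)) y t ∂lam := by
  have hlhs : cv (distKer lam F S a) y t =
      ∫ s in Ioo 0 t, ∫ α in S, F α * pk 𝓐 (a - α) s * y (t - s) ∂lam := by
    rw [cv_apply, ← setIntegral_eq_integral_of_forall_compl_eq_zero (s := Ioo 0 t)]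
    · refine integral_congr_ae (Eventually.of_forall fun s => ?_)
      exact (((ContinuousLinearMap.mul ℝ 𝓐).flip (y (t - s))).integral_comp_comm
        (integrableOn_integrand hF hSm hS ha s)).symm
    · intro s hs
      exact cv_integrand_eq_zero (mild_distKer hF hSm hM hS ha) hy hs
  rw [hlhs, setIntegral_congr_fun hSm fun α hα => mul_cv_eq_integral hS ha hy t hα]
  exact integral_integral_swap (integrable_prod_integrand hF hSm hM hS ha hy t)

theorem pk_cv_distKer (hF : Continuous F) (hSm : MeasurableSet S) (hM : 0 ≤ M) (hS : S ⊆ Icc 0 M)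
    (ha : M < a) {b : ℝ} (hb : 0 < b) :
    cv (pk 𝓐 b) (distKer lam F S a) = distKer lam F S (a + b) := by
  ext t
  rw [cv_comm, distKer_cv hF hSm hM hS ha (mild_pk hb), distKer]
  refine setIntegral_congr_fun hSm fun α hα => ?_
  rw [cv_pk (by linarith [(hS hα).2]) hb, sub_add_eq_add_sub]

end Alg

/-! ### The resolvent kernel of a weakly singular Volterra equation -/

/-- `s ^ (δ - 1) e ^ (-τ s)` on `s > 0`. -/
def expPow (δ τ s : ℝ) : ℝ := (Ioi (0 : ℝ)).indicator (fun s => s ^ (δ - 1) * Real.exp (-(τ * s))) s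

theorem expPow_of_pos {δ τ s : ℝ} (hs : 0 < s) :
    expPow δ τ s = s ^ (δ - 1) * Real.exp (-(τ * s)) := indicator_of_mem (mem_Ioi.2 hs) _

theorem expPow_nonneg (δ τ s : ℝ) : 0 ≤ expPow δ τ s :=
  indicator_nonneg (fun s (hs : 0 < s) => mul_nonneg (Real.rpow_nonneg hs.le _) (Real.exp_nonneg _)) s

theorem integral_expPow {δ τ : ℝ} (hδ : 0 < δ) (hτ : 0 < τ) :
    ∫ s, expPow δ τ s = (1 / τ) ^ δ * Real.Gamma δ := by
  unfold expPow
  rw [integral_indicator measurableSet_Ioi, Real.integral_rpow_mul_exp_neg_mul_Ioi hδ hτ]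

theorem integrable_expPow {δ τ : ℝ} (hδ : 0 < δ) (hτ : 0 < τ) : Integrable (expPow δ τ) := by
  refine not_imp_comm.1 integral_undef ?_
  rw [integral_expPow hδ hτ]
  have := Real.Gamma_pos_of_pos hδ
  positivity

section Alg

variable {𝓐 : Type*} [NormedCommRing 𝓐] [NormedAlgebra ℝ 𝓐]

/-- The two growth rates differ by τ, which leaves a factor e^(-τs). On each half of (0, t) the
power singular at the far endpoint is at most (t/2)^(δ-1), because δ ≤ 1; the other power times the
exponential is integrable over the whole half-line. -/
theorem norm_cv_integrand_le {x y : ℝ → 𝓐} {M N δ σ τ : ℝ} (hδ : δ ≤ 1) (hτ : 0 ≤ τ)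
    (hM : 0 ≤ M) (hN : 0 ≤ N) (hx : Mild x) (hy : Mild y)
    (hxM : ∀ t > 0, ‖x t‖ ≤ M * (t ^ (δ - 1) * Real.exp (σ * t)))
    (hyN : ∀ t > 0, ‖y t‖ ≤ N * (t ^ (δ - 1) * Real.exp ((σ + τ) * t))) {t : ℝ} (ht : 0 < t)
    (s : ℝ) : ‖x s * y (t - s)‖ ≤ M * N * (Real.exp ((σ + τ) * t) * (t / 2) ^ (δ - 1)) *
      (expPow δ τ s + expPow δ τ (t - s)) := by
  by_cases hs : s ∈ Ioo 0 t
  swap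
  · rw [cv_integrand_eq_zero hx hy hs, norm_zero]
    have := expPow_nonneg δ τ s
    have := expPow_nonneg δ τ (t - s)
    positivity
  have h0 := hs.1
  have h1 : 0 < t - s := by linarith [hs.2]
  have key : s ^ (δ - 1) * (t - s) ^ (δ - 1) * Real.exp (-(τ * s)) ≤
      (t / 2) ^ (δ - 1) * (expPow δ τ s + expPow δ τ (t - s)) := by
    rcases le_total s (t / 2) with h | h
    · have e1 : (t - s) ^ (δ - 1) ≤ (t / 2) ^ (δ - 1) :=
        Real.rpow_le_rpow_of_nonpos (by linarith) (by linarith) (by linarith)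
      calc _ = (t - s) ^ (δ - 1) * expPow δ τ s := by rw [expPow_of_pos h0]; ring
        _ ≤ (t / 2) ^ (δ - 1) * expPow δ τ s := mul_le_mul_of_nonneg_right e1 (expPow_nonneg _ _ _)
        _ ≤ _ := mul_le_mul_of_nonneg_left (by linarith [expPow_nonneg δ τ (t - s)])
            (by positivity)
    · have e1 : s ^ (δ - 1) ≤ (t / 2) ^ (δ - 1) :=
        Real.rpow_le_rpow_of_nonpos (by linarith) (by linarith) (by linarith)
      -- On the right half s ≥ t - s, so the decay in s may be weakened to decay in the distance t -
      -- s to the singularity.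
      have e2 : Real.exp (-(τ * s)) ≤ Real.exp (-(τ * (t - s))) :=
        Real.exp_le_exp.2 (neg_le_neg (mul_le_mul_of_nonneg_left (by linarith) hτ))
      calc _ = s ^ (δ - 1) * ((t - s) ^ (δ - 1) * Real.exp (-(τ * s))) := by ring
        _ ≤ (t / 2) ^ (δ - 1) * ((t - s) ^ (δ - 1) * Real.exp (-(τ * (t - s)))) :=
          mul_le_mul e1 (mul_le_mul_of_nonneg_left e2 (by positivity)) (by positivity)
            (by positivity)
        _ = (t / 2) ^ (δ - 1) * expPow δ τ (t - s) := by rw [expPow_of_pos h1]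
        _ ≤ _ := mul_le_mul_of_nonneg_left (by linarith [expPow_nonneg δ τ s])
            (by positivity)
  calc ‖x s * y (t - s)‖ ≤ ‖x s‖ * ‖y (t - s)‖ := norm_mul_le _ _
    _ ≤ (M * (s ^ (δ - 1) * Real.exp (σ * s))) *
        (N * ((t - s) ^ (δ - 1) * Real.exp ((σ + τ) * (t - s)))) :=
      mul_le_mul (hxM s h0) (hyN _ h1) (norm_nonneg _) (by positivity)
    _ = M * N * Real.exp ((σ + τ) * t) *
        (s ^ (δ - 1) * (t - s) ^ (δ - 1) * Real.exp (-(τ * s))) := by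
      rw [show (σ + τ) * t = σ * s + (σ + τ) * (t - s) + τ * s by ring, Real.exp_add, Real.exp_add,
        Real.exp_neg]
      field_simp
    _ ≤ M * N * Real.exp ((σ + τ) * t) *
        ((t / 2) ^ (δ - 1) * (expPow δ τ s + expPow δ τ (t - s))) :=
      mul_le_mul_of_nonneg_left key (by positivity)
    _ = _ := by ring

theorem integrable_expPow_add {δ τ : ℝ} (hδ : 0 < δ) (hτ : 0 < τ) (t : ℝ) :
    Integrable fun s => expPow δ τ s + expPow δ τ (t - s) :=
  (integrable_expPow hδ hτ).add ((integrable_expPow hδ hτ).comp_sub_left t)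

/-- Convolution with x preserves the profile t^(δ-1) e^((σ+τ)t), and costs a factor proportional to
τ^(-δ), the mass of the remaining gamma density. -/
theorem norm_cv_le {x y : ℝ → 𝓐} {M N δ σ τ : ℝ} (hδ0 : 0 < δ) (hδ : δ ≤ 1) (hτ : 0 < τ)
    (hM : 0 ≤ M) (hN : 0 ≤ N) (hx : Mild x) (hy : Mild y)
    (hxM : ∀ t > 0, ‖x t‖ ≤ M * (t ^ (δ - 1) * Real.exp (σ * t)))
    (hyN : ∀ t > 0, ‖y t‖ ≤ N * (t ^ (δ - 1) * Real.exp ((σ + τ) * t))) {t : ℝ} (ht : 0 < t) :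
    ‖cv x y t‖ ≤ M * N * (2 * (1 / 2) ^ (δ - 1) * Real.Gamma δ * (1 / τ) ^ δ) *
      (t ^ (δ - 1) * Real.exp ((σ + τ) * t)) := by
  rw [cv_apply]
  refine (norm_integral_le_of_norm_le ((integrable_expPow_add hδ0 hτ t).const_mul _)
    (Eventually.of_forall (norm_cv_integrand_le hδ hτ.le hM hN hx hy hxM hyN ht))).trans_eq ?_
  rw [integral_const_mul, integral_add (integrable_expPow hδ0 hτ)
    ((integrable_expPow hδ0 hτ).comp_sub_left t), integral_sub_left_eq_self, integral_expPow hδ0 hτ,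
    show t / 2 = t * (1 / 2) by ring, Real.mul_rpow ht.le (by norm_num)]
  ring

theorem exists_contraction_rate {M δ : ℝ} (hδ0 : 0 < δ) : ∃ τ > 0,
    M * (2 * (1 / 2) ^ (δ - 1) * Real.Gamma δ * (1 / τ) ^ δ) ≤ 1 / 2 := by
  have h1 : Tendsto (fun τ : ℝ => M * (2 * (1 / 2) ^ (δ - 1) * Real.Gamma δ * (1 / τ) ^ δ)) atTop
      (𝓝 (M * (2 * (1 / 2) ^ (δ - 1) * Real.Gamma δ * 0))) := by
    refine Tendsto.const_mul _ (Tendsto.const_mul _ ?_)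
    have := (tendsto_rpow_neg_atTop hδ0)
    refine this.congr' ?_
    filter_upwards [eventually_gt_atTop 0] with τ hτ
    rw [Real.rpow_neg hτ.le, one_div, Real.inv_rpow hτ.le]
  rw [mul_zero, mul_zero] at h1
  obtain ⟨τ, h, h'⟩ := ((h1.eventually (ge_mem_nhds (show (0 : ℝ) < 1 / 2 by norm_num))).and
    (eventually_gt_atTop 0)).exists
  exact ⟨τ, h', h⟩

/-- The iterated kernels `K, -K ⋆ K, K ⋆ K ⋆ K, …`. -/
def iterKer (K : ℝ → 𝓐) : ℕ → ℝ → 𝓐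
  | 0 => K
  | n + 1 => fun t => -cv K (iterKer K n) t

theorem mild_iterKer {K : ℝ → 𝓐} (hK : Mild K) : ∀ n, Mild (iterKer K n)
  | 0 => hK
  | n + 1 => (hK.cv (mild_iterKer hK n)).neg

theorem norm_iterKer_le {K : ℝ → 𝓐} (hK : Mild K) {M δ σ τ : ℝ} (hδ0 : 0 < δ) (hδ : δ ≤ 1)
    (hM : 0 ≤ M) (hτ : 0 < τ) (hθ : M * (2 * (1 / 2) ^ (δ - 1) * Real.Gamma δ * (1 / τ) ^ δ) ≤ 1 / 2)
    (hKM : ∀ t > 0, ‖K t‖ ≤ M * (t ^ (δ - 1) * Real.exp (σ * t))) (n : ℕ) : ∀ t > 0,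
    ‖iterKer K n t‖ ≤ M * (1 / 2) ^ n * (t ^ (δ - 1) * Real.exp ((σ + τ) * t)) := by
  induction n with
  | zero =>
    intro t ht
    refine (hKM t ht).trans ?_
    rw [pow_zero, mul_one]
    gcongr
    linarith
  | succ n ih =>
    intro t ht
    rw [iterKer, norm_neg]
    refine (norm_cv_le hδ0 hδ hτ hM (by positivity) hK (mild_iterKer hK n) hKM ih ht).trans ?_
    refine mul_le_mul_of_nonneg_right ?_ (by positivity)
    calc _ = M * (1 / 2) ^ n * (M * (2 * (1 / 2) ^ (δ - 1) * Real.Gamma δ * (1 / τ) ^ δ)) := by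
          ring
      _ ≤ M * (1 / 2) ^ n * (1 / 2) := mul_le_mul_of_nonneg_left hθ (by positivity)
      _ = _ := by ring

theorem summable_half_pow (M : ℝ) : Summable fun n : ℕ => M * (1 / 2 : ℝ) ^ n :=
  (summable_geometric_of_lt_one (by norm_num) (by norm_num)).mul_left M

theorem mild_tsum [CompleteSpace 𝓐] {y : ℕ → ℝ → 𝓐} (hy : ∀ n, Mild (y n)) {M δ ρ : ℝ}
    (hδ0 : 0 < δ) (hM : 0 ≤ M)
    (hb : ∀ n, ∀ t > 0, ‖y n t‖ ≤ M * (1 / 2) ^ n * (t ^ (δ - 1) * Real.exp (ρ * t))) :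
    (∀ t, Summable fun n => y n t) ∧ (Mild fun t => ∑' n, y n t) ∧
      ∃ C, ∀ t > 0, ‖∑' n, y n t‖ ≤ C * (t ^ (δ - 1) * Real.exp (ρ * t)) := by
  have hgeo := summable_half_pow M
  have hsum : ∀ t, Summable fun n => y n t := by
    intro t
    rcases le_or_gt t 0 with ht | ht
    · exact summable_zero.congr fun n => ((hy n).zero t ht).symm
    · exact Summable.of_norm_bounded (hgeo.mul_right _) fun n => hb n t ht
  have hbq : ∀ t > 0, ‖∑' n, y n t‖ ≤
      (∑' n : ℕ, M * (1 / 2) ^ n) * (t ^ (δ - 1) * Real.exp (ρ * t)) := fun t ht =>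
    tsum_of_norm_bounded (hgeo.hasSum.mul_right _) fun n => hb n t ht
  refine ⟨hsum, ⟨fun t ht => ?_, ?_, δ, hδ0, fun T => ?_⟩, _, hbq⟩
  · simp [(hy _).zero t ht]
  · have hc : ContinuousOn (fun t : ℝ => t ^ (δ - 1) * Real.exp (ρ * t)) (Ioi 0) :=
      fun t ht => ((Real.continuousAt_rpow_const _ _ (Or.inl (ne_of_gt ht))).mul
        (by fun_prop)).continuousWithinAt
    have hpos : ∀ t ∈ Ioi (0 : ℝ), 0 < t ^ (δ - 1) * Real.exp (ρ * t) := fun t ht =>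
      mul_pos (Real.rpow_pos_of_pos ht _) (Real.exp_pos _)
    -- Divided by the common weight, the series converges uniformly, although the functions
    -- themselves may be unbounded at 0.
    have h1 : ContinuousOn (fun t : ℝ => ∑' n,
        (t ^ (δ - 1) * Real.exp (ρ * t))⁻¹ • y n t) (Ioi 0) := by
      refine continuousOn_tsum (fun n => (hc.inv₀ fun t ht => (hpos t ht).ne').smul
        (hy n).cont) hgeo fun n t ht => ?_
      rw [norm_smul, norm_inv, Real.norm_of_nonneg (hpos t ht).le, inv_mul_le_iff₀ (hpos t ht),
        mul_comm]
      exact hb n t ht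
    refine (hc.smul h1).congr fun t ht => ?_
    rw [Pi.smul_apply', ((hsum t).tsum_const_smul _), smul_smul, mul_inv_cancel₀ (hpos t ht).ne', one_smul]
  · refine ⟨(∑' n : ℕ, M * (1 / 2) ^ n) * Real.exp (|ρ| * T), fun t ht =>
      (hbq t ht.1).trans ?_⟩
    have : 0 ≤ ∑' n : ℕ, M * (1 / 2 : ℝ) ^ n := tsum_nonneg fun n => by positivity
    have ht0 := ht.1
    rw [mul_assoc, mul_comm (Real.exp _)]
    gcongr
    · exact le_abs_self _
    · exact ht.2

theorem hasSum_cv [CompleteSpace 𝓐] {K : ℝ → 𝓐} {y : ℕ → ℝ → 𝓐} (hK : Mild K)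
    (hy : ∀ n, Mild (y n)) {M M' δ σ τ : ℝ} (hδ0 : 0 < δ) (hδ : δ ≤ 1) (hM : 0 ≤ M) (hM' : 0 ≤ M')
    (hτ : 0 < τ) (hKM : ∀ t > 0, ‖K t‖ ≤ M * (t ^ (δ - 1) * Real.exp (σ * t)))
    (hb : ∀ n, ∀ t > 0, ‖y n t‖ ≤ M' * (1 / 2) ^ n * (t ^ (δ - 1) * Real.exp ((σ + τ) * t)))
    (t : ℝ) : HasSum (fun n => cv K (y n) t) (cv K (fun t => ∑' n, y n t) t) := by
  obtain ⟨hsum, hq, -⟩ := mild_tsum hy hδ0 hM' hb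
  rcases le_or_gt t 0 with ht | ht
  · rw [(hK.cv hq).zero t ht]
    simp only [(hK.cv (hy _)).zero t ht]
    exact hasSum_zero
  simp only [cv_apply]
  refine hasSum_integral_of_dominated_convergence (fun n s => M * (M' * (1 / 2) ^ n) *
    (Real.exp ((σ + τ) * t) * (t / 2) ^ (δ - 1)) * (expPow δ τ s + expPow δ τ (t - s)))
    (fun n => (hK.integrable_cv (hy n) t).1)
    (fun n => Eventually.of_forall (norm_cv_integrand_le hδ hτ.le hM (by positivity) hK (hy n)
      hKM (hb n) ht)) ?_ ?_ ?_
  · exact Eventually.of_forall fun s => (((summable_half_pow M').mul_left M).mul_right _).mul_right _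
  · simp only [tsum_mul_right]
    exact (integrable_expPow_add hδ0 hτ t).const_mul _
  · exact Eventually.of_forall fun s => (hsum _).hasSum.mul_left (K s)

/-- With K_0 = K and K_(n+1) = -K⋆K_n, the sum q of the K_n satisfies K⋆q = -(K_1 + K_2 + ⋯) = K -
q. A large τ makes the weighted norms of the K_n decay like 2^(-n). -/
theorem exists_resolventKernel [CompleteSpace 𝓐] {K : ℝ → 𝓐} (hK : Mild K) {M δ σ : ℝ}
    (hδ0 : 0 < δ) (hδ : δ ≤ 1) (hM : 0 ≤ M)
    (hKM : ∀ t > 0, ‖K t‖ ≤ M * (t ^ (δ - 1) * Real.exp (σ * t))) :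
    ∃ q : ℝ → 𝓐, Mild q ∧ (∀ t, q t + cv K q t = K t) ∧
      ∃ C ρ, ∀ t > 0, ‖q t‖ ≤ C * (t ^ (δ - 1) * Real.exp (ρ * t)) := by
  obtain ⟨τ, hτ, hθ⟩ := exists_contraction_rate (M := M) hδ0
  have hKs := mild_iterKer hK
  have hb := norm_iterKer_le hK hδ0 hδ hM hτ hθ hKM
  obtain ⟨hsum, hq, C, hC⟩ := mild_tsum hKs hδ0 hM hb
  refine ⟨fun t => ∑' n, iterKer K n t, hq, fun t => ?_, C, σ + τ, hC⟩
  have h1 := hasSum_cv hK hKs hδ0 hδ hM hM hτ hKM hb t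
  have h2 : HasSum (fun n => iterKer K (n + 1) t) (-cv K (fun t => ∑' n, iterKer K n t) t) := h1.neg
  have h3 : HasSum (fun n => iterKer K n t) _ := (hasSum_nat_add_iff 1).1 h2
  have h4 := h3.tsum_eq
  rw [Finset.sum_range_one, iterKer] at h4
  change (∑' n, iterKer K n t) + _ = _
  rw [h4]
  abel

end Alg

/-! ### Laplace transforms -/

section Alg

variable {𝓐 : Type*} [NormedCommRing 𝓐] [NormedAlgebra ℝ 𝓐] [CompleteSpace 𝓐]

/-- `e ^ (-s t) x(t)`. -/
def damp (s : ℝ) (x : ℝ → 𝓐) (t : ℝ) : 𝓐 := Real.exp (-(s * t)) • x t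

/-- The exponential is multiplicative, so damping commutes with convolution and the Laplace
convolution theorem becomes the one for integrable functions on the line. -/
theorem damp_cv (s : ℝ) (x y : ℝ → 𝓐) : damp s (cv x y) = cv (damp s x) (damp s y) := by
  ext t
  simp only [damp, cv_apply, ← integral_smul]
  refine integral_congr_ae (Eventually.of_forall fun r => ?_)
  simp only
  rw [smul_mul_smul_comm, ← Real.exp_add]
  ring_nf

theorem integrable_damp_cv {s : ℝ} {x y : ℝ → 𝓐} (hx : Integrable (damp s x))
    (hy : Integrable (damp s y)) : Integrable (damp s (cv x y)) := by
  rw [damp_cv]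
  exact hx.integrable_convolution _ hy

theorem integral_damp_cv {s : ℝ} {x y : ℝ → 𝓐} (hx : Integrable (damp s x))
    (hy : Integrable (damp s y)) :
    ∫ t, damp s (cv x y) t = (∫ t, damp s x t) * ∫ t, damp s y t := by
  rw [damp_cv]
  exact integral_convolution _ hx hy

theorem integrable_damp {x : ℝ → 𝓐} (hx : Mild x) {C δ ρ s : ℝ} (hδ : 0 < δ)
    (h : ∀ t > 0, ‖x t‖ ≤ C * (t ^ (δ - 1) * Real.exp (ρ * t))) (hs : ρ < s) :
    Integrable (damp s x) := by
  refine Integrable.mono' ((integrable_expPow hδ (sub_pos.2 hs)).const_mul C)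
    ((Continuous.aestronglyMeasurable (by fun_prop)).smul hx.measurable)
    (Eventually.of_forall fun t => ?_)
  rcases le_or_gt t 0 with ht | ht
  · rw [damp, hx.zero t ht, smul_zero, norm_zero, expPow, indicator_of_notMem (by simpa using ht),
      mul_zero]
  · rw [damp, norm_smul, Real.norm_of_nonneg (Real.exp_nonneg _), expPow_of_pos ht]
    refine (mul_le_mul_of_nonneg_left (h t ht) (Real.exp_nonneg _)).trans_eq ?_
    rw [show -((s - ρ) * t) = -(s * t) + ρ * t by ring, Real.exp_add]
    ring

theorem damp_pk (s γ : ℝ) : damp s (pk 𝓐 γ) =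
    fun t => algebraMapCLM ℝ 𝓐 ((Real.Gamma γ)⁻¹ * expPow γ s t) := by
  ext t
  rw [damp, pk, ← map_smul, smul_eq_mul]
  congr 1
  rcases le_or_gt t 0 with ht | ht
  · rw [powKer_of_nonpos ht, expPow, indicator_of_notMem (by simpa using ht)]
    ring
  · rw [powKer_of_pos ht, expPow_of_pos ht]
    ring

theorem integrable_damp_pk {γ s : ℝ} (hγ : 0 < γ) (hs : 0 < s) :
    Integrable (damp s (pk 𝓐 γ)) := by
  rw [damp_pk]
  exact (algebraMapCLM ℝ 𝓐).integrable_comp ((integrable_expPow hγ hs).const_mul _)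

theorem integral_damp_pk {γ s : ℝ} (hγ : 0 < γ) (hs : 0 < s) :
    ∫ t, damp s (pk 𝓐 γ) t = algebraMap ℝ 𝓐 (s ^ (-γ)) := by
  rw [damp_pk, (algebraMapCLM ℝ 𝓐).integral_comp_comm ((integrable_expPow hγ hs).const_mul _),
    integral_const_mul, integral_expPow hγ hs, one_div, Real.inv_rpow hs.le, Real.rpow_neg hs.le]
  have := (Real.Gamma_pos_of_pos hγ).ne'
  rw [show (Real.Gamma γ)⁻¹ * ((s ^ γ)⁻¹ * Real.Gamma γ) = (s ^ γ)⁻¹ by field_simp]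
  rfl

/-- Fubini, with the transform s^(α-a) of each power kernel. The uniform bound on the kernels grows
like e^(Mt), whence the condition M < s. -/
theorem integral_damp_distKer {lam : Measure ℝ} [IsFiniteMeasure lam] {F : ℝ → 𝓐} {S : Set ℝ}
    {M a s : ℝ} (hF : Continuous F) (hSm : MeasurableSet S) (hM : 0 ≤ M) (hS : S ⊆ Icc 0 M)
    (ha : M < a) (hs : M < s) :
    ∫ t, damp s (distKer lam F S a) t = ∫ α in S, F α * algebraMap ℝ 𝓐 (s ^ (α - a)) ∂lam := by
  obtain ⟨B, hB0, hB⟩ := exists_norm_integrand_le hF hS ha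
  have hpos : ∀ α ∈ S, 0 < a - α := fun α hα => by linarith [(hS hα).2]
  have h1 : ∀ α ∈ S, F α * algebraMap ℝ 𝓐 (s ^ (α - a)) =
      ∫ t in Ioi 0, Real.exp (-(s * t)) • (F α * pk 𝓐 (a - α) t) := by
    intro α hα
    rw [setIntegral_eq_integral_of_forall_compl_eq_zero, show α - a = -(a - α) by ring,
      ← integral_damp_pk (hpos α hα) (hM.trans_lt hs)]
    · refine (((ContinuousLinearMap.mul ℝ 𝓐) (F α)).integral_comp_comm
        (integrable_damp_pk (hpos α hα) (hM.trans_lt hs))).symm.trans ?_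
      refine integral_congr_ae (Eventually.of_forall fun t => ?_)
      simp [damp]
    · intro t ht
      rw [(mild_pk (hpos α hα)).zero t (by simpa using ht), mul_zero, smul_zero]
  have h2 : ∫ t, damp s (distKer lam F S a) t =
      ∫ t in Ioi 0, ∫ α in S, Real.exp (-(s * t)) • (F α * pk 𝓐 (a - α) t) ∂lam := by
    rw [← setIntegral_eq_integral_of_forall_compl_eq_zero (s := Ioi 0)]
    · refine integral_congr_ae (Eventually.of_forall fun t => ?_)
      exact (integral_smul _ _).symm
    · intro t ht
      rw [damp, (mild_distKer hF hSm hM hS ha).zero t (by simpa using ht), smul_zero]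
  rw [h2, setIntegral_congr_fun hSm h1]
  refine integral_integral_swap ?_
  have hdom : Integrable (fun p : ℝ × ℝ => B * expPow (a - M) (s - M) p.1)
      ((volume.restrict (Ioi 0)).prod (lam.restrict S)) :=
    Integrable.comp_fst (f := fun t => B * expPow (a - M) (s - M) t)
      (((integrable_expPow (sub_pos.2 ha) (sub_pos.2 hs)).const_mul B).integrableOn) _
  refine Integrable.mono' hdom ?_ ?_
  · rw [Measure.prod_restrict]
    refine ContinuousOn.aestronglyMeasurable ?_ (measurableSet_Ioi.prod hSm)
    exact ContinuousOn.smul (f := fun p : ℝ × ℝ => Real.exp (-(s * p.1))) (by fun_prop)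
      (continuousOn_integrand hF hS ha)
  · rw [Measure.prod_restrict]
    filter_upwards [ae_restrict_mem (measurableSet_Ioi.prod hSm)] with p hp
    have h0 : 0 < p.1 := hp.1
    rw [Function.uncurry, norm_smul, Real.norm_of_nonneg (Real.exp_nonneg _), expPow_of_pos h0]
    refine (mul_le_mul_of_nonneg_left (hB p.2 hp.2 p.1 h0) (Real.exp_nonneg _)).trans_eq ?_
    rw [show -((s - M) * p.1) = -(s * p.1) + M * p.1 by ring, Real.exp_add]
    ring

/-! ### The resolvent kernel of the characteristic function -/

/-- `q` is the resolvent kernel of `K = ∫ F(α) t ^ (μ - α - 1) / Γ(μ - α) λ(dα)`: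
`q + K ⋆ q = K`. -/
structure IsResKer (lam : Measure ℝ) (F : ℝ → 𝓐) (M μ : ℝ) (q : ℝ → 𝓐) : Prop where
  mild : Mild q
  eq : ∀ t, q t + cv (distKer lam F (Icc 0 M) μ) q t = distKer lam F (Icc 0 M) μ t
  bound : ∃ C ρ, ∀ t > 0, ‖q t‖ ≤ C * (t ^ (μ - M - 1) * Real.exp (ρ * t))

/-- Here the singularity exponent is δ = μ - M, and M < μ ≤ M + 1 puts it in (0, 1]. -/
theorem exists_isResKer {lam : Measure ℝ} [IsFiniteMeasure lam] {F : ℝ → 𝓐} (hF : Continuous F)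
    {M μ : ℝ} (hM : 0 ≤ M) (hμ : M < μ) (hμ' : μ ≤ M + 1) : ∃ q, IsResKer lam F M μ q := by
  obtain ⟨B, hB0, hB⟩ := exists_norm_distKer_le (lam := lam) hF measurableSet_Icc Subset.rfl hμ
  obtain ⟨q, h1, h2, h3⟩ := exists_resolventKernel
    (mild_distKer (lam := lam) hF measurableSet_Icc hM Subset.rfl hμ)
    (sub_pos.2 hμ) (by linarith) hB0 hB
  exact ⟨q, h1, h2, h3⟩

/-- The inverse Laplace transform of `s ^ (μ - γ) / Δ(s)`, `γ ≥ 1`, where `q` is the resolvent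
kernel of `Δ`. -/
def resSol (q : ℝ → 𝓐) (γ t : ℝ) : 𝓐 :=
  algebraMap ℝ 𝓐 (t ^ (γ - 1) / Real.Gamma γ) - cv q (pk 𝓐 γ) t

theorem resSol_of_pos (q : ℝ → 𝓐) (γ : ℝ) {t : ℝ} (ht : 0 < t) :
    resSol q γ t = pk 𝓐 γ t - cv q (pk 𝓐 γ) t := by
  rw [resSol, pk, powKer_of_pos ht]
  rfl

theorem continuous_cv_of_one_le {q : ℝ → 𝓐} (hq : Mild q) {γ : ℝ} (hγ : 1 ≤ γ) :
    Continuous (cv q (pk 𝓐 γ)) := by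
  rcases hγ.eq_or_lt with rfl | hγ
  · rw [cv_comm]
    exact continuous_pk_cv hq
  · have h : 0 < γ - 1 := by linarith
    rw [cv_comm, show γ = 1 + (γ - 1) by ring, ← cv_pk one_pos h,
      cv_assoc (mild_pk one_pos) (mild_pk h) hq]
    exact continuous_pk_cv ((mild_pk h).cv hq)

/-- For γ = 1 the leading term is 1 at t = 0 as well, since 0 ^ 0 = 1; the kernel `pk`, cut off at
0, would jump there. -/
theorem continuous_resSol {q : ℝ → 𝓐} (hq : Mild q) {γ : ℝ} (hγ : 1 ≤ γ) :
    Continuous (resSol q γ) := by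
  refine Continuous.sub ?_ (continuous_cv_of_one_le hq hγ)
  exact (algebraMapCLM ℝ 𝓐).continuous.comp
    ((Real.continuous_rpow_const (by linarith)).div_const _)

/-- Transforming q + K⋆q = K gives (1 - Lq)(1 + LK) = 1, while Δ = s^μ (1 + LK). The result is
stated as a product, since Δ is an element of the algebra and need not be known to be invertible
beforehand. -/
theorem laplace_resSol {lam : Measure ℝ} [IsFiniteMeasure lam] {F : ℝ → 𝓐} (hF : Continuous F)
    {M μ : ℝ} (hM : 0 ≤ M) (hμ : M < μ) {q : ℝ → 𝓐} (hq : IsResKer lam F M μ q) {γ : ℝ}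
    (hγ : 0 < γ) : ∃ s₀ ≥ 0, ∀ s > s₀,
      IntegrableOn (fun t => Real.exp (-(s * t)) • resSol q γ t) (Ioi 0) ∧
      (∫ t in Ioi 0, Real.exp (-(s * t)) • resSol q γ t) *
        (algebraMap ℝ 𝓐 (s ^ μ) + ∫ α in Icc 0 M, F α * algebraMap ℝ 𝓐 (s ^ α) ∂lam) =
        algebraMap ℝ 𝓐 (s ^ (μ - γ)) := by
  obtain ⟨C, ρ, hC⟩ := hq.bound
  refine ⟨max M (max ρ 0), by simp, fun s hs => ?_⟩
  have hsM : M < s := (le_max_left _ _).trans_lt hs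
  have hsρ : ρ < s := (le_max_of_le_right (le_max_left _ _)).trans_lt hs
  have hs0 : 0 < s := hM.trans_lt hsM
  have iq := integrable_damp hq.mild (sub_pos.2 hμ) hC hsρ
  have ip := integrable_damp_pk (𝓐 := 𝓐) hγ hs0
  have hK := mild_distKer (lam := lam) hF measurableSet_Icc hM Subset.rfl hμ
  obtain ⟨B, -, hB⟩ := exists_norm_distKer_le (lam := lam) hF measurableSet_Icc Subset.rfl hμ
  have iK := integrable_damp hK (sub_pos.2 hμ) hB hsM
  have hEq : ∀ t ∈ Ioi (0 : ℝ), damp s (pk 𝓐 γ) t - damp s (cv q (pk 𝓐 γ)) t =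
      Real.exp (-(s * t)) • resSol q γ t := by
    intro t ht
    rw [resSol_of_pos q γ ht, smul_sub]
    rfl
  refine ⟨((ip.sub (integrable_damp_cv iq ip)).integrableOn).congr_fun hEq measurableSet_Ioi, ?_⟩
  rw [← setIntegral_congr_fun measurableSet_Ioi hEq,
    setIntegral_eq_integral_of_forall_compl_eq_zero, integral_sub ip (integrable_damp_cv iq ip),
    integral_damp_cv iq ip, integral_damp_pk hγ hs0]
  swap
  · intro t ht
    have ht : t ≤ 0 := by simpa using ht
    rw [damp, damp, (mild_pk hγ).zero t ht, (hq.mild.cv (mild_pk hγ)).zero t ht, smul_zero, sub_zero]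
  have hres : (∫ t, damp s q t) +
      (∫ t, damp s (distKer lam F (Icc 0 M) μ) t) * (∫ t, damp s q t) =
      ∫ t, damp s (distKer lam F (Icc 0 M) μ) t := by
    rw [← integral_damp_cv iK iq, ← integral_add iq (integrable_damp_cv iK iq)]
    refine integral_congr_ae (Eventually.of_forall fun t => ?_)
    simp only [damp, ← smul_add, hq.eq t]
  have hdelta : algebraMap ℝ 𝓐 (s ^ μ) + ∫ α in Icc 0 M, F α * algebraMap ℝ 𝓐 (s ^ α) ∂lam =
      algebraMap ℝ 𝓐 (s ^ μ) * (1 + ∫ t, damp s (distKer lam F (Icc 0 M) μ) t) := by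
    rw [integral_damp_distKer hF measurableSet_Icc hM Subset.rfl hμ hsM, mul_add, mul_one]
    congr 1
    have hi : IntegrableOn (fun α => F α * algebraMap ℝ 𝓐 (s ^ (α - μ))) (Icc 0 M) lam := by
      refine ContinuousOn.integrableOn_compact isCompact_Icc (ContinuousOn.mul hF.continuousOn ?_)
      refine (algebraMapCLM ℝ 𝓐).continuous.comp_continuousOn (ContinuousOn.rpow continuousOn_const
        (by fun_prop) fun _ _ => Or.inl hs0.ne')
    refine Eq.trans (integral_congr_ae (Eventually.of_forall fun α => ?_))
      (((ContinuousLinearMap.mul ℝ 𝓐) (algebraMap ℝ 𝓐 (s ^ μ))).integral_comp_comm hi)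
    simp only [ContinuousLinearMap.mul_apply']
    rw [mul_left_comm, ← map_mul, ← Real.rpow_add hs0]
    ring_nf
  rw [hdelta, show μ - γ = -γ + μ by ring, Real.rpow_add hs0, map_mul]
  set Lq := ∫ t, damp s q t
  set LK := ∫ t, damp s (distKer lam F (Icc 0 M) μ) t
  linear_combination (-(algebraMap ℝ 𝓐 (s ^ (-γ))) * algebraMap ℝ 𝓐 (s ^ μ)) * hres

end Alg

/-! ### Injectivity of the Laplace transform -/

/-- Lerch's theorem: in the variable e^(-t) the hypothesis at the points s₀ + 1 + n says that all
moments vanish. By Weierstrass the integral against every continuous function of e^(-t) vanishes,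
and compactly supported test functions on t > 0 are of this form. -/
theorem eq_zero_of_laplace_eq_zero {y : ℝ → ℂ} (hy : ContinuousOn y (Ici 0)) {s₀ : ℝ}
    (h : ∀ s > s₀, IntegrableOn (fun t => (Real.exp (-(s * t)) : ℂ) * y t) (Ioi 0) ∧
      ∫ t in Ioi (0 : ℝ), (Real.exp (-(s * t)) : ℂ) * y t = 0) : ∀ t ≥ 0, y t = 0 := by
  -- Damping at s₀ + 1, inside the half-line of convergence, makes z integrable, so the moment of
  -- order 0 is included.
  set z : ℝ → ℂ := fun t => (Real.exp (-((s₀ + 1) * t)) : ℂ) * y t with hz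
  have hzi : IntegrableOn z (Ioi 0) := (h (s₀ + 1) (by linarith)).1
  have hexp : ∀ (n : ℕ) (t : ℝ), ((Real.exp (-t) : ℂ)) ^ n * z t =
      (Real.exp (-((s₀ + 1 + n) * t)) : ℂ) * y t := by
    intro n t
    rw [hz, ← mul_assoc, ← Complex.ofReal_pow, ← Real.exp_nat_mul, ← Complex.ofReal_mul,
      ← Real.exp_add]
    ring_nf
  have hpoly : ∀ p : Polynomial ℝ,
      ∫ t in Ioi (0 : ℝ), ((p.eval (Real.exp (-t)) : ℝ) : ℂ) * z t = 0 := by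
    intro p
    have hn : ∀ n : ℕ, IntegrableOn (fun t => (Real.exp (-t) : ℂ) ^ n * z t) (Ioi 0) ∧
        ∫ t in Ioi (0 : ℝ), (Real.exp (-t) : ℂ) ^ n * z t = 0 := fun n => by
      simp only [hexp]
      exact h _ (by have : (0 : ℝ) ≤ n := n.cast_nonneg
                    linarith)
    simp only [Polynomial.eval_eq_sum_range, Complex.ofReal_sum, Finset.sum_mul]
    rw [integral_finsetSum]
    · refine Finset.sum_eq_zero fun i _ => ?_
      simp only [Complex.ofReal_mul, Complex.ofReal_pow, mul_assoc]
      rw [integral_const_mul, (hn i).2, mul_zero]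
    · intro i _
      simp only [Complex.ofReal_mul, Complex.ofReal_pow, mul_assoc]
      exact (hn i).1.const_mul _
  have hcont : ∀ φ : C(Icc (0 : ℝ) 1, ℝ),
      ∫ t in Ioi (0 : ℝ), ((φ (projIcc 0 1 zero_le_one (Real.exp (-t))) : ℝ) : ℂ) * z t = 0 := by
    intro φ
    have hmeas : ∀ φ : C(Icc (0 : ℝ) 1, ℝ), AEStronglyMeasurable (fun t : ℝ =>
        ((φ (projIcc 0 1 zero_le_one (Real.exp (-t))) : ℝ) : ℂ) * z t) (volume.restrict (Ioi 0)) := by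
      intro φ
      refine (Continuous.aestronglyMeasurable ?_).mul hzi.1
      refine Complex.continuous_ofReal.comp (φ.continuous.comp (continuous_projIcc.comp ?_))
      fun_prop
    have hint : ∀ φ : C(Icc (0 : ℝ) 1, ℝ), IntegrableOn (fun t : ℝ =>
        ((φ (projIcc 0 1 zero_le_one (Real.exp (-t))) : ℝ) : ℂ) * z t) (Ioi 0) := by
      intro φ
      refine Integrable.mono' (hzi.norm.const_mul ‖φ‖) (hmeas φ) (Eventually.of_forall fun t => ?_)
      rw [norm_mul, Complex.norm_real]
      exact mul_le_mul_of_nonneg_right (φ.norm_coe_le_norm _) (norm_nonneg _)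
    refine norm_le_zero_iff.1 (le_of_forall_pos_le_add fun ε hε => ?_)
    set N := ∫ t in Ioi (0 : ℝ), ‖z t‖ with hN
    have hN0 : 0 ≤ N := integral_nonneg fun t => norm_nonneg _
    obtain ⟨p, hp⟩ := exists_polynomial_near_continuousMap 0 1 φ (ε / (N + 1)) (by positivity)
    have e1 : ∫ t in Ioi (0 : ℝ),
        (((p.toContinuousMapOn (Icc 0 1)) (projIcc 0 1 zero_le_one (Real.exp (-t))) : ℝ) : ℂ) * z t
        = 0 := by
      rw [← hpoly p]
      refine setIntegral_congr_fun measurableSet_Ioi fun t (ht : 0 < t) => ?_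
      simp only [Polynomial.toContinuousMapOn_apply, Polynomial.toContinuousMap_apply]
      rw [projIcc_of_mem zero_le_one ⟨(Real.exp_pos _).le, Real.exp_le_one_iff.2 (by linarith)⟩]
    rw [zero_add, ← norm_neg, ← zero_sub, ← e1, ← integral_sub (hint _) (hint _)]
    refine (norm_integral_le_of_norm_le (hzi.norm.const_mul (ε / (N + 1)))
      (Eventually.of_forall fun t => ?_)).trans ?_
    · rw [← sub_mul, norm_mul, ← Complex.ofReal_sub, Complex.norm_real]
      refine mul_le_mul_of_nonneg_right ?_ (norm_nonneg _)
      exact ((p.toContinuousMapOn (Icc 0 1) - φ).norm_coe_le_norm _).trans hp.le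
    · rw [integral_const_mul, ← hN, div_mul_eq_mul_div, div_le_iff₀ (by positivity)]
      nlinarith
  have hae : ∀ᵐ t ∂volume, t ∈ Ioi (0 : ℝ) → z t = 0 := by
    refine IsOpen.ae_eq_zero_of_integral_contDiff_smul_eq_zero isOpen_Ioi
      hzi.locallyIntegrableOn fun g hg hgc hgs => ?_
    have hlogcont : ContinuousOn (fun x : Icc (0 : ℝ) 1 => g (-Real.log x)) {x | (x : ℝ) ≠ 0} :=
      hg.continuous.comp_continuousOn (ContinuousOn.neg (Real.continuousOn_log.comp
        continuous_subtype_val.continuousOn fun x hx => hx))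
    obtain ⟨R, hR⟩ := hgc.isBounded.subset_closedBall 0
    have hφ : Continuous fun x : Icc (0 : ℝ) 1 =>
        if (x : ℝ) ≤ 0 then 0 else g (-Real.log x) := by
      rw [continuous_iff_continuousAt]
      intro x
      rcases eq_or_ne (x : ℝ) 0 with hx | hx
      -- Small x means large t = -log x, beyond the support of g, so the function is 0 near x = 0.
      · have hev : ∀ᶠ x' : Icc (0 : ℝ) 1 in 𝓝 x, (x' : ℝ) < Real.exp (-(|R| + 1)) :=
          continuous_subtype_val.continuousAt.eventually_lt continuousAt_const
            (by rw [hx]; exact Real.exp_pos _)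
        refine (continuousAt_const (y := (0 : ℝ))).congr ?_
        filter_upwards [hev] with x' hx'
        split_ifs with h0
        · rfl
        · symm
          by_contra hne
          have := hR (subset_tsupport g hne)
          rw [mem_closedBall_zero_iff, Real.norm_eq_abs, abs_neg] at this
          have h2 := Real.log_lt_log (not_le.1 h0) hx'
          rw [Real.log_exp] at h2
          have := (abs_le.1 this).1
          linarith [le_abs_self R]
      · have hpos : 0 < (x : ℝ) := lt_of_le_of_ne x.2.1 (Ne.symm hx)
        have hopen : IsOpen {x : Icc (0 : ℝ) 1 | (x : ℝ) ≠ 0} :=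
          isOpen_ne_fun continuous_subtype_val continuous_const
        refine (hlogcont.continuousAt (hopen.mem_nhds hx)).congr ?_
        filter_upwards [hopen.mem_nhds hx] with x' hx'
        rw [if_neg (not_le.2 (lt_of_le_of_ne x'.2.1 (Ne.symm hx')))]
    have := hcont ⟨_, hφ⟩
    rw [← setIntegral_eq_integral_of_forall_compl_eq_zero (s := Ioi 0), ← this]
    · refine setIntegral_congr_fun measurableSet_Ioi fun t (ht : 0 < t) => ?_
      simp only [ContinuousMap.coe_mk]
      rw [projIcc_of_mem zero_le_one ⟨(Real.exp_pos _).le, Real.exp_le_one_iff.2 (by linarith)⟩,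
        if_neg (not_le.2 (Real.exp_pos _)), Real.log_exp, neg_neg, Complex.real_smul]
    · intro t ht
      rw [Function.notMem_support.1 fun h' => ht (hgs (subset_tsupport g h')), zero_smul]
  have hpos : ∀ t > 0, y t = 0 := by
    have hzc : ContinuousOn z (Ioi 0) :=
      ContinuousOn.mul (by fun_prop) (hy.mono Ioi_subset_Ici_self)
    have : EqOn z (fun _ => 0) (Ioi 0) := by
      refine Measure.eqOn_open_of_ae_eq (μ := volume) ?_ isOpen_Ioi hzc continuousOn_const
      exact (ae_restrict_iff' measurableSet_Ioi).2 hae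
    intro t ht
    have := this ht
    simpa [hz, Complex.exp_ne_zero] using this
  intro t ht
  have hcl : EqOn y (fun _ => 0) (closure (Ioi 0)) :=
    EqOn.of_subset_closure (s := Ioi 0) hpos (by rwa [closure_Ioi]) continuousOn_const
      subset_closure Subset.rfl
  exact hcl (by rw [closure_Ioi]; exact ht)

theorem IsInvLaplace.unique {F : ℝ → ℂ} {x y : ℝ → ℂ} (hx : IsInvLaplace F x)
    (hy : IsInvLaplace F y) {t : ℝ} (ht : 0 ≤ t) : x t = y t := by
  obtain ⟨hxc, s₁, h₁⟩ := hx
  obtain ⟨hyc, s₂, h₂⟩ := hy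
  refine sub_eq_zero.1 (eq_zero_of_laplace_eq_zero (y := fun t => x t - y t) (s₀ := max s₁ s₂)
    (hxc.sub hyc) (fun s hs => ?_) t ht)
  obtain ⟨i₁, e₁⟩ := h₁ s ((le_max_left _ _).trans_lt hs)
  obtain ⟨i₂, e₂⟩ := h₂ s ((le_max_right _ _).trans_lt hs)
  simp only [mul_sub]
  exact ⟨i₁.sub i₂, by rw [integral_sub i₁ i₂, e₁, e₂, sub_self]⟩

theorem isInvLaplace_invLaplace {F : ℝ → ℂ} {y : ℝ → ℂ} (hy : IsInvLaplace F y) :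
    IsInvLaplace F (invLaplace F) := by
  have h : ∃ y, IsInvLaplace F y := ⟨y, hy⟩
  rw [invLaplace, dif_pos h]
  exact h.choose_spec

theorem IsInvLaplace.invLaplace_eq {F : ℝ → ℂ} {y : ℝ → ℂ} (hy : IsInvLaplace F y) {t : ℝ}
    (ht : 0 ≤ t) : invLaplace F t = y t :=
  (isInvLaplace_invLaplace hy).unique hy ht

/-! ### Fractional integrals of order `β ≥ 0` -/

section Alg

variable {𝓐 : Type*} [NormedCommRing 𝓐] [NormedAlgebra ℝ 𝓐] [CompleteSpace 𝓐]

open Classical in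
/-- The fractional integral of order `β ≥ 0`; the identity for `β = 0`. -/
def fint (β : ℝ) (x : ℝ → 𝓐) : ℝ → 𝓐 := if β = 0 then x else cv (pk 𝓐 β) x

theorem fint_zero (x : ℝ → 𝓐) : fint 0 x = x := if_pos rfl

theorem fint_of_pos {β : ℝ} (hβ : 0 < β) (x : ℝ → 𝓐) : fint β x = cv (pk 𝓐 β) x := if_neg hβ.ne'

theorem Mild.fint {x : ℝ → 𝓐} (hx : Mild x) {β : ℝ} (hβ : 0 ≤ β) : Mild (fint β x) := by
  rcases hβ.eq_or_lt with rfl | hβ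
  · rwa [fint_zero]
  · rw [fint_of_pos hβ]
    exact (mild_pk hβ).cv hx

theorem fint_fint {x : ℝ → 𝓐} (hx : Mild x) {a b : ℝ} (ha : 0 ≤ a) (hb : 0 ≤ b) :
    fint a (fint b x) = fint (a + b) x := by
  rcases ha.eq_or_lt with rfl | ha
  · rw [fint_zero, zero_add]
  rcases hb.eq_or_lt with rfl | hb
  · rw [fint_zero, add_zero]
  rw [fint_of_pos ha, fint_of_pos hb, fint_of_pos (by linarith), ← cv_assoc (mild_pk ha)
    (mild_pk hb) hx, cv_pk ha hb]

theorem fint_pk {β γ : ℝ} (hβ : 0 ≤ β) (hγ : 0 < γ) : fint β (pk 𝓐 γ) = pk 𝓐 (γ + β) := by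
  rcases hβ.eq_or_lt with rfl | hβ
  · rw [fint_zero, add_zero]
  · rw [fint_of_pos hβ, cv_pk hβ hγ, add_comm]

theorem fint_cv {x y : ℝ → 𝓐} (hx : Mild x) (hy : Mild y) {β : ℝ} (hβ : 0 ≤ β) :
    fint β (cv x y) = cv (fint β x) y := by
  rcases hβ.eq_or_lt with rfl | hβ
  · rw [fint_zero, fint_zero]
  · rw [fint_of_pos hβ, fint_of_pos hβ, cv_assoc (mild_pk hβ) hx hy]

theorem fint_add {x y : ℝ → 𝓐} (hx : Mild x) (hy : Mild y) {β : ℝ} (hβ : 0 ≤ β) :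
    fint β (fun t => x t + y t) = fun t => fint β x t + fint β y t := by
  rcases hβ.eq_or_lt with rfl | hβ
  · simp only [fint_zero]
  · simp only [fint_of_pos hβ, cv_add (mild_pk hβ) hx hy]

theorem fint_sub {x y : ℝ → 𝓐} (hx : Mild x) (hy : Mild y) {β : ℝ} (hβ : 0 ≤ β) :
    fint β (fun t => x t - y t) = fun t => fint β x t - fint β y t := by
  rcases hβ.eq_or_lt with rfl | hβ
  · simp only [fint_zero]
  · simp only [fint_of_pos hβ, cv_sub (mild_pk hβ) hx hy]

theorem fint_sum {ι : Type*} {x : ι → ℝ → 𝓐} (s : Finset ι) (hx : ∀ i ∈ s, Mild (x i)) {β : ℝ}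
    (hβ : 0 ≤ β) : fint β (fun t => ∑ i ∈ s, x i t) = fun t => ∑ i ∈ s, fint β (x i) t := by
  rcases hβ.eq_or_lt with rfl | hβ
  · simp only [fint_zero]
  · simp only [fint_of_pos hβ, cv_sum s (mild_pk hβ) hx]

theorem fint_mul_const {x : ℝ → 𝓐} (hx : Mild x) {β : ℝ} (hβ : 0 ≤ β) (a : 𝓐) :
    fint β (fun t => x t * a) = fun t => fint β x t * a := by
  rcases hβ.eq_or_lt with rfl | hβ
  · simp only [fint_zero]
  · simp only [fint_of_pos hβ, cv_mul_const (mild_pk hβ) hx]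

theorem fint_distKer {lam : Measure ℝ} [IsFiniteMeasure lam] {F : ℝ → 𝓐} {S : Set ℝ} {M a : ℝ}
    (hF : Continuous F) (hSm : MeasurableSet S) (hM : 0 ≤ M) (hS : S ⊆ Icc 0 M)
    (ha : M < a) {β : ℝ} (hβ : 0 ≤ β) :
    fint β (distKer lam F S a) = distKer lam F S (a + β) := by
  rcases hβ.eq_or_lt with rfl | hβ
  · rw [fint_zero, add_zero]
  · rw [fint_of_pos hβ, pk_cv_distKer hF hSm hM hS ha hβ]

theorem map_fint {𝓑 : Type*} [NormedCommRing 𝓑] [NormedAlgebra ℝ 𝓑] [CompleteSpace 𝓑]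
    (L : 𝓐 →L[ℝ] 𝓑) {x : ℝ → 𝓐} (hx : Mild x) {β : ℝ} (hβ : 0 ≤ β) (t : ℝ) :
    L (fint β x t) = fint β (fun s => L (x s)) t := by
  rcases hβ.eq_or_lt with rfl | hβ
  · simp only [fint_zero]
  · simp only [fint_of_pos hβ, cv_apply]
    rw [← L.integral_comp_comm ((mild_pk hβ).integrable_cv hx t)]
    simp only [pk_mul, map_smul]

theorem hasDerivAt_fint {x : ℝ → 𝓐} (hx : Mild x) {γ : ℝ} (hγ : 0 ≤ γ) {t : ℝ} (ht : 0 < t) :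
    HasDerivAt (fint (γ + 1) x) (fint γ x t) t := by
  rcases hγ.eq_or_lt with rfl | hγ
  · rw [zero_add, fint_of_pos one_pos, fint_zero]
    exact hasDerivAt_pk_one_cv hx ht
  · rw [fint_of_pos hγ, fint_of_pos (by linarith)]
    exact hasDerivAt_pk_cv hx hγ ht

theorem continuous_fint {x : ℝ → 𝓐} (hx : Mild x) (n : ℕ) : Continuous (fint (n + 1) x) := by
  rw [fint_of_pos (by positivity)]
  exact continuous_pk_nat_cv hx n

/-! ### The solution of the Cauchy problem in a commutative Banach algebra -/

variable {lam : Measure ℝ} [IsFiniteMeasure lam] {F : ℝ → 𝓐} {m : ℕ} {μ : ℝ} {q : ℝ → 𝓐}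

/-- The kernel `∫_{[0, k]} F(α) t ^ (μ - α + k - m) / Γ(μ - α + k + 1 - m) λ(dα)`. -/
def initKer (lam : Measure ℝ) (F : ℝ → 𝓐) (m : ℕ) (μ : ℝ) (k : ℕ) : ℝ → 𝓐 :=
  distKer lam F (Icc 0 k) (μ + k + 1 - m)

theorem mild_initKer (hF : Continuous F) (hμ : μ ∈ Ioc ((m : ℝ) - 1) m) (k : ℕ) :
    Mild (initKer lam F m μ k) :=
  mild_distKer hF measurableSet_Icc k.cast_nonneg Subset.rfl (by linarith [hμ.1])

/-- The derivative of order `m` of the solution operator `S_k`, up to the sign. -/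
def initRes (lam : Measure ℝ) (F : ℝ → 𝓐) (m : ℕ) (μ : ℝ) (q : ℝ → 𝓐) (k : ℕ) (t : ℝ) : 𝓐 :=
  initKer lam F m μ k t - cv q (initKer lam F m μ k) t

theorem mild_initRes (hF : Continuous F) (hμ : μ ∈ Ioc ((m : ℝ) - 1) m) (hq : Mild q) (k : ℕ) :
    Mild (initRes lam F m μ q k) :=
  (mild_initKer hF hμ k).sub (hq.cv (mild_initKer hF hμ k))

/-- The solution operators `S_k` in a Banach algebra. -/
def solFun (lam : Measure ℝ) (F : ℝ → 𝓐) (m : ℕ) (μ : ℝ) (q : ℝ → 𝓐) (k : ℕ) (t : ℝ) : 𝓐 :=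
  resSol q (k + 1) t + ∫ α in Ioc (k : ℝ) (m - 1), F α * resSol q (μ + k + 1 - α) t ∂lam

theorem Ioc_nat_subset (k : ℕ) (M : ℝ) : Ioc (k : ℝ) M ⊆ Icc 0 M := fun _ hα =>
  ⟨(Nat.cast_nonneg k).trans hα.1.le, hα.2⟩

theorem integrableOn_mul_resSol (hF : Continuous F) (hm : 1 ≤ m) (hμ : μ ∈ Ioc ((m : ℝ) - 1) m)
    (hq : Mild q) (k : ℕ) {t : ℝ} (ht : 0 ≤ t) :
    IntegrableOn (fun α => F α * resSol q (μ + k + 1 - α) t) (Ioc (k : ℝ) (m - 1)) lam := by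
  have hm' : (1 : ℝ) ≤ m := by exact_mod_cast hm
  have hk : (0 : ℝ) ≤ k := k.cast_nonneg
  have hM : (0 : ℝ) ≤ m - 1 := by linarith
  have ha : (m : ℝ) - 1 < μ + k + 1 := by linarith [hμ.1]
  have hS := Ioc_nat_subset k ((m : ℝ) - 1)
  rcases ht.eq_or_lt with rfl | ht
  · refine integrableOn_zero.congr_fun (fun α hα => ?_) measurableSet_Ioc
    have hα2 := hα.2
    rw [resSol, Real.zero_rpow (by linarith [hμ.1]),
      (hq.cv (mild_pk (by linarith [hμ.1]))).zero 0 le_rfl]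
    simp
  · refine IntegrableOn.congr_fun ((integrableOn_integrand hF measurableSet_Ioc hS ha t).sub
      (integrableOn_mul_cv hF measurableSet_Ioc hM hS ha hq t)) (fun α hα => ?_) measurableSet_Ioc
    rw [resSol_of_pos q _ ht, mul_sub, cv_comm q]
    rfl

/-- Convolve K - q = K⋆q with x and use commutativity and associativity. -/
theorem resKer_cancel (hF : Continuous F) (hm : 1 ≤ m) (hμ : μ ∈ Ioc ((m : ℝ) - 1) m)
    (hq : IsResKer lam F (m - 1) μ q) {x : ℝ → 𝓐} (hx : Mild x) (t : ℝ) :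
    cv (distKer lam F (Icc 0 (m - 1)) μ) x t - cv q x t =
      cv q (cv (distKer lam F (Icc 0 (m - 1)) μ) x) t := by
  have hm' : (1 : ℝ) ≤ m := by exact_mod_cast hm
  have hK : Mild (distKer lam F (Icc 0 ((m : ℝ) - 1)) μ) :=
    mild_distKer hF measurableSet_Icc (by linarith) Subset.rfl hμ.1
  rw [← cv_assoc hq.mild hK hx, cv_comm q (distKer _ _ _ _)]
  have h : cv x (distKer lam F (Icc 0 ((m : ℝ) - 1)) μ) =
      fun t => cv x q t + cv x (cv (distKer lam F (Icc 0 ((m : ℝ) - 1)) μ) q) t := by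
    rw [← cv_add hx hq.mild (hK.cv hq.mild)]
    congr 1
    ext s
    exact (hq.eq s).symm
  rw [cv_comm _ x, cv_comm _ x, cv_comm _ x, h, add_sub_cancel_left]

/-- On the Laplace side, replacing the integral over (k, m-1] by Δ - s^μ minus the one over [0, k]
shows that S_k has transform s^(-k-1) - s^(-k-1) Δ⁻¹ ∫_{[0,k]} F(α) s^α λ(dα). The proof carries
this out with convolutions; the second term is visibly an m-fold integral, so the derivatives of S_k
below order m are continuous and those at 0 are those of t^k/k!. -/
theorem solFun_eq (hF : Continuous F) (hm : 1 ≤ m) (hμ : μ ∈ Ioc ((m : ℝ) - 1) m)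
    (hq : IsResKer lam F (m - 1) μ q) {k : ℕ} (hk : k < m) {t : ℝ} (ht : 0 ≤ t) :
    solFun lam F m μ q k t = algebraMap ℝ 𝓐 (t ^ k / k.factorial) -
      cv (pk 𝓐 m) (initRes lam F m μ q k) t := by
  have hm' : (1 : ℝ) ≤ m := by exact_mod_cast hm
  have hm0 : (0 : ℝ) < m := by linarith
  have hk0 : (0 : ℝ) ≤ k := k.cast_nonneg
  have hkm : (k : ℝ) ≤ m - 1 := by
    have : (k : ℝ) + 1 ≤ m := by exact_mod_cast hk
    linarith
  have hM : (0 : ℝ) ≤ m - 1 := by linarith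
  have ha : (m : ℝ) - 1 < μ + k + 1 := by linarith [hμ.1]
  have hS := Ioc_nat_subset k ((m : ℝ) - 1)
  have hP : Mild (pk 𝓐 ((k : ℝ) + 1)) := mild_pk (by linarith)
  have hpow : t ^ ((k : ℝ) + 1 - 1) / Real.Gamma (k + 1) = t ^ k / k.factorial := by
    rw [add_sub_cancel_right, Real.rpow_natCast, Real.Gamma_nat_eq_factorial]
  rcases ht.eq_or_lt with rfl | ht
  · rw [solFun, setIntegral_eq_zero_of_forall_eq_zero, add_zero, resSol, hpow,
      (hq.mild.cv hP).zero 0 le_rfl,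
      ((mild_pk hm0).cv (mild_initRes hF hμ hq.mild k)).zero 0 le_rfl]
    -- At t = 0 the exponent μ + k - α is positive, because α ≤ m - 1 < μ; only t^k/k! can survive.
    intro α hα
    have hα2 := hα.2
    rw [resSol, Real.zero_rpow (by linarith [hμ.1]),
      (hq.mild.cv (mild_pk (by linarith [hμ.1]))).zero 0 le_rfl]
    simp
  set K := distKer lam F (Icc 0 ((m : ℝ) - 1)) μ with hKdef
  have hK : Mild K := mild_distKer hF measurableSet_Icc hM Subset.rfl hμ.1
  set D := distKer lam F (Ioc (k : ℝ) (m - 1)) (μ + k + 1) with hD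
  have hDm : Mild D := mild_distKer hF measurableSet_Ioc hM hS ha
  have hint : ∫ α in Ioc (k : ℝ) (m - 1), F α * resSol q (μ + k + 1 - α) t ∂lam =
      D t - cv q D t := by
    have h1 : ∀ α ∈ Ioc (k : ℝ) (m - 1), F α * resSol q (μ + k + 1 - α) t =
        F α * pk 𝓐 (μ + k + 1 - α) t - F α * cv (pk 𝓐 (μ + k + 1 - α)) q t := by
      intro α hα
      rw [resSol_of_pos q _ ht, mul_sub, cv_comm q]
    rw [setIntegral_congr_fun measurableSet_Ioc h1, integral_sub
      (integrableOn_integrand hF measurableSet_Ioc hS ha t)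
      (integrableOn_mul_cv hF measurableSet_Ioc hM hS ha hq.mild t), cv_comm q,
      distKer_cv hF measurableSet_Ioc hM hS ha hq.mild]
    rfl
  have hQ : Mild (initKer lam F m μ k) := mild_initKer hF hμ k
  -- Splitting [0, m-1] at k separates the part of K that is an m-fold integral after integrating k
  -- + 1 times from the part entering S_k.
  have hKP : ∀ s, cv K (pk 𝓐 ((k : ℝ) + 1)) s = cv (pk 𝓐 m) (initKer lam F m μ k) s + D s := by
    intro s
    rw [cv_comm, hKdef, pk_cv_distKer hF measurableSet_Icc hM Subset.rfl hμ.1 (by linarith),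
      initKer, pk_cv_distKer hF measurableSet_Icc hk0 Subset.rfl (by linarith [hμ.1]) hm0,
      show μ + k + 1 - m + m = μ + k + 1 by ring, ← add_assoc, hD]
    simp only [distKer]
    rw [← Icc_union_Ioc_eq_Icc hk0 hkm, setIntegral_union _ measurableSet_Ioc]
    · exact integrableOn_integrand hF measurableSet_Icc Subset.rfl (by linarith [hμ.1]) s
    · exact integrableOn_integrand hF measurableSet_Ioc hS ha s
    · exact Set.disjoint_left.2 fun x hx hx' => not_lt.2 hx.2 hx'.1
  have hDeq : D = fun s => cv K (pk 𝓐 ((k : ℝ) + 1)) s - cv (pk 𝓐 m) (initKer lam F m μ k) s := by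
    ext s
    rw [hKP s, add_sub_cancel_left]
  have hcan := resKer_cancel hF hm hμ hq hP t
  have hqD : cv q D t = cv q (cv K (pk 𝓐 ((k : ℝ) + 1))) t -
      cv (pk 𝓐 m) (cv q (initKer lam F m μ k)) t := by
    rw [hDeq, cv_sub hq.mild (hK.cv hP) ((mild_pk hm0).cv hQ), ← cv_assoc hq.mild (mild_pk hm0) hQ,
      cv_comm q (pk 𝓐 m), cv_assoc (mild_pk hm0) hq.mild hQ]
  have hW : cv (pk 𝓐 m) (initRes lam F m μ q k) t =
      cv (pk 𝓐 m) (initKer lam F m μ k) t - cv (pk 𝓐 m) (cv q (initKer lam F m μ k)) t := by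
    have := cv_sub (mild_pk (𝓐 := 𝓐) hm0) hQ (hq.mild.cv hQ)
    exact congrFun this t
  have hPt : pk 𝓐 ((k : ℝ) + 1) t = algebraMap ℝ 𝓐 (t ^ k / k.factorial) := by
    rw [pk, powKer_of_pos ht, hpow]
    rfl
  rw [solFun, hint, resSol_of_pos q _ ht, hqD, hW, ← hPt, ← hcan, congrFun hDeq t]
  ring

/-- The derivative of order `m` of the solution with initial values `φ` and right-hand side whose
fractional derivative is `g`. -/
def solDeriv (lam : Measure ℝ) (F : ℝ → 𝓐) (m : ℕ) (μ : ℝ) (q : ℝ → 𝓐) (φ : Fin m → 𝓐)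
    (g : ℝ → 𝓐) (t : ℝ) : 𝓐 :=
  g t - cv q g t - ∑ k : Fin m, initRes lam F m μ q k t * φ k

theorem mild_solDeriv (hF : Continuous F) (hμ : μ ∈ Ioc ((m : ℝ) - 1) m) (hq : Mild q)
    (φ : Fin m → 𝓐) {g : ℝ → 𝓐} (hg : Mild g) : Mild (solDeriv lam F m μ q φ g) :=
  (hg.sub (hq.cv hg)).sub (Mild.sum _ fun k _ => (mild_initRes hF hμ hq k).mul_const (φ k))

/-- With r = g - ∑ Q_k φ_k the function is r - q⋆r, and K⋆(r - q⋆r) = q⋆r by the resolvent identity.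
-/
theorem solDeriv_volterra (hF : Continuous F) (hm : 1 ≤ m) (hμ : μ ∈ Ioc ((m : ℝ) - 1) m)
    (hq : IsResKer lam F (m - 1) μ q) (φ : Fin m → 𝓐) {g : ℝ → 𝓐} (hg : Mild g) (t : ℝ) :
    solDeriv lam F m μ q φ g t +
      cv (distKer lam F (Icc 0 (m - 1)) μ) (solDeriv lam F m μ q φ g) t +
      ∑ k : Fin m, initKer lam F m μ k t * φ k = g t := by
  have hm' : (1 : ℝ) ≤ m := by exact_mod_cast hm
  have hK : Mild (distKer lam F (Icc 0 ((m : ℝ) - 1)) μ) :=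
    mild_distKer hF measurableSet_Icc (by linarith) Subset.rfl hμ.1
  set r : ℝ → 𝓐 := fun t => g t - ∑ k : Fin m, initKer lam F m μ k t * φ k with hr
  have hsm : Mild fun t => ∑ k : Fin m, initKer lam F m μ k t * φ k :=
    Mild.sum _ fun k _ => (mild_initKer hF hμ k).mul_const (φ k)
  have hrm : Mild r := hg.sub hsm
  have hw : solDeriv lam F m μ q φ g = fun t => r t - cv q r t := by
    ext t
    have h1 : cv q r t = cv q g t - ∑ k : Fin m, cv q (initKer lam F m μ k) t * φ k := by
      have hs := cv_sum (y := fun (k : Fin m) t => initKer lam F m μ k t * φ k) Finset.univ hq.mild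
        fun k _ => (mild_initKer hF hμ k).mul_const (φ k)
      rw [hr, cv_sub hq.mild hg hsm, hs]
      simp only [cv_mul_const hq.mild (mild_initKer hF hμ _)]
    rw [h1, solDeriv, hr]
    simp only [initRes, sub_mul, Finset.sum_sub_distrib]
    abel
  have h2 : cv (distKer lam F (Icc 0 ((m : ℝ) - 1)) μ) (solDeriv lam F m μ q φ g) t = cv q r t := by
    rw [hw, cv_sub hK hrm (hq.mild.cv hrm), ← cv_assoc hK hq.mild hrm,
      cv_comm (distKer lam F (Icc 0 ((m : ℝ) - 1)) μ) q, cv_assoc hq.mild hK hrm,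
      ← funext (resKer_cancel hF hm hμ hq hrm)]
    exact sub_sub_cancel _ _
  rw [h2, hw]
  simp only [hr]
  abel

/-- The Caputo derivative of order `α` of the solution. -/
def solCaputo {m : ℕ} (φ : Fin m → 𝓐) (w : ℝ → 𝓐) (α t : ℝ) : 𝓐 :=
  (∑ k : Fin m, if α ≤ (k : ℕ) then pk 𝓐 ((k : ℕ) + 1 - α) t * φ k else 0) + fint (m - α) w t

/-- The monomial t^k has zero Caputo derivative of every order α > k, which cuts the α-integral down
to [0, k]. -/
theorem integrableOn_mul_solCaputo_term (hF : Continuous F) {k : ℕ} (hk : k < m) (φ : 𝓐) (t : ℝ) :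
    IntegrableOn (fun α => F α * if α ≤ (k : ℝ) then pk 𝓐 ((k : ℝ) + 1 - α) t * φ else 0)
      (Icc 0 ((m : ℝ) - 1)) lam ∧
    ∫ α in Icc 0 ((m : ℝ) - 1), (F α * if α ≤ (k : ℝ) then pk 𝓐 ((k : ℝ) + 1 - α) t * φ else 0) ∂lam =
      distKer lam F (Icc 0 k) (k + 1) t * φ := by
  have hkm : (k : ℝ) ≤ m - 1 := by
    have : (k : ℝ) + 1 ≤ m := by exact_mod_cast hk
    linarith
  have hEq : (fun α => F α * if α ≤ (k : ℝ) then pk 𝓐 ((k : ℝ) + 1 - α) t * φ else 0) =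
      (Iic (k : ℝ)).indicator fun α => F α * pk 𝓐 ((k : ℝ) + 1 - α) t * φ := by
    ext α
    by_cases h : α ≤ (k : ℝ)
    · rw [if_pos h, indicator_of_mem (mem_Iic.2 h), mul_assoc]
    · rw [if_neg h, indicator_of_notMem (by simpa using h), mul_zero]
  have hset : Icc 0 ((m : ℝ) - 1) ∩ Iic (k : ℝ) = Icc 0 (k : ℝ) := by
    ext α
    simp only [mem_inter_iff, mem_Icc, mem_Iic]
    constructor
    · rintro ⟨⟨h1, -⟩, h2⟩
      exact ⟨h1, h2⟩
    · rintro ⟨h1, h2⟩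
      exact ⟨⟨h1, h2.trans hkm⟩, h2⟩
  have hi : IntegrableOn (fun α => F α * pk 𝓐 ((k : ℝ) + 1 - α) t) (Icc 0 (k : ℝ)) lam :=
    integrableOn_integrand hF measurableSet_Icc Subset.rfl (by linarith) t
  rw [hEq]
  refine ⟨?_, ?_⟩
  · rw [integrableOn_indicator_iff measurableSet_Iic, inter_comm, hset]
    exact ((ContinuousLinearMap.mul ℝ 𝓐).flip φ).integrable_comp hi
  · rw [setIntegral_indicator measurableSet_Iic, hset]
    exact ((ContinuousLinearMap.mul ℝ 𝓐).flip φ).integral_comp_comm hi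

theorem integrableOn_mul_solCaputo (hF : Continuous F) (hm : 1 ≤ m) (φ : Fin m → 𝓐) {w : ℝ → 𝓐}
    (hw : Mild w) (t : ℝ) :
    IntegrableOn (fun α => F α * solCaputo φ w α t) (Icc 0 ((m : ℝ) - 1)) lam ∧
    ∫ α in Icc 0 ((m : ℝ) - 1), F α * solCaputo φ w α t ∂lam =
      (∑ k : Fin m, distKer lam F (Icc 0 (k : ℕ)) ((k : ℕ) + 1) t * φ k) +
        cv (distKer lam F (Icc 0 ((m : ℝ) - 1)) m) w t := by
  have hm' : (1 : ℝ) ≤ m := by exact_mod_cast hm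
  have hM : (0 : ℝ) ≤ m - 1 := by linarith
  have h1 := fun k : Fin m => integrableOn_mul_solCaputo_term (lam := lam) hF k.2 (φ k) t
  have h2 : IntegrableOn (fun α => F α * fint (m - α) w t) (Icc 0 ((m : ℝ) - 1)) lam := by
    refine (integrableOn_mul_cv hF measurableSet_Icc hM Subset.rfl (sub_one_lt (m : ℝ)) hw t).congr_fun
      (fun α hα => ?_) measurableSet_Icc
    rw [fint_of_pos (by linarith [hα.2])]
  simp only [solCaputo, mul_add, Finset.mul_sum]
  refine ⟨(integrable_finsetSum _ fun k _ => (h1 k).1).add h2, ?_⟩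
  rw [integral_add (integrable_finsetSum _ fun k _ => (h1 k).1) h2,
    integral_finsetSum _ fun k _ => (h1 k).1]
  congr 1
  · exact Finset.sum_congr rfl fun k _ => (h1 k).2
  · rw [distKer_cv hF measurableSet_Icc hM Subset.rfl (sub_one_lt (m : ℝ)) hw]
    refine setIntegral_congr_fun measurableSet_Icc fun α hα => ?_
    rw [fint_of_pos (by linarith [hα.2])]

/-- Apply J^(m-μ) to the Volterra equation: each kernel exponent rises by m - μ, so K becomes the
kernel of J^(m-α) averaged over α, and Q_k the average of the kernels t^(k-α)/Γ(k+1-α). -/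
theorem solCaputo_equation (hF : Continuous F) (hm : 1 ≤ m) (hμ : μ ∈ Ioc ((m : ℝ) - 1) m)
    (hq : IsResKer lam F (m - 1) μ q) (φ : Fin m → 𝓐) {g : ℝ → 𝓐} (hg : Mild g) (t : ℝ) :
    solCaputo φ (solDeriv lam F m μ q φ g) μ t +
      ∫ α in Icc 0 ((m : ℝ) - 1), F α * solCaputo φ (solDeriv lam F m μ q φ g) α t ∂lam =
      fint (m - μ) g t := by
  have hm' : (1 : ℝ) ≤ m := by exact_mod_cast hm
  have hM : (0 : ℝ) ≤ m - 1 := by linarith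
  have hβ : 0 ≤ (m : ℝ) - μ := by linarith [hμ.2]
  set w := solDeriv lam F m μ q φ g with hwdef
  have hw : Mild w := mild_solDeriv hF hμ hq.mild φ hg
  have hK : Mild (distKer lam F (Icc 0 ((m : ℝ) - 1)) μ) :=
    mild_distKer hF measurableSet_Icc hM Subset.rfl hμ.1
  have hQ : ∀ k ∈ (Finset.univ : Finset (Fin m)), Mild fun t => initKer lam F m μ k t * φ k :=
    fun k _ => (mild_initKer hF hμ k).mul_const (φ k)
  -- Every k is at most m - 1 < μ, so the initial polynomial does not contribute to the leading
  -- derivative.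
  have h0 : solCaputo φ w μ t = fint (m - μ) w t := by
    rw [solCaputo, Finset.sum_eq_zero, zero_add]
    intro k _
    rw [if_neg]
    have : ((k : ℕ) : ℝ) + 1 ≤ m := by exact_mod_cast k.2
    linarith [hμ.1]
  rw [h0, (integrableOn_mul_solCaputo hF hm φ hw t).2]
  have hv : (fun t => (w t + cv (distKer lam F (Icc 0 ((m : ℝ) - 1)) μ) w t) +
      ∑ k : Fin m, initKer lam F m μ k t * φ k) = g :=
    funext fun t => solDeriv_volterra hF hm hμ hq φ hg t
  rw [← hv, fint_add (hw.add (hK.cv hw)) (Mild.sum _ hQ) hβ, fint_add hw (hK.cv hw) hβ,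
    fint_sum _ hQ hβ, fint_cv hK hw hβ,
    fint_distKer hF measurableSet_Icc hM Subset.rfl hμ.1 hβ]
  have hk : ∀ k : Fin m, fint (m - μ) (fun t => initKer lam F m μ k t * φ k) t =
      distKer lam F (Icc 0 (k : ℕ)) ((k : ℕ) + 1) t * φ k := by
    intro k
    rw [fint_mul_const (mild_initKer hF hμ k) hβ, initKer, fint_distKer hF measurableSet_Icc
      (Nat.cast_nonneg _) Subset.rfl (by linarith [hμ.1]) hβ]
    ring_nf
  simp only [hk]
  rw [show μ + (m - μ) = (m : ℝ) by ring]
  abel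

/-- The representation formula, in the algebra. -/
theorem sum_solFun_add_integral (hF : Continuous F) (hm : 1 ≤ m) (hμ : μ ∈ Ioc ((m : ℝ) - 1) m)
    (hq : IsResKer lam F (m - 1) μ q) (φ : Fin m → 𝓐) {g g' : ℝ → 𝓐} (hg : Mild g)
    (hgg' : ∀ t > 0, g t = g' t) {t : ℝ} (ht : 0 ≤ t) :
    (∑ k : Fin m, solFun lam F m μ q k t * φ k) +
      ∫ τ in (0 : ℝ)..t, solFun lam F m μ q (m - 1) (t - τ) * g' τ =
    (∑ k : Fin m, algebraMap ℝ 𝓐 (t ^ (k : ℕ) / (k : ℕ).factorial) * φ k) +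
      fint m (solDeriv lam F m μ q φ g) t := by
  have hm' : (1 : ℝ) ≤ m := by exact_mod_cast hm
  have hm0 : (0 : ℝ) < m := by linarith
  have hP : Mild (pk 𝓐 m) := mild_pk hm0
  -- For k = m - 1 the interval (k, m-1] is empty, so the last solution operator has no integral
  -- term.
  have hres : ∀ s > 0, solFun lam F m μ q (m - 1) s = pk 𝓐 m s - cv q (pk 𝓐 m) s := by
    intro s hs
    rw [solFun, Ioc_eq_empty (by rw [Nat.cast_sub hm]; simp), Measure.restrict_empty,
      integral_zero_measure, add_zero, resSol_of_pos q _ hs, Nat.cast_sub hm]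
    simp
  have hint : ∫ τ in (0 : ℝ)..t, solFun lam F m μ q (m - 1) (t - τ) * g' τ =
      cv (pk 𝓐 m) (fun t => g t - cv q g t) t := by
    have h1 : cv (pk 𝓐 m) (fun t => g t - cv q g t) t =
        cv g (fun t => pk 𝓐 m t - cv q (pk 𝓐 m) t) t := by
      rw [cv_sub hP hg (hq.mild.cv hg), cv_sub hg hP (hq.mild.cv hP), cv_comm g, cv_comm g,
        ← cv_assoc hP hq.mild hg, cv_comm q (pk 𝓐 m)]
    rw [h1, cv_apply, intervalIntegral.integral_of_le ht, integral_Ioc_eq_integral_Ioo,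
      ← setIntegral_eq_integral_of_forall_compl_eq_zero (s := Ioo 0 t) (fun s hs =>
        cv_integrand_eq_zero hg (hP.sub (hq.mild.cv hP)) hs)]
    refine setIntegral_congr_fun measurableSet_Ioo fun s hs => ?_
    rw [hres _ (sub_pos.2 hs.2), hgg' s hs.1, mul_comm]
  have hsum : Mild fun t => ∑ k : Fin m, initRes lam F m μ q k t * φ k :=
    Mild.sum _ fun k _ => (mild_initRes hF hμ hq.mild k).mul_const (φ k)
  have hw : cv (pk 𝓐 m) (solDeriv lam F m μ q φ g) t =
      cv (pk 𝓐 m) (fun t => g t - cv q g t) t -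
        ∑ k : Fin m, cv (pk 𝓐 m) (initRes lam F m μ q k) t * φ k := by
    have := congrFun (cv_sub hP (hg.sub (hq.mild.cv hg)) hsum) t
    have hs := cv_sum (y := fun (k : Fin m) t => initRes lam F m μ q k t * φ k) Finset.univ hP
      fun k _ => (mild_initRes hF hμ hq.mild k).mul_const (φ k)
    refine this.trans (congrArg _ ?_)
    rw [hs]
    exact Finset.sum_congr rfl fun k _ =>
      congrFun (cv_mul_const hP (mild_initRes hF hμ hq.mild k) (φ k)) t
  rw [hint, fint_of_pos hm0, hw, Finset.sum_congr rfl fun k _ => by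
    rw [solFun_eq hF hm hμ hq k.2 ht, sub_mul], Finset.sum_sub_distrib]
  abel

end Alg

/-! ### Caputo derivatives -/

section Caputo

theorem hasDerivAt_powKer {γ t : ℝ} (hγ : 0 < γ) (ht : 0 < t) :
    HasDerivAt (powKer (γ + 1)) (powKer γ t) t := by
  have h := (Real.hasDerivAt_rpow_const (p := γ) (Or.inl ht.ne')).div_const (Real.Gamma (γ + 1))
  rw [powKer_of_pos ht]
  have hG := (Real.Gamma_pos_of_pos hγ).ne'
  convert! h.congr_of_eventuallyEq (f₁ := powKer (γ + 1)) ?_ using 1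
  · rw [Real.Gamma_add_one hγ.ne']
    field_simp
  · filter_upwards [lt_mem_nhds ht] with s hs
    rw [powKer_of_pos hs, add_sub_cancel_right]

theorem hasDerivAt_powKer_one {t : ℝ} (ht : 0 < t) : HasDerivAt (powKer 1) 0 t := by
  refine (hasDerivAt_const t (1 : ℝ)).congr_of_eventuallyEq ?_
  filter_upwards [lt_mem_nhds ht] with s hs
  simp [powKer_of_pos hs]

theorem hasDerivAt_pk_mul (φ : ℂ) {γ t : ℝ} (hγ : 0 < γ) (ht : 0 < t) :
    HasDerivAt (fun t => pk ℂ (γ + 1) t * φ) (pk ℂ γ t * φ) t :=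
  (((algebraMapCLM ℝ ℂ).hasFDerivAt.comp_hasDerivAt t (hasDerivAt_powKer hγ ht))).mul_const φ

variable {m : ℕ}

theorem mild_solCaputo (φ : Fin m → ℂ) {w : ℝ → ℂ} (hw : Mild w) {α : ℝ} (hα : α ≤ m) :
    Mild (solCaputo φ w α) := by
  refine Mild.add (Mild.sum _ fun k _ => ?_) (hw.fint (by linarith))
  split_ifs with h
  · exact (mild_pk (by linarith)).mul_const _
  · exact mild_zero

/-- J^(n-α) applied to the derivative of order n; `hαn` says that n is the ceiling of α, so that the
same monomials survive differentiation to order n and to order α. -/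
theorem fint_solCaputo (φ : Fin m → ℂ) {w : ℝ → ℂ} (hw : Mild w) {α : ℝ} {n : ℕ} (hn : n ≤ m)
    (hα : α ≤ n) (hαn : ∀ k : ℕ, n ≤ k ↔ α ≤ k) :
    fint (n - α) (solCaputo φ w n) = solCaputo φ w α := by
  have hn' : (n : ℝ) ≤ m := by exact_mod_cast hn
  have hβ : 0 ≤ (n : ℝ) - α := by linarith
  have hterm : ∀ k ∈ (Finset.univ : Finset (Fin m)), Mild fun t =>
      if (n : ℝ) ≤ (k : ℕ) then pk ℂ ((k : ℕ) + 1 - n) t * φ k else 0 := by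
    intro k _
    split_ifs with h
    · exact (mild_pk (by linarith)).mul_const _
    · exact mild_zero
  unfold solCaputo
  rw [fint_add (Mild.sum _ hterm) (hw.fint (by linarith)) hβ, fint_sum _ hterm hβ,
    fint_fint hw hβ (by linarith), sub_add_sub_cancel']
  ext t
  congr 1
  refine Finset.sum_congr rfl fun k _ => ?_
  have hk : ((n : ℝ) ≤ (k : ℕ)) ↔ α ≤ (k : ℕ) := by rw [Nat.cast_le, hαn]
  by_cases h : α ≤ (k : ℕ)
  · have h' := hk.2 h
    simp only [if_pos h, if_pos h']
    rw [fint_mul_const (mild_pk (by linarith)) hβ, fint_pk hβ (by linarith),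
      sub_add_sub_cancel]
  · simp only [if_neg h, if_neg (mt hk.1 h)]
    rcases hβ.eq_or_lt with h0 | h0
    · rw [← h0, fint_zero]
    · rw [fint_of_pos h0, cv_apply]
      simp

theorem hasDerivAt_solCaputo (φ : Fin m → ℂ) {w : ℝ → ℂ} (hw : Mild w) {n : ℕ} (hn : n < m) {t : ℝ}
    (ht : 0 < t) : HasDerivAt (solCaputo φ w n) (solCaputo φ w (n + 1 : ℕ) t) t := by
  have hn' : (n : ℝ) + 1 ≤ m := by exact_mod_cast hn
  refine HasDerivAt.add ?_ ?_
  · refine HasDerivAt.fun_sum fun k _ => ?_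
    by_cases h : n + 1 ≤ (k : ℕ)
    · have h2 : (n : ℝ) + 1 ≤ (k : ℕ) := by exact_mod_cast h
      have h1 : ((n + 1 : ℕ) : ℝ) ≤ (k : ℕ) := by exact_mod_cast h
      simp only [if_pos h1, if_pos (show (n : ℝ) ≤ (k : ℕ) by linarith)]
      have := hasDerivAt_pk_mul (φ k) (γ := (k : ℕ) - n) (by linarith) ht
      convert! this using 3
      · ring_nf
      · push_cast
        ring_nf
    · have h1 : ¬((n + 1 : ℕ) : ℝ) ≤ (k : ℕ) := by exact_mod_cast h
      simp only [if_neg h1]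
      by_cases h2 : (n : ℝ) ≤ (k : ℕ)
      · have h3 : n = (k : ℕ) := le_antisymm (by exact_mod_cast h2) (by omega)
        -- The boundary case k = n: the monomial has become constant, and it disappears at order n +
        -- 1.
        have h4 : HasDerivAt (fun t => pk ℂ 1 t * φ k) (algebraMapCLM ℝ ℂ 0 * φ k) t :=
          ((algebraMapCLM ℝ ℂ).hasFDerivAt.comp_hasDerivAt t
            (hasDerivAt_powKer_one ht)).mul_const (φ k)
        simp only [h3, le_refl, if_true, add_sub_cancel_left]
        rwa [map_zero, zero_mul] at h4
      · simp only [if_neg h2]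
        exact hasDerivAt_const _ _
  · have := hasDerivAt_fint hw (γ := m - (n + 1)) (by linarith) ht
    rw [show (m : ℝ) - (n + 1) + 1 = m - n by ring] at this
    push_cast
    exact this

theorem iteratedDeriv_eq_of_hasDerivAt {y : ℝ → ℂ} {d : ℕ → ℝ → ℂ} {N : ℕ}
    (h0 : ∀ t > 0, y t = d 0 t)
    (hd : ∀ n < N, ∀ t > 0, HasDerivAt (d n) (d (n + 1) t) t) :
    ∀ n ≤ N, ∀ t > 0, iteratedDeriv n y t = d n t := by
  intro n
  induction n with
  | zero =>
    intro _ t ht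
    rw [iteratedDeriv_zero, h0 t ht]
  | succ n ih =>
    intro hn t ht
    rw [iteratedDeriv_succ]
    refine ((hd n (by omega) t ht).congr_of_eventuallyEq ?_).deriv
    filter_upwards [lt_mem_nhds ht] with s hs using ih (by omega) s hs

theorem fracIntegral_eq {β : ℝ} (hβ : 0 < β) {x y : ℝ → ℂ} (hx : Mild x) {t : ℝ} (ht : 0 ≤ t)
    (h : ∀ s ∈ Ioo 0 t, y s = x s) : fracIntegral β y t = fint β x t := by
  rw [fint_of_pos hβ, pk_cv_apply hx β ht, fracIntegral, ← intervalIntegral.integral_smul,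
    intervalIntegral.integral_of_le ht, intervalIntegral.integral_of_le ht,
    integral_Ioc_eq_integral_Ioo, integral_Ioc_eq_integral_Ioo]
  refine setIntegral_congr_fun measurableSet_Ioo fun s hs => ?_
  rw [h s hs, smul_smul, powKer_of_pos (sub_pos.2 hs.2), one_div, inv_mul_eq_div]

theorem iteratedDeriv_eq_solCaputo {y : ℝ → ℂ} (φ : Fin m → ℂ) {w : ℝ → ℂ} (hw : Mild w)
    (hy : ∀ t > 0, y t = solCaputo φ w 0 t) {n : ℕ} (hn : n ≤ m) {t : ℝ} (ht : 0 < t) :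
    iteratedDeriv n y t = solCaputo φ w n t :=
  iteratedDeriv_eq_of_hasDerivAt (d := fun n => solCaputo φ w (n : ℕ)) (by simpa using hy)
    (fun _ hn _ ht => hasDerivAt_solCaputo φ hw hn ht) n hn t ht

theorem caputo_eq_solCaputo {y : ℝ → ℂ} (φ : Fin m → ℂ) {w : ℝ → ℂ} (hw : Mild w)
    (hy : ∀ t > 0, y t = solCaputo φ w 0 t) {α : ℝ} (hα : α ≤ m) {t : ℝ} (ht : 0 < t) :
    caputo α y t = solCaputo φ w α t := by
  have hn : ⌈α⌉₊ ≤ m := Nat.ceil_le.2 hα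
  have hn' : (⌈α⌉₊ : ℝ) ≤ m := by exact_mod_cast hn
  rw [caputo]
  split_ifs with h
  · rw [iteratedDeriv_eq_solCaputo φ hw hy hn ht, ← h]
  · have hlt : 0 < (⌈α⌉₊ : ℝ) - α := sub_pos.2 (lt_of_le_of_ne (Nat.le_ceil α) h)
    rw [fracIntegral_eq hlt (mild_solCaputo φ hw hn') ht.le
      fun s hs => iteratedDeriv_eq_solCaputo φ hw hy hn hs.1,
      fint_solCaputo φ hw hn (Nat.le_ceil α) fun k => Nat.ceil_le]

/-- The derivative of order `n` of the function with initial values `φ` whose derivative of order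
`m` is `w`. -/
def solTaylor (φ : Fin m → ℂ) (w : ℝ → ℂ) (n : ℕ) (t : ℝ) : ℂ :=
  (∑ k : Fin m, if n ≤ (k : ℕ) then
    algebraMap ℝ ℂ (t ^ ((k : ℕ) - n) / ((k : ℕ) - n).factorial) * φ k else 0) + fint (m - n) w t

/-- The Taylor form keeps the polynomials at t = 0, where the cut-off kernels vanish; it is the form
that is continuous on t ≥ 0 and carries the initial values. -/
theorem solTaylor_eq_solCaputo (φ : Fin m → ℂ) (w : ℝ → ℂ) (n : ℕ) {t : ℝ} (ht : 0 < t) :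
    solTaylor φ w n t = solCaputo φ w n t := by
  unfold solTaylor solCaputo
  congr 1
  refine Finset.sum_congr rfl fun k _ => ?_
  by_cases h : n ≤ (k : ℕ)
  · rw [if_pos h, if_pos (by exact_mod_cast h), pk, powKer_of_pos ht]
    congr 1
    change _ = algebraMap ℝ ℂ _
    rw [show ((k : ℕ) : ℝ) + 1 - n = (((k : ℕ) - n : ℕ) : ℝ) + 1 by
      rw [Nat.cast_sub h]; ring, add_sub_cancel_right, Real.rpow_natCast,
      Real.Gamma_nat_eq_factorial]
  · rw [if_neg h, if_neg (by exact_mod_cast h)]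

theorem continuous_solTaylor (φ : Fin m → ℂ) {w : ℝ → ℂ} (hw : Mild w) {n : ℕ} (hn : n < m) :
    Continuous (solTaylor φ w n) := by
  refine Continuous.add (continuous_finsetSum _ fun k _ => ?_) ?_
  · split_ifs with h
    · refine Continuous.mul ((algebraMapCLM ℝ ℂ).continuous.comp ?_) continuous_const
      fun_prop
    · exact continuous_const
  · obtain ⟨j, rfl⟩ : ∃ j, m = j + 1 + n := ⟨m - 1 - n, by omega⟩
    have := continuous_fint hw j
    convert! this using 2
    push_cast
    ring

theorem solTaylor_zero_right (φ : Fin m → ℂ) {w : ℝ → ℂ} (hw : Mild w) (n : Fin m) :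
    solTaylor φ w n 0 = φ n := by
  have hn : ((n : ℕ) : ℝ) + 1 ≤ m := by exact_mod_cast n.2
  rw [solTaylor, (hw.fint (by linarith)).zero 0 le_rfl, add_zero,
    Finset.sum_eq_single_of_mem n (Finset.mem_univ _)]
  · simp
  · intro k _ hk
    split_ifs with h
    · have h1 : (k : ℕ) - n ≠ 0 := by
        have : (k : ℕ) ≠ n := fun e => hk (Fin.ext e)
        omega
      simp [h1]
    · rfl

end Caputo

/-! ### The symbols of the solution operators -/

section Symbols

variable {𝓐 : Type*} [NormedCommRing 𝓐] [NormedAlgebra ℝ 𝓐] [CompleteSpace 𝓐]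
  {lam : Measure ℝ} [IsFiniteMeasure lam] {F : ℝ → 𝓐} {m : ℕ} {μ : ℝ} {q : ℝ → 𝓐}
  {f : ℝ → ℂ → ℂ} {z : ℂ}

/-- A character χ evaluates the identity in the algebra at the point z, and turns F into f(·, z). -/
theorem isInvLaplace_resSol (hF : Continuous F) (hm : 1 ≤ m) (hμ : μ ∈ Ioc ((m : ℝ) - 1) m)
    (hq : IsResKer lam F (m - 1) μ q) (χ : 𝓐 →A[ℝ] ℂ)
    (hχ : ∀ α ∈ Icc (0 : ℝ) (m - 1), χ (F α) = f α z) {β : ℝ} (hβ : β ≤ μ - 1) :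
    IsInvLaplace (fun s => ((s ^ β : ℝ) : ℂ) / charFun m μ lam f s z)
      fun t => χ (resSol q (μ - β) t) := by
  have hm' : (1 : ℝ) ≤ m := by exact_mod_cast hm
  have hM : (0 : ℝ) ≤ m - 1 := by linarith
  refine ⟨(χ.cont.comp (continuous_resSol hq.mild (by linarith))).continuousOn, ?_⟩
  obtain ⟨s₀, hs₀, h⟩ := laplace_resSol hF hM hμ.1 hq (γ := μ - β) (by linarith)
  have hr : ∀ r : ℝ, χ (algebraMap ℝ 𝓐 r) = (r : ℂ) := fun r => χ.toAlgHom.commutes r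
  let χL : 𝓐 →L[ℝ] ℂ := ⟨χ.toAlgHom.toLinearMap, χ.cont⟩
  refine ⟨s₀, fun s hs => ?_⟩
  obtain ⟨hi, he⟩ := h s hs
  have hs0 : 0 < s := hs₀.trans_lt hs
  have hEq : ∀ t, (Real.exp (-(s * t)) : ℂ) * χ (resSol q (μ - β) t) =
      χL (Real.exp (-(s * t)) • resSol q (μ - β) t) := by
    intro t
    rw [map_smul, Complex.real_smul]
    rfl
  simp only [hEq]
  refine ⟨χL.integrable_comp hi, ?_⟩
  rw [χL.integral_comp_comm hi]
  have hint : χL (∫ α in Icc 0 ((m : ℝ) - 1), F α * algebraMap ℝ 𝓐 (s ^ α) ∂lam) =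
      ∫ α in Icc (0 : ℝ) (m - 1), f α z * ((s ^ α : ℝ) : ℂ) ∂lam := by
    rw [← χL.integral_comp_comm]
    · refine setIntegral_congr_fun measurableSet_Icc fun α hα => ?_
      change χ _ = _
      rw [map_mul, hχ α hα, hr]
    · refine ContinuousOn.integrableOn_compact isCompact_Icc (ContinuousOn.mul hF.continuousOn ?_)
      exact (algebraMapCLM ℝ 𝓐).continuous.comp_continuousOn (ContinuousOn.rpow continuousOn_const
        (by fun_prop) fun _ _ => Or.inl hs0.ne')
  have key := congrArg χ he
  rw [map_mul, map_add, hr, hr, sub_sub_cancel] at key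
  change χ _ * (_ + χL _) = _ at key
  rw [hint] at key
  -- A transform times Δ(s, z) equals s^β, which is not 0; so Δ(s, z) ≠ 0 comes out of the identity
  -- itself.
  have hne : charFun m μ lam f s z ≠ 0 := by
    intro h0
    rw [charFun] at h0
    rw [h0, mul_zero] at key
    exact (Real.rpow_pos_of_pos hs0 β).ne' (by exact_mod_cast key.symm)
  rw [eq_div_iff hne]
  exact key

theorem cFun_eq (hF : Continuous F) (hm : 1 ≤ m) (hμ : μ ∈ Ioc ((m : ℝ) - 1) m)
    (hq : IsResKer lam F (m - 1) μ q) (χ : 𝓐 →A[ℝ] ℂ)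
    (hχ : ∀ α ∈ Icc (0 : ℝ) (m - 1), χ (F α) = f α z) {β : ℝ} (hβ : β ≤ μ - 1) {t : ℝ}
    (ht : 0 ≤ t) : cFun m μ lam f β t z = χ (resSol q (μ - β) t) :=
  (isInvLaplace_resSol hF hm hμ hq χ hχ hβ).invLaplace_eq ht

theorem mul_cFun_eq (hF : Continuous F) (hm : 1 ≤ m) (hμ : μ ∈ Ioc ((m : ℝ) - 1) m)
    (hq : IsResKer lam F (m - 1) μ q) (χ : 𝓐 →A[ℝ] ℂ)
    (hχ : ∀ α ∈ Icc (0 : ℝ) (m - 1), χ (F α) = f α z) (k : ℕ) {t : ℝ} (ht : 0 ≤ t) :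
    ∀ α ∈ Ioc (k : ℝ) (m - 1), χ (F α * resSol q (μ + k + 1 - α) t) =
      f α z * cFun m μ lam f (α - k - 1) t z := by
  intro α hα
  have hk : (0 : ℝ) ≤ k := k.cast_nonneg
  rw [map_mul, hχ α (Ioc_nat_subset k _ hα), cFun_eq hF hm hμ hq χ hχ
    (by linarith [hα.2, hμ.1]) ht]
  ring_nf

theorem integrableOn_mul_cFun (hF : Continuous F) (hm : 1 ≤ m) (hμ : μ ∈ Ioc ((m : ℝ) - 1) m)
    (hq : IsResKer lam F (m - 1) μ q) (χ : 𝓐 →A[ℝ] ℂ)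
    (hχ : ∀ α ∈ Icc (0 : ℝ) (m - 1), χ (F α) = f α z) (k : ℕ) {t : ℝ} (ht : 0 ≤ t) :
    IntegrableOn (fun α => f α z * cFun m μ lam f (α - k - 1) t z) (Ioc (k : ℝ) (m - 1)) lam :=
  IntegrableOn.congr_fun ((⟨χ.toAlgHom.toLinearMap, χ.cont⟩ : 𝓐 →L[ℝ] ℂ).integrable_comp
    (integrableOn_mul_resSol hF hm hμ hq.mild k ht)) (mul_cFun_eq hF hm hμ hq χ hχ k ht)
    measurableSet_Ioc

/-- By uniqueness of inverse Laplace transforms every algebra with a character at z computes the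
same number S_k(t, z); this links the different choices of algebra. -/
theorem solSymbol_eq (hF : Continuous F) (hm : 1 ≤ m) (hμ : μ ∈ Ioc ((m : ℝ) - 1) m)
    (hq : IsResKer lam F (m - 1) μ q) (χ : 𝓐 →A[ℝ] ℂ)
    (hχ : ∀ α ∈ Icc (0 : ℝ) (m - 1), χ (F α) = f α z) (k : ℕ) {t : ℝ} (ht : 0 ≤ t) :
    solSymbol m μ lam f k t z = χ (solFun lam F m μ q k t) := by
  have hk : (0 : ℝ) ≤ k := k.cast_nonneg
  rw [solSymbol, solFun, map_add, cFun_eq hF hm hμ hq χ hχ (by linarith) ht,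
    show μ - (μ - k - 1) = (k : ℝ) + 1 by ring,
    ← setIntegral_congr_fun measurableSet_Ioc (mul_cFun_eq hF hm hμ hq χ hχ k ht)]
  congr 1
  exact (⟨χ.toAlgHom.toLinearMap, χ.cont⟩ : 𝓐 →L[ℝ] ℂ).integral_comp_comm
    (integrableOn_mul_resSol hF hm hμ hq.mild k ht)

end Symbols

/-! ### Algebras of continuous and of holomorphic functions -/

/-- Joint continuity curries to continuity in the supremum norm on K. Clamping α to [0, M] extends
the family continuously to all of ℝ. -/
theorem exists_continuous_family {f : ℝ → ℂ → ℂ} {G K : Set ℂ} {M : ℝ} (hM : 0 ≤ M)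
    (hf : ContinuousOn (fun p : ℝ × ℂ => f p.1 p.2) (Icc (0 : ℝ) M ×ˢ G)) (hK : K ⊆ G) :
    ∃ F : C(ℝ, C(K, ℂ)), ∀ (α : ℝ) (z : K), F α z = f (projIcc 0 M hM α) z := by
  have h : Continuous fun p : ℝ × K => f (projIcc 0 M hM p.1) p.2 := by
    refine hf.comp_continuous (f := fun p : ℝ × K => ((projIcc 0 M hM p.1 : ℝ), (p.2 : ℂ))) ?_
      fun p => ⟨(projIcc 0 M hM p.1).2, hK p.2.2⟩
    exact (continuous_subtype_val.comp (continuous_projIcc.comp continuous_fst)).prodMk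
      (continuous_subtype_val.comp continuous_snd)
  exact ⟨ContinuousMap.curry ⟨_, h⟩, fun α z => rfl⟩

/-- Evaluation at a point, as a homomorphism of real algebras. -/
def evalHom {K : Type*} [TopologicalSpace K] [CompactSpace K] (z : K) : C(K, ℂ) →A[ℝ] ℂ where
  toAlgHom := ContinuousMap.evalAlgHom ℝ ℂ z
  cont := continuous_eval_const z

/-- The extension by `0` of a function on a closed disc. -/
def discExt {c : ℂ} {r : ℝ} (b : C(Metric.closedBall c r, ℂ)) (z : ℂ) : ℂ :=
  Function.extend Subtype.val b 0 z

theorem discExt_apply {c : ℂ} {r : ℝ} (b : C(Metric.closedBall c r, ℂ)) {z : ℂ}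
    (hz : z ∈ Metric.closedBall c r) : discExt b z = b ⟨z, hz⟩ :=
  Subtype.val_injective.extend_apply b 0 ⟨z, hz⟩

/-- The algebra of functions that are continuous on a closed disc and holomorphic in its
interior. -/
def discAlgebra (c : ℂ) (r : ℝ) : Subalgebra ℝ C(Metric.closedBall c r, ℂ) where
  carrier := {b | DifferentiableOn ℂ (discExt b) (Metric.ball c r)}
  mul_mem' := fun {a b} ha hb => (DifferentiableOn.mul ha hb).congr fun z hz => by
    have hz' := Metric.ball_subset_closedBall hz
    rw [Pi.mul_apply, discExt_apply _ hz', discExt_apply _ hz', discExt_apply _ hz']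
    rfl
  add_mem' := fun {a b} ha hb => (DifferentiableOn.add ha hb).congr fun z hz => by
    have hz' := Metric.ball_subset_closedBall hz
    rw [Pi.add_apply, discExt_apply _ hz', discExt_apply _ hz', discExt_apply _ hz']
    rfl
  algebraMap_mem' := fun x => (differentiableOn_const (x : ℂ)).congr fun z hz => by
    rw [discExt_apply _ (Metric.ball_subset_closedBall hz)]
    rfl

/-- Uniform limits of holomorphic functions are holomorphic. The resulting completeness is what the
Bochner integrals and the Neumann series need. -/
theorem isClosed_discAlgebra (c : ℂ) (r : ℝ) :
    IsClosed (discAlgebra c r : Set C(Metric.closedBall c r, ℂ)) := by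
  refine IsSeqClosed.isClosed fun b b₀ hb hlim => ?_
  have h := ContinuousMap.tendsto_iff_tendstoUniformly.1 hlim
  refine TendstoLocallyUniformlyOn.differentiableOn (F := fun n => discExt (b n)) (φ := atTop) ?_
    (Eventually.of_forall hb) Metric.isOpen_ball
  refine TendstoUniformlyOn.tendstoLocallyUniformlyOn fun u hu => ?_
  filter_upwards [h u hu] with n hn z hz
  have hz' := Metric.ball_subset_closedBall hz
  rw [discExt_apply _ hz', discExt_apply _ hz']
  exact hn _

instance (c : ℂ) (r : ℝ) : CompleteSpace (discAlgebra c r) :=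
  (isClosed_discAlgebra c r).completeSpace_coe

/-- Evaluation at a point of the closed disc. -/
def discEval {c : ℂ} {r : ℝ} (z : Metric.closedBall c r) : discAlgebra c r →A[ℝ] ℂ where
  toAlgHom := (ContinuousMap.evalAlgHom ℝ ℂ z).comp (discAlgebra c r).val
  cont := (continuous_eval_const z).comp continuous_subtype_val

/-! ### The symbols of the given f: existence, integrability, analyticity -/

section

variable {G : Set ℂ} {m : ℕ} {μ : ℝ} {lam : Measure ℝ} [IsFiniteMeasure lam] {f : ℝ → ℂ → ℂ}

/-- A family of elements of the algebra `𝓐` that represents `f` at a point `z`. -/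
theorem exists_scalar_family (hm : 1 ≤ m)
    (hf : ContinuousOn (fun p : ℝ × ℂ => f p.1 p.2) (Icc (0 : ℝ) (m - 1) ×ˢ G)) {z : ℂ}
    (hz : z ∈ G) : ∃ F : ℝ → ℂ, Continuous F ∧
      ∀ α ∈ Icc (0 : ℝ) (m - 1), ContinuousAlgHom.id ℝ ℂ (F α) = f α z := by
  have hm' : (1 : ℝ) ≤ m := by exact_mod_cast hm
  obtain ⟨F, hF⟩ := exists_continuous_family (K := {z}) (by linarith) hf (by simpa using hz)
  refine ⟨fun α => F α ⟨z, rfl⟩, (continuous_eval_const _).comp F.continuous,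
    fun α hα => ?_⟩
  change F α _ = _
  rw [hF, projIcc_of_mem _ hα]

theorem isInvLaplace_cFun (hm : 1 ≤ m) (hμ : μ ∈ Ioc ((m : ℝ) - 1) m)
    (hf : ContinuousOn (fun p : ℝ × ℂ => f p.1 p.2) (Icc (0 : ℝ) (m - 1) ×ˢ G)) {z : ℂ}
    (hz : z ∈ G) {β : ℝ} (hβ : β ≤ μ - 1) :
    IsInvLaplace (fun s => ((s ^ β : ℝ) : ℂ) / charFun m μ lam f s z)
      fun t => cFun m μ lam f β t z := by
  have hm' : (1 : ℝ) ≤ m := by exact_mod_cast hm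
  obtain ⟨F, hF, hχ⟩ := exists_scalar_family hm hf hz
  obtain ⟨q, hq⟩ := exists_isResKer (lam := lam) hF (M := m - 1) (by linarith) hμ.1
    (by linarith [hμ.2])
  exact isInvLaplace_invLaplace (isInvLaplace_resSol hF hm hμ hq _ hχ hβ)

theorem integrableOn_symbol (hm : 1 ≤ m) (hμ : μ ∈ Ioc ((m : ℝ) - 1) m)
    (hf : ContinuousOn (fun p : ℝ × ℂ => f p.1 p.2) (Icc (0 : ℝ) (m - 1) ×ˢ G)) {z : ℂ}
    (hz : z ∈ G) (k : ℕ) {t : ℝ} (ht : 0 ≤ t) :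
    IntegrableOn (fun α => f α z * cFun m μ lam f (α - k - 1) t z) (Ioc (k : ℝ) (m - 1)) lam := by
  have hm' : (1 : ℝ) ≤ m := by exact_mod_cast hm
  obtain ⟨F, hF, hχ⟩ := exists_scalar_family hm hf hz
  obtain ⟨q, hq⟩ := exists_isResKer (lam := lam) hF (M := m - 1) (by linarith) hμ.1
    (by linarith [hμ.2])
  exact integrableOn_mul_cFun hF hm hμ hq _ hχ k ht

/-- Near each point, S_k(t, ·) is the function represented by the element `solFun` of a disc
algebra, so it is holomorphic without differentiating under any integral. -/
theorem differentiableOn_solSymbol (hG : IsOpen G) (hm : 1 ≤ m) (hμ : μ ∈ Ioc ((m : ℝ) - 1) m)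
    (hf : ContinuousOn (fun p : ℝ × ℂ => f p.1 p.2) (Icc (0 : ℝ) (m - 1) ×ˢ G))
    (hf_an : ∀ α ∈ Icc (0 : ℝ) (m - 1), DifferentiableOn ℂ (f α) G) (k : ℕ) {t : ℝ} (ht : 0 ≤ t) :
    DifferentiableOn ℂ (solSymbol m μ lam f k t) G := by
  have hm' : (1 : ℝ) ≤ m := by exact_mod_cast hm
  have hM : (0 : ℝ) ≤ m - 1 := by linarith
  intro c hc
  obtain ⟨r, hr, hrG⟩ := Metric.nhds_basis_closedBall.mem_iff.1 (hG.mem_nhds hc)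
  obtain ⟨F, hF⟩ := exists_continuous_family hM hf hrG
  have hmem : ∀ α, F α ∈ discAlgebra c r := by
    intro α
    refine ((hf_an _ (projIcc 0 ((m : ℝ) - 1) hM α).2).mono
      (Metric.ball_subset_closedBall.trans hrG)).congr fun z hz => ?_
    rw [discExt_apply _ (Metric.ball_subset_closedBall hz), hF]
  let F' : ℝ → discAlgebra c r := fun α => ⟨F α, hmem α⟩
  have hF' : Continuous F' := F.continuous.subtype_mk _
  obtain ⟨q, hq⟩ := exists_isResKer (lam := lam) hF' hM hμ.1 (by linarith [hμ.2])
  have hEq : ∀ z ∈ Metric.ball c r, solSymbol m μ lam f k t z =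
      discExt (solFun lam F' m μ q k t).1 z := by
    intro z hz
    have hz' := Metric.ball_subset_closedBall hz
    rw [discExt_apply _ hz', solSymbol_eq hF' hm hμ hq (discEval ⟨z, hz'⟩) (fun α hα => ?_) k ht]
    · rfl
    · change F α _ = _
      rw [hF, projIcc_of_mem _ hα]
  have hd : DifferentiableOn ℂ (solSymbol m μ lam f k t) (Metric.ball c r) :=
    DifferentiableOn.congr (solFun lam F' m μ q k t).2 hEq
  exact (hd.differentiableAt (Metric.ball_mem_nhds c hr)).differentiableWithinAt

end

/-! ### Power series in an element of a Banach algebra -/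

section PowerSeriesCalculus

variable {𝓑 : Type*} [NormedRing 𝓑] [NormedAlgebra ℂ 𝓑] [CompleteSpace 𝓑]
  {G : Set ℂ} {b b₁ b₂ : ℂ → ℂ} {c : ℂ} {ν r : ℝ} {a : 𝓑}

/-- The Taylor coefficients of `b` at `c`. -/
def taylorCoeff (b : ℂ → ℂ) (c : ℂ) (n : ℕ) : ℂ :=
  iteratedDeriv n b c / (n.factorial : ℂ)

/-- The element `b (c + a)` of a Banach algebra, given by the Taylor series of `b` at `c`. -/
def powerCalc (b : ℂ → ℂ) (c : ℂ) (a : 𝓑) : 𝓑 :=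
  ∑' n, taylorCoeff b c n • a ^ n

theorem norm_taylorCoeff_le (hr : 0 < r) (hb : DifferentiableOn ℂ b G)
    (hG : Metric.closedBall c r ⊆ G) : ∃ C, ∀ n, ‖taylorCoeff b c n‖ ≤ C / r ^ n := by
  have hb' := hb.mono hG
  obtain ⟨C, hC⟩ := (isCompact_sphere c r).exists_bound_of_continuousOn
    (hb'.continuousOn.mono Metric.sphere_subset_closedBall)
  refine ⟨C, fun n => ?_⟩
  have h := Complex.norm_iteratedDeriv_le_of_forall_mem_sphere_norm_le n hr
    (hb'.diffContOnCl_ball subset_rfl) hC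
  rw [taylorCoeff, norm_div, Complex.norm_natCast, div_le_iff₀ (by positivity)]
  exact h.trans_eq (by ring)

/-- Only ‖1‖ ≤ 1 is assumed, because the operators on a trivial space of orbits have 1 = 0. -/
theorem norm_pow_le_of_le (h1 : ‖(1 : 𝓑)‖ ≤ 1) (ha : ‖a‖ ≤ ν) (n : ℕ) : ‖a ^ n‖ ≤ ν ^ n := by
  have hν : 0 ≤ ν := (norm_nonneg a).trans ha
  induction n with
  | zero => simpa using h1
  | succ n ih =>
    rw [pow_succ, pow_succ]
    exact (norm_mul_le _ _).trans (mul_le_mul ih ha (norm_nonneg _) (by positivity))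

theorem summable_norm_powerCalc (h1 : ‖(1 : 𝓑)‖ ≤ 1) (ha : ‖a‖ ≤ ν) (hr : ν < r)
    (hb : DifferentiableOn ℂ b G) (hG : Metric.closedBall c r ⊆ G) :
    Summable fun n => ‖taylorCoeff b c n • a ^ n‖ := by
  have hν : 0 ≤ ν := (norm_nonneg a).trans ha
  have hr0 : 0 < r := hν.trans_lt hr
  obtain ⟨C, hC⟩ := norm_taylorCoeff_le hr0 hb hG
  refine Summable.of_nonneg_of_le (fun n => norm_nonneg _) (fun n => ?_)
    ((summable_geometric_of_lt_one (div_nonneg hν hr0.le) ((div_lt_one hr0).2 hr)).mul_left C)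
  rw [norm_smul, div_pow]
  refine (mul_le_mul (hC n) (norm_pow_le_of_le h1 ha n) (norm_nonneg _)
    ((norm_nonneg _).trans (hC n))).trans_eq (by ring)

theorem hasSum_powerCalc (h1 : ‖(1 : 𝓑)‖ ≤ 1) (ha : ‖a‖ ≤ ν) (hr : ν < r)
    (hb : DifferentiableOn ℂ b G) (hG : Metric.closedBall c r ⊆ G) :
    HasSum (fun n => taylorCoeff b c n • a ^ n) (powerCalc b c a) :=
  (summable_norm_powerCalc h1 ha hr hb hG).of_norm.hasSum

theorem taylorCoeff_mul (hG : G ∈ 𝓝 c) (hb₁ : DifferentiableOn ℂ b₁ G)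
    (hb₂ : DifferentiableOn ℂ b₂ G) (n : ℕ) :
    taylorCoeff (fun z => b₁ z * b₂ z) c n =
      ∑ p ∈ Finset.HasAntidiagonal.antidiagonal n, taylorCoeff b₁ c p.1 * taylorCoeff b₂ c p.2 := by
  have h₁ : ContDiffAt ℂ n b₁ c := (hb₁.analyticAt hG).contDiffAt
  have h₂ : ContDiffAt ℂ n b₂ c := (hb₂.analyticAt hG).contDiffAt
  rw [taylorCoeff, iteratedDeriv_fun_mul h₁ h₂, Finset.sum_div,
    Finset.Nat.sum_antidiagonal_eq_sum_range_succ
      (fun i j => taylorCoeff b₁ c i * taylorCoeff b₂ c j)]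
  refine Finset.sum_congr rfl fun i hi => ?_
  have hi : i ≤ n := Nat.lt_succ_iff.1 (Finset.mem_range.1 hi)
  rw [taylorCoeff, taylorCoeff, Nat.cast_choose ℂ hi]
  have h0 : (n.factorial : ℂ) ≠ 0 := Nat.cast_ne_zero.2 n.factorial_ne_zero
  field_simp

/-- Leibniz' rule for Taylor coefficients matches the Cauchy product of the two series. -/
theorem powerCalc_mul (h1 : ‖(1 : 𝓑)‖ ≤ 1) (ha : ‖a‖ ≤ ν) (hr : ν < r)
    (hb₁ : DifferentiableOn ℂ b₁ G) (hb₂ : DifferentiableOn ℂ b₂ G)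
    (hG : Metric.closedBall c r ⊆ G) :
    powerCalc (fun z => b₁ z * b₂ z) c a = powerCalc b₁ c a * powerCalc b₂ c a := by
  have hr0 : 0 < r := ((norm_nonneg a).trans ha).trans_lt hr
  rw [powerCalc, powerCalc, powerCalc, tsum_mul_tsum_eq_tsum_sum_antidiagonal_of_summable_norm
    (summable_norm_powerCalc h1 ha hr hb₁ hG) (summable_norm_powerCalc h1 ha hr hb₂ hG)]
  refine tsum_congr fun n => ?_
  rw [taylorCoeff_mul (mem_of_superset (Metric.closedBall_mem_nhds c hr0) hG) hb₁ hb₂,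
    Finset.sum_smul]
  refine Finset.sum_congr rfl fun p hp => ?_
  rw [smul_mul_smul_comm, ← pow_add, Finset.HasAntidiagonal.mem_antidiagonal.1 hp]

variable {z : ℂ}

theorem sub_eq_smul_one_sub (hz : z ≠ c) :
    algebraMap ℂ 𝓑 z - (algebraMap ℂ 𝓑 c + a) = (z - c) • (1 - (z - c)⁻¹ • a) := by
  rw [smul_sub, smul_inv_smul₀ (sub_ne_zero.2 hz), Algebra.algebraMap_eq_smul_one,
    Algebra.algebraMap_eq_smul_one, sub_smul]
  abel

theorem mem_resolventSet_add (h1 : ‖(1 : 𝓑)‖ ≤ 1) (hz : ‖a‖ < ‖z - c‖) :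
    z ∈ resolventSet ℂ (algebraMap ℂ 𝓑 c + a) := by
  have h : z - c ∈ resolventSet ℂ a := spectrum.mem_resolventSet_of_norm_lt_mul
    ((mul_le_of_le_one_right (norm_nonneg _) h1).trans_lt hz)
  rw [spectrum.mem_resolventSet_iff] at h ⊢
  rwa [← sub_sub, ← map_sub]

theorem hasSum_resolvent (hz : ‖a‖ < ‖z - c‖) :
    HasSum (fun n : ℕ => ((z - c) ^ (n + 1))⁻¹ • a ^ n) (resolvent (algebraMap ℂ 𝓑 c + a) z) := by
  have hz0 : 0 < ‖z - c‖ := (norm_nonneg a).trans_lt hz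
  have hzc : z - c ≠ 0 := norm_pos_iff.1 hz0
  have hx : ‖(z - c)⁻¹ • a‖ < 1 := by
    rw [norm_smul, norm_inv, inv_mul_lt_one₀ hz0]
    exact hz
  have h := (hasSum_geom_series_inverse _ hx).const_smul (z - c)⁻¹
  have e : resolvent (algebraMap ℂ 𝓑 c + a) z =
      (z - c)⁻¹ • Ring.inverse (1 - (z - c)⁻¹ • a) := by
    have hu : IsUnit (1 - (z - c)⁻¹ • a) := isUnit_one_sub_of_norm_lt_one hx
    have hm : (algebraMap ℂ 𝓑 z - (algebraMap ℂ 𝓑 c + a)) *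
        ((z - c)⁻¹ • Ring.inverse (1 - (z - c)⁻¹ • a)) = 1 := by
      rw [sub_eq_smul_one_sub (sub_ne_zero.1 hzc), smul_mul_smul_comm, mul_inv_cancel₀ hzc,
        one_smul, Ring.mul_inverse_cancel _ hu]
    have hu' : IsUnit (algebraMap ℂ 𝓑 z - (algebraMap ℂ 𝓑 c + a)) := by
      rw [sub_eq_smul_one_sub (sub_ne_zero.1 hzc)]
      exact (hu.smul (Units.mk0 _ hzc) :)
    have hm' := congrArg (resolvent (algebraMap ℂ 𝓑 c + a) z * ·) hm
    simp only [← mul_assoc, mul_one] at hm'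
    rw [← hm', resolvent, Ring.inverse_mul_cancel _ hu', one_mul]
  rw [e]
  simpa only [smul_pow, smul_smul, inv_pow, pow_succ', mul_inv] using h

theorem hasDerivAt_resolvent_pow (h1 : ‖(1 : 𝓑)‖ ≤ 1) (hz : ‖a‖ < ‖z - c‖) (n : ℕ) :
    HasDerivAt (fun ζ => resolvent (algebraMap ℂ 𝓑 c + a) ζ ^ (n + 1))
      (-((n : ℂ) + 1) • resolvent (algebraMap ℂ 𝓑 c + a) z ^ (n + 2)) z := by
  have h := spectrum.hasDerivAt_resolvent_const_left (mem_resolventSet_add h1 hz)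
  induction n with
  | zero => simpa using h
  | succ n ih =>
    refine ((ih.mul h).congr_deriv ?_).congr_of_eventuallyEq
      (Eventually.of_forall fun ζ => pow_succ _ _)
    push_cast
    simp only [smul_mul_assoc, mul_neg, ← pow_succ, ← pow_add]
    module

theorem sphere_subset_resolvent (ha : ‖a‖ ≤ ν) (hr : ν < r) (hz : z ∈ Metric.sphere c r) :
    ‖a‖ < ‖z - c‖ := by
  rw [mem_sphere_iff_norm.1 hz]
  exact ha.trans_lt hr

theorem continuousOn_resolvent (h1 : ‖(1 : 𝓑)‖ ≤ 1) (ha : ‖a‖ ≤ ν) (hr : ν < r) :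
    ContinuousOn (resolvent (algebraMap ℂ 𝓑 c + a)) (Metric.sphere c r) := fun _ hz =>
  (spectrum.hasDerivAt_resolvent_const_left
    (mem_resolventSet_add h1 (sphere_subset_resolvent ha hr hz))).continuousAt.continuousWithinAt

/-- On the circle the resolvent is a geometric series of ratio at most ν/r < 1, so it may be
integrated term by term, and Cauchy's formula produces the Taylor coefficients of b. -/
theorem circleIntegral_smul_resolvent (h1 : ‖(1 : 𝓑)‖ ≤ 1) (ha : ‖a‖ ≤ ν) (hr : ν < r)
    (hb : DifferentiableOn ℂ b G) (hG : Metric.closedBall c r ⊆ G) :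
    (∮ z in C(c, r), b z • resolvent (algebraMap ℂ 𝓑 c + a) z) =
      (2 * Real.pi * Complex.I : ℂ) • powerCalc b c a := by
  have hν : 0 ≤ ν := (norm_nonneg a).trans ha
  have hr0 : 0 < r := hν.trans_lt hr
  have hbc : ContinuousOn b (Metric.sphere c r) :=
    (hb.mono hG).continuousOn.mono Metric.sphere_subset_closedBall
  have hbi : CircleIntegrable b c r := hbc.circleIntegrable hr0.le
  have hq : ν / r ∈ Ico (0 : ℝ) 1 := ⟨div_nonneg hν hr0.le, (div_lt_one hr0).2 hr⟩
  have key : HasSum (fun n : ℕ => ∮ z in C(c, r), b z • ((z - c) ^ (n + 1))⁻¹ • a ^ n)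
      (∮ z in C(c, r), b z • resolvent (algebraMap ℂ 𝓑 c + a) z) := by
    refine intervalIntegral.hasSum_integral_of_dominated_convergence
      (fun n θ => ‖b (circleMap c r θ)‖ * (ν / r) ^ n) (fun n => ?_) (fun n => ?_) ?_ ?_ ?_
    · simp only [deriv_circleMap]
      refine Continuous.aestronglyMeasurable ?_
      have hb' : Continuous fun θ => b (circleMap c r θ) :=
        hbc.comp_continuous (continuous_circleMap c r) fun θ => circleMap_mem_sphere c hr0.le θ
      have hi : Continuous fun θ => ((circleMap c r θ - c) ^ (n + 1))⁻¹ :=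
        (((continuous_circleMap c r).sub continuous_const).pow _).inv₀ fun θ =>
          pow_ne_zero _ (sub_ne_zero.2 (circleMap_ne_center hr0.ne'))
      exact ((continuous_circleMap 0 r).mul continuous_const).smul
        (hb'.smul (hi.smul continuous_const))
    · refine Eventually.of_forall fun θ _ => ?_
      have hp := norm_pow_le_of_le h1 ha n
      simp only [deriv_circleMap, norm_smul, norm_mul, norm_inv, norm_pow, Complex.norm_I,
        circleMap_sub_center, norm_circleMap_zero, abs_of_pos hr0, mul_one]
      rw [show r * (‖b (circleMap c r θ)‖ * ((r ^ (n + 1))⁻¹ * ‖a ^ n‖)) =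
        ‖b (circleMap c r θ)‖ * (‖a ^ n‖ / r ^ n) by rw [pow_succ]; field_simp, div_pow]
      gcongr
    · exact Eventually.of_forall fun _ _ => (summable_geometric_of_lt_one hq.1 hq.2).mul_left _
    · simpa only [tsum_mul_left, tsum_geometric_of_lt_one hq.1 hq.2] using
        hbi.norm.mul_continuousOn continuousOn_const
    · refine Eventually.of_forall fun θ _ => HasSum.const_smul _ (HasSum.const_smul _ ?_)
      exact hasSum_resolvent
        (sphere_subset_resolvent ha hr (circleMap_mem_sphere c hr0.le θ))
  refine key.unique ?_
  convert! (hasSum_powerCalc h1 ha hr hb hG).const_smul (2 * Real.pi * Complex.I : ℂ) using 2 with n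
  have h := ((hb.mono hG).diffContOnCl_ball subset_rfl).circleIntegral_one_div_sub_center_pow_smul
    hr0 n
  simp only [smul_smul, one_div, smul_eq_mul] at h ⊢
  rw [circleIntegral.integral_smul_const]
  simp only [mul_comm (b _)]
  rw [h, taylorCoeff]
  congr 1
  ring

end PowerSeriesCalculus

/-! ### The Banach spaces of orbits -/

section Orbits

open scoped ENNReal

variable {X : Type*} [NormedAddCommGroup X] [NormedSpace ℂ X] {A : X →ₗ.[ℂ] X} {G : Set ℂ}
  {c : ℂ} {ν : ℝ}

theorem isOrbit_shift_iff {w : ℕ → X} :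
    IsOrbit (shift A c) w ↔ ∀ k, (w k, c • w k + w (k + 1)) ∈ A.graph := by
  refine forall_congr' fun k => ⟨?_, ?_⟩
  · rintro ⟨h, e⟩
    refine (LinearPMap.mem_graph_iff A).2 ⟨⟨w k, h⟩, rfl, ?_⟩
    rw [← e]
    exact (add_sub_cancel (c • w k) (A ⟨w k, h⟩)).symm
  · intro h
    obtain ⟨⟨y, hy⟩, e₁, e₂⟩ := (LinearPMap.mem_graph_iff A).1 h
    simp only at e₁ e₂
    subst e₁
    refine ⟨hy, ?_⟩
    rw [← sub_eq_iff_eq_add'] at e₂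
    exact e₂

variable (A c ν) in
/-- The orbits `w` of `A - c` with `‖w k‖ ≤ C ν ^ k`, rescaled: the sequences `x` in `ℓ^∞` with
`(A - c) (x k) = ν x (k + 1)`. -/
def orbitSubmodule : Submodule ℂ (lp (fun _ : ℕ => X) ∞) where
  carrier := {x | ∀ k, (x k, c • x k + (ν : ℂ) • x (k + 1)) ∈ A.graph}
  zero_mem' := fun k => by
    simp
  add_mem' := fun {x y} hx hy k => by
    convert! A.graph.add_mem (hx k) (hy k) using 1
    simp only [lp.coeFn_add, Pi.add_apply, Prod.mk_add_mk, Prod.mk.injEq, true_and]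
    module
  smul_mem' := fun a x hx k => by
    convert! A.graph.smul_mem a (hx k) using 1
    simp only [lp.coeFn_smul, Pi.smul_apply, Prod.smul_mk, Prod.mk.injEq, true_and]
    module

variable (A c ν) in
/-- The Banach space of the rescaled orbits. -/
def orbitSpace : Type _ := orbitSubmodule A c ν

instance : NormedAddCommGroup (orbitSpace A c ν) :=
  inferInstanceAs (NormedAddCommGroup (orbitSubmodule A c ν))

instance : NormedSpace ℂ (orbitSpace A c ν) :=
  inferInstanceAs (NormedSpace ℂ (orbitSubmodule A c ν))

variable (A c ν) in
/-- The inclusion in `ℓ^∞`. -/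
def orbitCoe : orbitSpace A c ν →L[ℂ] lp (fun _ : ℕ => X) ∞ :=
  (orbitSubmodule A c ν).subtypeL

variable (A c ν) in
/-- The `k`-th term of a rescaled orbit. -/
def orbitEval (k : ℕ) : orbitSpace A c ν →L[ℂ] X :=
  (lp.evalCLM ℂ (fun _ : ℕ => X) ∞ k).comp (orbitCoe A c ν)

theorem orbitEval_mem (x : orbitSpace A c ν) (k : ℕ) :
    (orbitEval A c ν k x, c • orbitEval A c ν k x + (ν : ℂ) • orbitEval A c ν (k + 1) x) ∈
      A.graph :=
  x.2 k

theorem norm_orbitEval_le (x : orbitSpace A c ν) (k : ℕ) : ‖orbitEval A c ν k x‖ ≤ ‖x‖ :=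
  lp.norm_apply_le_norm ENNReal.top_ne_zero (orbitCoe A c ν x) k

/-- The orbit condition is stated through the graph of A, so for closed A it is a closed condition
on bounded sequences. -/
instance [hA : Fact A.IsClosed] [CompleteSpace X] : CompleteSpace (orbitSpace A c ν) := by
  refine IsClosed.completeSpace_coe (s := {x | x ∈ orbitSubmodule A c ν}) (hs := ?_)
  have : {x | x ∈ orbitSubmodule A c ν} =
      ⋂ k, {x : lp (fun _ : ℕ => X) ∞ | (x k, c • x k + (ν : ℂ) • x (k + 1)) ∈ A.graph} := by
    ext x
    simp only [mem_iInter]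
    rfl
  rw [this]
  refine isClosed_iInter fun k => IsClosed.preimage ?_ hA.out
  have h (j : ℕ) : Continuous fun x : lp (fun _ : ℕ => X) ∞ => x j :=
    (lp.evalCLM ℂ (fun _ : ℕ => X) ∞ j).continuous
  exact (h k).prodMk (((h k).const_smul c).add ((h (k + 1)).const_smul (ν : ℂ)))

theorem exists_orbitEval_eq {x : ℕ → X} {C : ℝ} (hC : ∀ k, ‖x k‖ ≤ C)
    (hx : ∀ k, (x k, c • x k + (ν : ℂ) • x (k + 1)) ∈ A.graph) :
    ∃ y : orbitSpace A c ν, (∀ k, orbitEval A c ν k y = x k) ∧ ‖y‖ ≤ C := by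
  have hm : Memℓp x ∞ := memℓp_infty ⟨C, by rintro _ ⟨k, rfl⟩; exact hC k⟩
  exact ⟨⟨⟨x, hm⟩, hx⟩, fun k => rfl,
    lp.norm_le_of_forall_le ((norm_nonneg _).trans (hC 0)) hC⟩

theorem orbitSpace_ext {x y : orbitSpace A c ν}
    (h : ∀ k, orbitEval A c ν k x = orbitEval A c ν k y) : x = y :=
  Subtype.ext (lp.ext (funext h))

/-- A - c moves an orbit one step; because of the rescaling this costs a factor ν, which makes A - c
a bounded operator of norm at most ν. -/
theorem exists_orbitShift (x : orbitSpace A c ν) :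
    ∃ y : orbitSpace A c ν,
      (∀ k, orbitEval A c ν k y = (ν : ℂ) • orbitEval A c ν (k + 1) x) ∧ ‖y‖ ≤ |ν| * ‖x‖ := by
  refine exists_orbitEval_eq (fun k => ?_) fun k => ?_
  · rw [norm_smul, Complex.norm_real, Real.norm_eq_abs]
    exact mul_le_mul_of_nonneg_left (norm_orbitEval_le x _) (abs_nonneg ν)
  · convert! A.graph.smul_mem (ν : ℂ) (orbitEval_mem x (k + 1)) using 1
    simp only [Prod.smul_mk, Prod.mk.injEq, true_and]
    module

variable (A c ν) in
/-- The operator `A - c` on the space of orbits. -/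
def orbitShift : orbitSpace A c ν →L[ℂ] orbitSpace A c ν :=
  LinearMap.mkContinuous
    { toFun := fun x => (exists_orbitShift x).choose
      map_add' := fun x y => orbitSpace_ext fun k => by
        rw [(exists_orbitShift (x + y)).choose_spec.1, map_add, map_add,
          (exists_orbitShift x).choose_spec.1, (exists_orbitShift y).choose_spec.1, smul_add]
      map_smul' := fun a x => orbitSpace_ext fun k => by
        rw [(exists_orbitShift (a • x)).choose_spec.1, map_smul, map_smul,
          (exists_orbitShift x).choose_spec.1, RingHom.id_apply, smul_comm a] }
    |ν| fun x => (exists_orbitShift x).choose_spec.2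

theorem orbitEval_orbitShift (k : ℕ) (x : orbitSpace A c ν) :
    orbitEval A c ν k (orbitShift A c ν x) = (ν : ℂ) • orbitEval A c ν (k + 1) x :=
  (exists_orbitShift x).choose_spec.1 k

theorem orbitEval_orbitShift_pow (n k : ℕ) (x : orbitSpace A c ν) :
    orbitEval A c ν k ((orbitShift A c ν ^ n) x) = (ν : ℂ) ^ n • orbitEval A c ν (k + n) x := by
  induction n generalizing k with
  | zero => simp
  | succ n ih =>
    rw [pow_succ', ContinuousLinearMap.mul_def, ContinuousLinearMap.comp_apply, orbitEval_orbitShift, ih, smul_smul,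
      ← pow_succ', add_right_comm, add_assoc]

theorem norm_orbitShift_le (hν : 0 ≤ ν) : ‖orbitShift A c ν‖ ≤ ν :=
  (LinearMap.mkContinuous_norm_le _ (abs_nonneg ν) _).trans_eq (abs_of_nonneg hν)

theorem norm_one_orbitSpace_le : ‖(1 : orbitSpace A c ν →L[ℂ] orbitSpace A c ν)‖ ≤ 1 :=
  ContinuousLinearMap.norm_id_le

variable (A c ν) in
/-- The operator `A` on the space of orbits. -/
def orbitOp : orbitSpace A c ν →L[ℂ] orbitSpace A c ν :=
  algebraMap ℂ (orbitSpace A c ν →L[ℂ] orbitSpace A c ν) c + orbitShift A c ν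

theorem orbitOp_apply (x : orbitSpace A c ν) : orbitOp A c ν x = c • x + orbitShift A c ν x := by
  rw [orbitOp, Algebra.algebraMap_eq_smul_one]
  rfl

theorem orbitEval_orbitOp_mem (x : orbitSpace A c ν) :
    (orbitEval A c ν 0 x, orbitEval A c ν 0 (orbitOp A c ν x)) ∈ A.graph := by
  rw [orbitOp_apply, map_add, map_smul, orbitEval_orbitShift]
  exact orbitEval_mem x 0

theorem exists_orbit_of_isOrbit (hν : 0 < ν) {w : ℕ → X} {C : ℝ} (hw : IsOrbit (shift A c) w)
    (hC : ∀ k, ‖w k‖ ≤ C * ν ^ k) :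
    ∃ x : orbitSpace A c ν, (∀ k, w k = (ν : ℂ) ^ k • orbitEval A c ν k x) ∧ ‖x‖ ≤ C := by
  have hν' : (ν : ℂ) ≠ 0 := Complex.ofReal_ne_zero.2 hν.ne'
  rw [isOrbit_shift_iff] at hw
  have hb (k : ℕ) : ‖((ν : ℂ) ^ k)⁻¹ • w k‖ ≤ C := by
    rw [norm_smul, norm_inv, norm_pow, Complex.norm_real, Real.norm_of_nonneg hν.le,
      inv_mul_le_iff₀ (by positivity), mul_comm]
    exact hC k
  obtain ⟨x, hx, hn⟩ := exists_orbitEval_eq (A := A) (c := c) (ν := ν) hb fun k => by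
    convert! A.graph.smul_mem ((ν : ℂ) ^ k)⁻¹ (hw k) using 1
    simp only [Prod.smul_mk, Prod.mk.injEq, true_and, smul_add, smul_smul]
    rw [pow_succ, mul_inv, mul_comm (_ : ℂ)⁻¹ (ν : ℂ)⁻¹, mul_inv_cancel_left₀ hν', mul_comm c]
  exact ⟨x, fun k => by rw [hx, smul_inv_smul₀ (pow_ne_zero k hν')], hn⟩

theorem isOrbit_orbitEval (x : orbitSpace A c ν) :
    IsOrbit (shift A c) fun k => (ν : ℂ) ^ k • orbitEval A c ν k x := by
  rw [isOrbit_shift_iff]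
  intro k
  convert! A.graph.smul_mem ((ν : ℂ) ^ k) (orbitEval_mem x k) using 1
  simp only [Prod.smul_mk, Prod.mk.injEq, true_and]
  module

theorem expBound_orbitEval (hν : 0 ≤ ν) (x : orbitSpace A c ν) :
    ExpBound (shift A c) ν ‖x‖ (orbitEval A c ν 0 x) := by
  refine ⟨_, by simp, isOrbit_orbitEval x, fun k => ?_⟩
  rw [norm_smul, norm_pow, Complex.norm_real, Real.norm_of_nonneg hν, mul_comm]
  exact mul_le_mul_of_nonneg_right (norm_orbitEval_le x k) (by positivity)

/-- A ball of radius slightly above ν avoids the boundary of G, contains c ∈ G and is connected, so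
it lies in G. -/
theorem Admissible.exists_closedBall_subset (hG : IsOpen G) (h : Admissible G c ν) :
    ∃ r, ν < r ∧ Metric.closedBall c r ⊆ G := by
  obtain ⟨hc, hν, hd⟩ := h
  obtain ⟨r, hr, hrd⟩ : ∃ r : ℝ, ν < r ∧ ENNReal.ofReal r < Metric.infEDist c (frontier G) := by
    obtain ⟨s, hs, hsd⟩ := ENNReal.lt_iff_exists_nnreal_btwn.1 hd
    refine ⟨s, (ENNReal.ofReal_lt_ofReal_iff_of_nonneg hν.le).1 ?_, ?_⟩ <;>
      simpa using! by assumption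
  refine ⟨r, hr, ?_⟩
  have hpre : IsPreconnected (Metric.closedBall c r) := (convex_closedBall c r).isPreconnected
  have hdisj : Metric.closedBall c r ∩ frontier G = ∅ := by
    rw [eq_empty_iff_forall_notMem]
    rintro z ⟨hz, hzG⟩
    have h1 := Metric.infEDist_le_edist_of_mem (x := c) hzG
    rw [edist_comm, edist_dist] at h1
    exact absurd (h1.trans (ENNReal.ofReal_le_ofReal hz)) (not_le.2 hrd)
  refine hpre.subset_of_closure_inter_subset hG
    ⟨c, Metric.mem_closedBall_self (hν.le.trans hr.le), hc⟩ fun z hz => ?_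
  by_contra hzG
  refine (eq_empty_iff_forall_notMem.1 hdisj) z ⟨hz.2, ?_⟩
  rw [hG.frontier_eq]
  exact ⟨hz.1, hzG⟩

theorem orbitEval_mem_expSubmodule (h : Admissible G c ν) (x : orbitSpace A c ν) :
    orbitEval A c ν 0 x ∈ expSubmodule A G :=
  Submodule.mem_iSup_of_mem c <| Submodule.mem_iSup_of_mem ν <| Submodule.mem_iSup_of_mem h
    ⟨‖x‖, expBound_orbitEval h.2.1.le x⟩

/-- The vector with a given orbit, as an element of `Exp_{A, G}(X)`. -/
def toExpₗ (h : Admissible G c ν) : orbitSpace A c ν →ₗ[ℂ] ExpSpace A G :=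
  LinearMap.codRestrict (expSubmodule A G) (orbitEval A c ν 0 : orbitSpace A c ν →ₗ[ℂ] X)
    (orbitEval_mem_expSubmodule h)

theorem val_injective : Function.Injective (val A G) :=
  Subtype.val_injective

theorem continuous_toExpₗ (h : Admissible G c ν) :
    Continuous (toExpₗ h : orbitSpace A c ν →ₗ[ℂ] ExpSpace A G) := by
  refine WithSeminorms.continuous_normedSpace_dom _ (withSeminorms A G) _ fun p => ?_
  obtain ⟨K, hK⟩ := p.2 c ν h
  refine ⟨K.toNNReal, fun x => ?_⟩
  refine (hK ‖x‖ _ (expBound_orbitEval h.2.1.le x)).trans ?_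
  exact mul_le_mul_of_nonneg_right (Real.le_coe_toNNReal K) (norm_nonneg x)

/-- The vector with a given orbit, as an element of `Exp_{A, G}(X)`. -/
def toExp (h : Admissible G c ν) : orbitSpace A c ν →L[ℂ] ExpSpace A G :=
  ⟨toExpₗ h, continuous_toExpₗ h⟩

theorem val_toExp (h : Admissible G c ν) (x : orbitSpace A c ν) :
    val A G (toExp h x) = orbitEval A c ν 0 x :=
  rfl

theorem exists_toExp_eq (h : Admissible G c ν) {C : ℝ} {u : ExpSpace A G}
    (hu : ExpBound (shift A c) ν C (val A G u)) :
    ∃ x : orbitSpace A c ν, toExp h x = u ∧ ‖x‖ ≤ C := by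
  obtain ⟨w, hw0, hw, hC⟩ := hu
  obtain ⟨x, hx, hn⟩ := exists_orbit_of_isOrbit h.2.1 hw hC
  refine ⟨x, val_injective ?_, hn⟩
  rw [val_toExp, ← hw0, hx 0, pow_zero, one_smul]

/-- Vectors of `ExpSpace` are finite sums of heads of orbits, so an additive property need only be
checked on the Banach spaces of orbits. -/
theorem expSpace_induction {p : ExpSpace A G → Prop} (hadd : ∀ u v, p u → p v → p (u + v))
    (h0 : p 0)
    (hp : ∀ c ν, ∀ h : Admissible G c ν, ∀ x : orbitSpace A c ν, p (toExp h x))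
    (u : ExpSpace A G) : p u := by
  obtain ⟨v, hv⟩ := u
  refine Submodule.iSup_induction' (motive := fun v hv => p ⟨v, hv⟩) _ (fun c v hv => ?_) h0
    (fun u v hu hv => hadd ⟨u, _⟩ ⟨v, _⟩) hv
  refine Submodule.iSup_induction' (p := fun ν => ⨆ _ : Admissible G c ν, expType (shift A c) ν)
    (motive := fun v hv => p ⟨v, Submodule.mem_iSup_of_mem c hv⟩) (fun ν v hv => ?_) h0
    (fun u v hu hv => hadd ⟨u, _⟩ ⟨v, _⟩) hv
  refine Submodule.iSup_induction' (p := fun _ : Admissible G c ν => expType (shift A c) ν)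
    (motive := fun v hv => p ⟨v, Submodule.mem_iSup_of_mem c (Submodule.mem_iSup_of_mem ν hv)⟩)
    (fun h v hv => ?_) h0 (fun u v hu hv => hadd ⟨u, _⟩ ⟨v, _⟩) hv
  obtain ⟨C, hC⟩ := hv
  obtain ⟨x, hx, -⟩ := exists_toExp_eq h (u := ⟨v, Submodule.mem_iSup_of_mem c
    (Submodule.mem_iSup_of_mem ν (Submodule.mem_iSup_of_mem h ⟨C, hC⟩))⟩) hC
  rw [← hx]
  exact hp c ν h x

theorem continuous_of_orbits {Y : Type*} [NormedAddCommGroup Y] [NormedSpace ℂ Y]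
    (φ : ExpSpace A G →ₗ[ℂ] Y)
    (hφ : ∀ c ν, ∀ h : Admissible G c ν, Continuous fun x : orbitSpace A c ν => φ (toExp h x)) :
    Continuous φ := by
  refine continuous_of_step A G φ fun c ν h => ?_
  let L : orbitSpace A c ν →L[ℂ] Y := ⟨φ.comp (toExpₗ h), hφ c ν h⟩
  refine ⟨‖L‖, fun C u hu => ?_⟩
  obtain ⟨x, rfl, hx⟩ := exists_toExp_eq h hu
  exact (L.le_opNorm x).trans (mul_le_mul_of_nonneg_left hx (norm_nonneg L))

theorem continuous_expSpace_of_orbits (φ : ExpSpace A G →ₗ[ℂ] ExpSpace A G)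
    (hφ : ∀ c ν, ∀ h : Admissible G c ν, Continuous fun x : orbitSpace A c ν => φ (toExp h x)) :
    Continuous φ := by
  have := (withSeminorms A G).topologicalAddGroup
  refine (withSeminorms A G).continuous_of_continuous_comp φ fun p => ?_
  refine (withSeminorms A G).continuous_seminorm ⟨p.1.comp φ, fun c ν h => ?_⟩
  have hc : Continuous ((p.1 : Seminorm ℂ (ExpSpace A G)).comp (φ.comp (toExpₗ h)) :
      orbitSpace A c ν → ℝ) :=
    ((withSeminorms A G).continuous_seminorm p).comp (hφ c ν h)
  obtain ⟨K, hK, hb⟩ := Seminorm.bound_of_continuous_normedSpace _ hc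
  refine ⟨K, fun C u hu => ?_⟩
  obtain ⟨x, rfl, hx⟩ := exists_toExp_eq h hu
  exact (hb x).trans (mul_le_mul_of_nonneg_left hx hK.le)

end Orbits

/-! ### Cutoff functions and the Cauchy--Riemann operator -/

section Dbar

variable {Y : Type*} [NormedAddCommGroup Y] [NormedSpace ℂ Y] {G K K' : Set ℂ} {χ χ₁ χ₂ : ℂ → ℂ}
  {g : ℂ → Y}

/-- Twice the Cauchy--Riemann operator `∂ / ∂z̄`. -/
def dbar (F : ℂ → Y) (ζ : ℂ) : Y :=
  fderiv ℝ F ζ 1 + Complex.I • fderiv ℝ F ζ Complex.I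

/-- `χ` is continuously differentiable, with compact support in `G`, and `χ = 1` near `K`. -/
structure IsCutoff (K G : Set ℂ) (χ : ℂ → ℂ) : Prop where
  contDiff : ContDiff ℝ 1 χ
  compact : HasCompactSupport χ
  supp : tsupport χ ⊆ G
  one : ∀ ζ ∈ K, χ =ᶠ[𝓝 ζ] fun _ => 1

theorem IsCutoff.mono (h : IsCutoff K' G χ) (hK : K ⊆ K') : IsCutoff K G χ :=
  ⟨h.contDiff, h.compact, h.supp, fun ζ hζ => h.one ζ (hK hζ)⟩

theorem dbar_eq_zero {F : ℂ → Y} {ζ : ℂ} {a : Y} (h : F =ᶠ[𝓝 ζ] fun _ => a) : dbar F ζ = 0 := by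
  simp [dbar, h.fderiv_eq]

/-- Leibniz' rule; the two terms with the derivative of g cancel, since that derivative is complex
linear. -/
theorem dbar_smul {ζ : ℂ} (hχ : DifferentiableAt ℝ χ ζ) (hg : DifferentiableAt ℂ g ζ) :
    dbar (fun z => χ z • g z) ζ = dbar χ ζ • g ζ := by
  have h : HasFDerivAt (fun z => χ z • g z) _ ζ :=
    hχ.hasFDerivAt.smul (hg.hasFDerivAt.restrictScalars ℝ)
  have hI : (fderiv ℂ g ζ) Complex.I = Complex.I • (fderiv ℂ g ζ) 1 := by
    rw [← map_smul, smul_eq_mul, mul_one]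
  rw [dbar, h.fderiv, dbar]
  simp only [add_apply, smul_apply,
    ContinuousLinearMap.coe_restrictScalars', ContinuousLinearMap.smulRight_apply, hI, smul_eq_mul]
  have hII : Complex.I • χ ζ • Complex.I • (fderiv ℂ g ζ) 1 = -(χ ζ • (fderiv ℂ g ζ) 1) := by
    rw [smul_comm, smul_smul Complex.I, Complex.I_mul_I, neg_one_smul, smul_neg]
  rw [smul_add, hII]
  module

theorem continuous_dbar {F : ℂ → Y} (hF : ContDiff ℝ 1 F) : Continuous (dbar F) := by
  have h := hF.continuous_fderiv one_ne_zero
  exact (h.clm_apply continuous_const).add ((h.clm_apply continuous_const).const_smul _)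

theorem dbar_apply_eq_zero_of_notMem {F : ℂ → Y} {ζ : ℂ} (h : ζ ∉ tsupport F) : dbar F ζ = 0 :=
  dbar_eq_zero (notMem_tsupport_iff_eventuallyEq.1 h)

/-- Integration by parts against the constant function 1. -/
theorem integral_dbar_eq_zero {F : ℂ → Y} (hF : ContDiff ℝ 1 F) (hc : HasCompactSupport F) :
    ∫ ζ, dbar F ζ = 0 := by
  have h (v : ℂ) : Integrable (fun ζ => fderiv ℝ F ζ v) ∧ ∫ ζ, fderiv ℝ F ζ v = 0 := by
    have hi : Integrable fun ζ => fderiv ℝ F ζ v :=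
      ((hF.continuous_fderiv one_ne_zero).clm_apply continuous_const).integrable_of_hasCompactSupport
        (hc.fderiv_apply ℝ v)
    refine ⟨hi, ?_⟩
    have := integral_smul_fderiv_eq_neg_fderiv_smul_of_integrable (𝕜 := ℝ) (μ := volume)
      (f := fun _ : ℂ => (1 : ℝ)) (g := F) (v := v) (by simp) (by simpa using hi)
      (by simpa using hF.continuous.integrable_of_hasCompactSupport hc) (by simp)
      fun x _ => (hF.differentiable one_ne_zero).differentiableAt
    simpa using this
  unfold dbar
  rw [integral_add (h 1).1 ((h Complex.I).1.smul Complex.I :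
    Integrable fun ζ => Complex.I • fderiv ℝ F ζ Complex.I), integral_smul, (h 1).2, (h Complex.I).2]
  simp

theorem contDiff_cutoff_smul [CompleteSpace Y] (hG : IsOpen G) (hK : IsClosed K)
    (hs : tsupport χ ⊆ G) (h0 : ∀ ζ ∈ K, χ =ᶠ[𝓝 ζ] fun _ => 0) (hχ : ContDiff ℝ 1 χ)
    (hg : DifferentiableOn ℂ g (G \ K)) : ContDiff ℝ 1 fun z => χ z • g z := by
  rw [contDiff_iff_contDiffAt]
  intro ζ
  by_cases hζ : χ =ᶠ[𝓝 ζ] fun _ => 0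
  · refine (contDiffAt_const (c := (0 : Y))).congr_of_eventuallyEq ?_
    filter_upwards [hζ] with z hz
    rw [hz, zero_smul]
  · have hm : ζ ∈ G \ K := by
      refine ⟨hs ?_, fun h => hζ (h0 ζ h)⟩
      by_contra h
      exact hζ (notMem_tsupport_iff_eventuallyEq.1 h)
    have ha : AnalyticAt ℂ g ζ := hg.analyticAt ((hG.sdiff hK).mem_nhds hm)
    exact hχ.contDiffAt.smul (ha.contDiffAt.restrict_scalars ℝ)

/-- Near K and off the support of χ the cutoff is locally constant, so its ∂̄-derivative kills g
exactly where nothing is known about g. -/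
theorem IsCutoff.continuous_dbar_smul (hG : IsOpen G) (hK : IsClosed K) (hχ : IsCutoff K G χ)
    (hg : DifferentiableOn ℂ g (G \ K)) : Continuous fun ζ => dbar χ ζ • g ζ := by
  rw [continuous_iff_continuousAt]
  intro ζ
  by_cases hζ : ζ ∈ G \ K
  · exact (continuous_dbar hχ.contDiff).continuousAt.smul
      (hg.differentiableAt ((hG.sdiff hK).mem_nhds hζ)).continuousAt
  · refine (continuousAt_const (y := (0 : Y))).congr_of_eventuallyEq ?_
    have : ∃ a : ℂ, χ =ᶠ[𝓝 ζ] fun _ => a := by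
      by_cases hK' : ζ ∈ K
      · exact ⟨1, hχ.one ζ hK'⟩
      · refine ⟨0, notMem_tsupport_iff_eventuallyEq.1 fun h => hζ ⟨hχ.supp h, hK'⟩⟩
    obtain ⟨a, ha⟩ := this
    filter_upwards [ha.eventuallyEq_nhds] with z hz
    rw [dbar_eq_zero hz, zero_smul]

theorem IsCutoff.hasCompactSupport_dbar_smul (hχ : IsCutoff K G χ) :
    HasCompactSupport fun ζ => dbar χ ζ • g ζ :=
  hχ.compact.mono' fun ζ hζ => by
    by_contra h
    exact hζ (by simp [dbar_apply_eq_zero_of_notMem h])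

theorem IsCutoff.integrable_dbar_smul (hG : IsOpen G) (hK : IsClosed K) (hχ : IsCutoff K G χ)
    (hg : DifferentiableOn ℂ g (G \ K)) : Integrable fun ζ => dbar χ ζ • g ζ :=
  (hχ.continuous_dbar_smul hG hK hg).integrable_of_hasCompactSupport
    hχ.hasCompactSupport_dbar_smul

theorem dbar_sub {ζ : ℂ} (h₁ : DifferentiableAt ℝ χ₁ ζ) (h₂ : DifferentiableAt ℝ χ₂ ζ) :
    dbar (fun z => χ₁ z - χ₂ z) ζ = dbar χ₁ ζ - dbar χ₂ ζ := by
  rw [dbar, fderiv_fun_sub h₁ h₂, dbar, dbar]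
  simp only [sub_apply, smul_sub]
  abel

/-- The difference of two cutoffs vanishes near K, so its product with g is C¹ with compact support,
and the ∂̄-derivative of such a function has integral 0. -/
theorem IsCutoff.integral_dbar_smul_eq [CompleteSpace Y] (hG : IsOpen G) (hK : IsClosed K)
    (h₁ : IsCutoff K G χ₁) (h₂ : IsCutoff K G χ₂) (hg : DifferentiableOn ℂ g (G \ K)) :
    ∫ ζ, dbar χ₁ ζ • g ζ = ∫ ζ, dbar χ₂ ζ • g ζ := by
  have hd := h₁.contDiff.sub h₂.contDiff
  have h0 : ∀ ζ ∈ K, (fun z => χ₁ z - χ₂ z) =ᶠ[𝓝 ζ] fun _ => 0 := fun ζ hζ => by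
    filter_upwards [h₁.one ζ hζ, h₂.one ζ hζ] with z hz₁ hz₂
    rw [hz₁, hz₂, sub_self]
  have hs : tsupport (fun z => χ₁ z - χ₂ z) ⊆ G :=
    (tsupport_sub χ₁ χ₂).trans (union_subset h₁.supp h₂.supp)
  have hF := contDiff_cutoff_smul hG hK hs h0 hd hg
  have hc : HasCompactSupport fun z => (χ₁ z - χ₂ z) • g z :=
    (h₁.compact.sub h₂.compact).smul_right
  rw [← sub_eq_zero, ← integral_sub (h₁.integrable_dbar_smul hG hK hg)
    (h₂.integrable_dbar_smul hG hK hg), ← integral_dbar_eq_zero hF hc]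
  refine integral_congr_ae (Eventually.of_forall fun ζ => ?_)
  simp only
  have hd₁ : DifferentiableAt ℝ χ₁ ζ := (h₁.contDiff.differentiable one_ne_zero).differentiableAt
  have hd₂ : DifferentiableAt ℝ χ₂ ζ := (h₂.contDiff.differentiable one_ne_zero).differentiableAt
  by_cases hζ : (fun z => χ₁ z - χ₂ z) =ᶠ[𝓝 ζ] fun _ => 0
  · rw [← sub_smul, ← dbar_sub hd₁ hd₂, dbar_eq_zero hζ, zero_smul, dbar_eq_zero (a := 0)]
    filter_upwards [hζ] with z hz
    rw [hz, zero_smul]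
  · have hm : ζ ∈ G \ K := by
      refine ⟨hs ?_, fun h => hζ (h0 ζ h)⟩
      by_contra h
      exact hζ (notMem_tsupport_iff_eventuallyEq.1 h)
    rw [dbar_smul (χ := fun z => χ₁ z - χ₂ z) (hd₁.sub hd₂) (hg.differentiableAt ((hG.sdiff hK).mem_nhds hm)),
      ← sub_smul, ← dbar_sub hd₁ hd₂]

theorem exists_isCutoff (hG : IsOpen G) (hK : IsCompact K) (hKG : K ⊆ G) :
    ∃ χ, IsCutoff K G χ := by
  obtain ⟨L, hL, hKL, hLG⟩ := exists_compact_between hK hG hKG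
  obtain ⟨f, hf1, hf0, -⟩ := exists_contMDiffMap_one_nhds_of_subset_interior (n := 1)
    (modelWithCornersSelf ℝ ℂ) hK.isClosed hKL
  have hs : tsupport (fun z => ((f z : ℝ) : ℂ)) ⊆ L :=
    closure_minimal (fun z hz => by
      by_contra h
      exact hz (by simp [hf0 z h])) hL.isClosed
  refine ⟨fun z => (f z : ℂ), Complex.ofRealCLM.contDiff.comp f.contMDiff.contDiff,
    hL.of_isClosed_subset (isClosed_tsupport _) hs, hs.trans hLG, fun ζ hζ => ?_⟩
  filter_upwards [eventually_nhdsSet_iff_forall.1 hf1 ζ hζ] with z hz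
  rw [hz, Complex.ofReal_one]

end Dbar

/-! ### Area integrals with a radial cutoff compared with circle integrals -/

section Radial

variable {Y : Type*} [NormedAddCommGroup Y] [NormedSpace ℂ Y] {G : Set ℂ}
  {g : ℂ → Y} {c : ℂ} {ν r : ℝ}

/-- A smooth function on the line, equal to `1` for `s ≤ a` and to `0` for `s ≥ b`. -/
def lineCutoff (a b s : ℝ) : ℝ :=
  Real.smoothTransition ((b - s) / (b - a))

theorem contDiff_lineCutoff (a b : ℝ) : ContDiff ℝ 1 (lineCutoff a b) :=
  Real.smoothTransition.contDiff.comp ((contDiff_const.sub contDiff_id).div_const _)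

theorem lineCutoff_eq_one {a b s : ℝ} (hab : a < b) (hs : s ≤ a) : lineCutoff a b s = 1 :=
  Real.smoothTransition.one_of_one_le ((one_le_div (sub_pos.2 hab)).2 (by linarith))

theorem lineCutoff_eq_zero {a b s : ℝ} (hab : a < b) (hs : b ≤ s) : lineCutoff a b s = 0 :=
  Real.smoothTransition.zero_of_nonpos
    (div_nonpos_of_nonpos_of_nonneg (by linarith) (sub_pos.2 hab).le)

/-- A radial cutoff function around `c`. -/
def radialCutoff (c : ℂ) (a b : ℝ) (z : ℂ) : ℂ :=
  lineCutoff (a ^ 2) (b ^ 2) (‖z - c‖ ^ 2)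

variable {a b : ℝ}

theorem isCutoff_radialCutoff (hν : 0 ≤ ν) (ha : ν < a) (hab : a < b) (hb : b < r)
    (hG : Metric.closedBall c r ⊆ G) :
    IsCutoff (Metric.closedBall c ν) G (radialCutoff c a b) := by
  have hab' : a ^ 2 < b ^ 2 := pow_lt_pow_left₀ hab (hν.trans ha.le) two_ne_zero
  have hs : tsupport (radialCutoff c a b) ⊆ Metric.closedBall c b :=
    closure_minimal (fun z hz => by
      by_contra h
      rw [mem_closedBall_iff_norm, not_le] at h
      refine hz ?_
      rw [radialCutoff, lineCutoff_eq_zero hab' (pow_le_pow_left₀ (by linarith) h.le 2),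
        Complex.ofReal_zero]) Metric.isClosed_closedBall
  refine ⟨?_, ?_, ?_, fun ζ hζ => ?_⟩
  · exact Complex.ofRealCLM.contDiff.comp ((contDiff_lineCutoff _ _).comp
      ((contDiff_id.sub contDiff_const).norm_sq ℝ))
  · exact (isCompact_closedBall c b).of_isClosed_subset (isClosed_tsupport _) hs
  · exact hs.trans ((Metric.closedBall_subset_closedBall hb.le).trans hG)
  · filter_upwards [Metric.ball_mem_nhds ζ (sub_pos.2 ha)] with z hz
    have hz' : ‖z - c‖ ≤ a := by
      rw [← dist_eq_norm]
      have := dist_triangle z ζ c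
      have h1 : dist ζ c ≤ ν := hζ
      have h2 : dist z ζ < a - ν := hz
      linarith
    rw [radialCutoff, lineCutoff_eq_one hab' (pow_le_pow_left₀ (norm_nonneg _) hz' 2),
      Complex.ofReal_one]

theorem dbar_radialCutoff (z : ℂ) :
    dbar (radialCutoff c a b) z =
      ((deriv (lineCutoff (a ^ 2) (b ^ 2)) (‖z - c‖ ^ 2) : ℝ) : ℂ) * (2 * (z - c)) := by
  have hl : HasDerivAt (lineCutoff (a ^ 2) (b ^ 2)) _ (‖z - c‖ ^ 2) :=
    ((contDiff_lineCutoff (a ^ 2) (b ^ 2)).differentiable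
      one_ne_zero).differentiableAt.hasDerivAt
  have hn : HasFDerivAt (fun w : ℂ => ‖w - c‖ ^ 2) _ z :=
    ((hasFDerivAt_id z).sub_const c).norm_sq
  have h1 := hl.comp_hasFDerivAt z hn
  have h2 := Complex.ofRealCLM.hasFDerivAt.comp z h1
  have h : HasFDerivAt (radialCutoff c a b) _ z := h2
  rw [dbar, h.fderiv]
  simp [Complex.inner]
  apply Complex.ext <;> simp

/-- In polar coordinates the radius ρ contributes f'(ρ) times -i ∮ g = 2π y, where f(ρ) is the
radial profile of the cutoff; and ∫ f' = -f(0) = -1. -/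
theorem integral_radialCutoff [CompleteSpace Y] (hGo : IsOpen G) (hν : 0 ≤ ν) (ha : ν < a)
    (hab : a < b) (hb : b < r) (hG : Metric.closedBall c r ⊆ G)
    (hg : DifferentiableOn ℂ g (G \ Metric.closedBall c ν)) {y : Y}
    (hy : ∀ ρ, ν < ρ → ρ < r → (∮ z in C(c, ρ), g z) = (2 * Real.pi * Complex.I : ℂ) • y) :
    ∫ ζ, dbar (radialCutoff c a b) ζ • g ζ = -((2 * Real.pi : ℝ) • y) := by
  have ha0 : 0 < a := hν.trans_lt ha
  have hab' : a ^ 2 < b ^ 2 := pow_lt_pow_left₀ hab ha0.le two_ne_zero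
  have hcut := isCutoff_radialCutoff hν ha hab hb hG
  set D : ℂ → Y := fun ζ => dbar (radialCutoff c a b) ζ • g ζ with hD
  have hDc : Continuous D := hcut.continuous_dbar_smul hGo Metric.isClosed_closedBall hg
  set H : ℝ × ℝ → Y := fun p => p.1 • D (Complex.polarCoord.symm p + c) with hH
  have hHc : Continuous H := by
    simp only [hH, Complex.polarCoord_symm_apply]
    fun_prop
  set f : ℝ → ℝ := fun ρ => lineCutoff (a ^ 2) (b ^ 2) (ρ ^ 2) with hf
  have hfc : ContDiff ℝ 1 f := (contDiff_lineCutoff _ _).comp (contDiff_id.pow 2)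
  have hfz {ρ : ℝ} (h : b ≤ |ρ|) : f ρ = 0 := by
    refine lineCutoff_eq_zero hab' ?_
    rw [← sq_abs ρ]
    exact pow_le_pow_left₀ (by linarith) h 2
  have hfs : HasCompactSupport f := by
    refine HasCompactSupport.intro (isCompact_Icc (a := -b) (b := b)) fun ρ hρ => hfz ?_
    by_contra h
    exact hρ (abs_le.1 (not_le.1 h).le)
  have hfd (ρ : ℝ) : deriv f ρ = deriv (lineCutoff (a ^ 2) (b ^ 2)) (ρ ^ 2) * (2 * ρ) := by
    have h := (((contDiff_lineCutoff (a ^ 2) (b ^ 2)).differentiable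
      one_ne_zero).differentiableAt.hasDerivAt (x := ρ ^ 2)).comp ρ (hasDerivAt_pow 2 ρ)
    simpa using! h.deriv
  have hHeq {ρ : ℝ} (hρ : 0 < ρ) (θ : ℝ) :
      H (ρ, θ) = deriv f ρ • circleMap 0 ρ θ • g (circleMap c ρ θ) := by
    have e : Complex.polarCoord.symm (ρ, θ) = circleMap 0 ρ θ := by
      rw [Complex.polarCoord_symm_apply, circleMap, Complex.exp_mul_I, zero_add]
      simp
    have e' : circleMap 0 ρ θ + c = circleMap c ρ θ := by
      simp [circleMap, add_comm]
    have e'' : circleMap c ρ θ - c = circleMap 0 ρ θ := by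
      simp [circleMap]
    simp only [hH, hD, e, e', dbar_radialCutoff, e'', norm_circleMap_zero, hfd,
      abs_of_pos hρ, smul_smul, ← Complex.coe_smul]
    congr 1
    push_cast
    ring
  have hinner {ρ : ℝ} (hρ : 0 < ρ) : ∫ θ in Ioo (-Real.pi) Real.pi, H (ρ, θ) =
      deriv f ρ • (2 * Real.pi : ℝ) • y := by
    simp only [hHeq hρ]
    rw [integral_smul]
    by_cases h : ν < ρ ∧ ρ < r
    · congr 1
      have hp : Function.Periodic (fun θ => circleMap 0 ρ θ • g (circleMap c ρ θ))
          (2 * Real.pi) := fun θ => by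
        simp only [periodic_circleMap 0 ρ θ, periodic_circleMap c ρ θ]
      have h1 := hp.intervalIntegral_add_eq (-Real.pi) 0
      rw [show -Real.pi + 2 * Real.pi = Real.pi by ring, zero_add] at h1
      rw [← integral_Ioc_eq_integral_Ioo, ← intervalIntegral.integral_of_le
        (by linarith [Real.pi_pos]), h1]
      have h2 := hy ρ h.1 h.2
      rw [circleIntegral] at h2
      simp only [deriv_circleMap, mul_comm (circleMap 0 ρ _) Complex.I, mul_smul] at h2
      rw [intervalIntegral.integral_smul] at h2
      have h3 := congrArg (fun x => (-Complex.I) • x) h2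
      simp only [smul_smul, neg_mul, Complex.I_mul_I, neg_neg, one_smul] at h3
      rw [h3, ← Complex.coe_smul]
      congr 1
      push_cast
      linear_combination (-2 * (Real.pi : ℂ)) * Complex.I_mul_I
    -- For radii outside (ν, r) the circle integral is unknown, but there the profile is locally
    -- constant.
    · have h0 : deriv f ρ = 0 := by
        have : ∃ k : ℝ, f =ᶠ[𝓝 ρ] fun _ => k := by
          rcases not_and_or.1 h with h | h
          · refine ⟨1, ?_⟩
            filter_upwards [Ioo_mem_nhds (show -a < ρ by linarith)
              (show ρ < a by linarith)] with x hx
            exact lineCutoff_eq_one hab' (sq_le_sq' hx.1.le hx.2.le)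
          · refine ⟨0, ?_⟩
            filter_upwards [Ioi_mem_nhds (show b < ρ by linarith)] with x hx
            exact hfz (hx.out.le.trans (le_abs_self x))
        obtain ⟨k, hk⟩ := this
        rw [hk.deriv_eq, deriv_const]
      rw [h0, zero_smul, zero_smul]
  have hint : IntegrableOn H (Ioi 0 ×ˢ Ioo (-Real.pi) Real.pi) (volume.prod volume) := by
    have h1 : IntegrableOn H (Icc 0 b ×ˢ Icc (-Real.pi) Real.pi) (volume.prod volume) :=
      hHc.continuousOn.integrableOn_compact (isCompact_Icc.prod isCompact_Icc)
    refine h1.of_forall_sdiff_eq_zero (measurableSet_Ioi.prod measurableSet_Ioo) ?_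
    rintro ⟨ρ, θ⟩ ⟨⟨h2, h3⟩, h4⟩
    have hρ : (0 : ℝ) < ρ := h2
    have hb' : b < ρ := by
      by_contra h
      exact h4 ⟨⟨hρ.le, not_lt.1 h⟩, h3.1.le, h3.2.le⟩
    have h0 : deriv f ρ = 0 := by
      have hk : f =ᶠ[𝓝 ρ] fun _ => 0 := by
        filter_upwards [Ioi_mem_nhds hb'] with x hx
        exact hfz (hx.out.le.trans (le_abs_self x))
      rw [hk.deriv_eq, deriv_const]
    rw [hHeq hρ, h0, zero_smul]
  calc ∫ ζ, D ζ = ∫ ζ, D (ζ + c) := (integral_add_right_eq_self D c).symm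
    _ = ∫ p in Ioi 0 ×ˢ Ioo (-Real.pi) Real.pi, H p :=
      (Complex.integral_comp_polarCoord_symm fun ζ => D (ζ + c)).symm
    _ = ∫ ρ in Ioi (0 : ℝ), ∫ θ in Ioo (-Real.pi) Real.pi, H (ρ, θ) := setIntegral_prod H hint
    _ = ∫ ρ in Ioi (0 : ℝ), deriv f ρ • (2 * Real.pi : ℝ) • y :=
      setIntegral_congr_fun measurableSet_Ioi fun ρ hρ => hinner hρ
    _ = -((2 * Real.pi : ℝ) • y) := by
      rw [integral_smul_const, hfs.integral_Ioi_deriv_eq hfc 0, neg_smul, hf]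
      simp only
      rw [lineCutoff_eq_one hab' (by rw [zero_pow two_ne_zero]; positivity), one_smul]

theorem IsCutoff.integral_dbar_smul_eq_of_circleIntegral [CompleteSpace Y] (hGo : IsOpen G)
    (hν : 0 ≤ ν) (hr : ν < r) (hG : Metric.closedBall c r ⊆ G)
    (hg : DifferentiableOn ℂ g (G \ Metric.closedBall c ν)) {y : Y}
    (hy : ∀ ρ, ν < ρ → ρ < r → (∮ z in C(c, ρ), g z) = (2 * Real.pi * Complex.I : ℂ) • y)
    {χ : ℂ → ℂ} (hχ : IsCutoff (Metric.closedBall c ν) G χ) :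
    ∫ ζ, dbar χ ζ • g ζ = -((2 * Real.pi : ℝ) • y) := by
  obtain ⟨a, ha, har⟩ := exists_between hr
  obtain ⟨b, hab, hb⟩ := exists_between har
  rw [hχ.integral_dbar_smul_eq hGo Metric.isClosed_closedBall
    (isCutoff_radialCutoff hν ha hab hb hG) hg]
  exact integral_radialCutoff hGo hν ha hab hb hG hg hy

end Radial

/-! ### The operator calculus is well defined -/

section Calculus

variable {X : Type*} [NormedAddCommGroup X] [NormedSpace ℂ X] {A : X →ₗ.[ℂ] X} {G K K' : Set ℂ}
  {c : ℂ} {ν : ℝ} {x x' y y' : X} {R R' : ℕ → ℂ → X} {b : ℂ → ℂ}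

/-- `R 0` is holomorphic outside the compact set `K ⊆ G`, with values in `Exp_{A, G}(X)`, it tends
to `0` at infinity and `(ζ - A) (R 0 ζ) = x`; the functions `R n` are its derivatives. -/
structure CauchyRep (A : X →ₗ.[ℂ] X) (G : Set ℂ) (x : X) (K : Set ℂ) (R : ℕ → ℂ → X) : Prop where
  compact : IsCompact K
  subset : K ⊆ G
  deriv : ∀ n, ∀ ζ ∉ K, HasDerivAt (R n) (R (n + 1) ζ) ζ
  mem : ∀ n, ∀ ζ ∉ K, R n ζ ∈ expSubmodule A G
  zero : ∀ ζ ∉ K, (R 0 ζ, ζ • R 0 ζ - x) ∈ A.graph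
  succ : ∀ n, ∀ ζ ∉ K, (R (n + 1) ζ, ζ • R (n + 1) ζ + ((n : ℂ) + 1) • R n ζ) ∈ A.graph
  tendsto : Tendsto (R 0) (Bornology.cobounded ℂ) (𝓝 0)

theorem CauchyRep.add (h : CauchyRep A G x K R) (h' : CauchyRep A G x' K' R') :
    CauchyRep A G (x + x') (K ∪ K') fun n ζ => R n ζ + R' n ζ where
  compact := h.compact.union h'.compact
  subset := union_subset h.subset h'.subset
  deriv n ζ hζ := (h.deriv n ζ fun hK => hζ (Or.inl hK)).add (h'.deriv n ζ fun hK => hζ (Or.inr hK))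
  mem n ζ hζ := add_mem (h.mem n ζ fun hK => hζ (Or.inl hK)) (h'.mem n ζ fun hK => hζ (Or.inr hK))
  zero ζ hζ := by
    convert! add_mem (h.zero ζ fun hK => hζ (Or.inl hK)) (h'.zero ζ fun hK => hζ (Or.inr hK))
      using 1
    simp only [Prod.mk_add_mk, Prod.mk.injEq, true_and]
    module
  succ n ζ hζ := by
    convert! add_mem (h.succ n ζ fun hK => hζ (Or.inl hK)) (h'.succ n ζ fun hK => hζ (Or.inr hK))
      using 1
    simp only [Prod.mk_add_mk, Prod.mk.injEq, true_and]
    module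
  tendsto := by simpa using h.tendsto.add h'.tendsto

theorem CauchyRep.smul (a : ℂ) (h : CauchyRep A G x K R) :
    CauchyRep A G (a • x) K fun n ζ => a • R n ζ where
  compact := h.compact
  subset := h.subset
  deriv n ζ hζ := (h.deriv n ζ hζ).const_smul a
  mem n ζ hζ := Submodule.smul_mem _ a (h.mem n ζ hζ)
  zero ζ hζ := by
    convert! A.graph.smul_mem a (h.zero ζ hζ) using 1
    simp only [Prod.smul_mk, Prod.mk.injEq, true_and]
    module
  succ n ζ hζ := by
    convert! A.graph.smul_mem a (h.succ n ζ hζ) using 1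
    simp only [Prod.smul_mk, Prod.mk.injEq, true_and]
    module
  tendsto := by simpa using h.tendsto.const_smul a

/-- The value `y` of `b (A) x`, as an integral over a Cauchy representation of `x`. -/
def IsCalcValue (A : X →ₗ.[ℂ] X) (G : Set ℂ) (b : ℂ → ℂ) (x y : X) : Prop :=
  ∃ K R, CauchyRep A G x K R ∧ ∀ χ, IsCutoff K G χ →
    ∫ ζ, dbar χ ζ • b ζ • R 0 ζ = -((2 * Real.pi : ℝ) • y)

theorem CauchyRep.differentiableOn (hG : IsOpen G) (h : CauchyRep A G x K R)
    (hb : DifferentiableOn ℂ b G) : DifferentiableOn ℂ (fun ζ => b ζ • R 0 ζ) (G \ K) := fun ζ hζ =>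
  ((hb.differentiableAt (hG.mem_nhds hζ.1)).smul
    (h.deriv 0 ζ hζ.2).differentiableAt).differentiableWithinAt

theorem IsCalcValue.add (hG : IsOpen G) (hb : DifferentiableOn ℂ b G) (h : IsCalcValue A G b x y)
    (h' : IsCalcValue A G b x' y') : IsCalcValue A G b (x + x') (y + y') := by
  obtain ⟨K, R, hR, hy⟩ := h
  obtain ⟨K', R', hR', hy'⟩ := h'
  refine ⟨_, _, hR.add hR', fun χ hχ => ?_⟩
  have h1 := hχ.mono subset_union_left
  have h2 := hχ.mono subset_union_right
  simp only [smul_add]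
  rw [integral_add (h1.integrable_dbar_smul hG hR.compact.isClosed (hR.differentiableOn hG hb))
    (h2.integrable_dbar_smul hG hR'.compact.isClosed (hR'.differentiableOn hG hb)),
    hy χ h1, hy' χ h2, neg_add]

theorem IsCalcValue.smul (a : ℂ) (h : IsCalcValue A G b x y) :
    IsCalcValue A G b (a • x) (a • y) := by
  obtain ⟨K, R, hR, hy⟩ := h
  refine ⟨_, _, hR.smul a, fun χ hχ => ?_⟩
  simp only [smul_comm _ a]
  rw [integral_smul, hy χ hχ, smul_neg, smul_comm]

/-- R 0 ζ would be an eigenvector of A in Exp, so it is 0; then (ζ - A) R (n + 1) ζ = -(n + 1) R n ζ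
= 0 propagates this to all derivatives. -/
theorem CauchyRep.apply_eq_zero
    (hker : ∀ ζ ∉ G, ∀ v : A.domain, (v : X) ∈ expSubmodule A G → A v = ζ • (v : X) → v = 0)
    (h : CauchyRep A G 0 K R) {ζ : ℂ} (hζ : ζ ∉ G) (n : ℕ) : R n ζ = 0 := by
  have hζK : ζ ∉ K := fun hK => hζ (h.subset hK)
  have key {w : X} (hw : w ∈ expSubmodule A G) (hg : (w, ζ • w) ∈ A.graph) : w = 0 := by
    obtain ⟨v, hv, hAv⟩ := (LinearPMap.mem_graph_iff A).1 hg
    simp only at hv hAv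
    subst hv
    rw [hker ζ hζ v hw hAv]
    rfl
  induction n with
  | zero => exact key (h.mem 0 ζ hζK) (by simpa using h.zero ζ hζK)
  | succ n ih => exact key (h.mem (n + 1) ζ hζK) (by simpa [ih] using h.succ n ζ hζK)

/-- All Taylor coefficients at ζ vanish, so the function vanishes on a whole neighbourhood of ζ;
this lets the support be kept inside G. -/
theorem CauchyRep.eventually_eq_zero [CompleteSpace X]
    (hker : ∀ ζ ∉ G, ∀ v : A.domain, (v : X) ∈ expSubmodule A G → A v = ζ • (v : X) → v = 0)
    (h : CauchyRep A G 0 K R) {ζ : ℂ} (hζ : ζ ∉ G) : ∀ᶠ z in 𝓝 ζ, R 0 z = 0 := by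
  have hζK : ζ ∉ K := fun hK => hζ (h.subset hK)
  obtain ⟨r, hr, hrK⟩ := Metric.isOpen_iff.1 h.compact.isClosed.isOpen_compl ζ hζK
  have hd : DifferentiableOn ℂ (R 0) (Metric.ball ζ r) := fun z hz =>
    (h.deriv 0 z (hrK hz)).differentiableAt.differentiableWithinAt
  have hit (n : ℕ) : ∀ z ∉ K, iteratedDeriv n (R 0) z = R n z := by
    induction n with
    | zero => intro z _; rw [iteratedDeriv_zero]
    | succ n ih =>
      intro z hz
      have : iteratedDeriv n (R 0) =ᶠ[𝓝 z] R n :=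
        eventually_of_mem (h.compact.isClosed.isOpen_compl.mem_nhds hz) ih
      rw [iteratedDeriv_succ, this.deriv_eq, (h.deriv n z hz).deriv]
  filter_upwards [Metric.ball_mem_nhds ζ hr] with z hz
  have hs := Complex.hasSum_taylorSeries_on_ball hd hz
  simp only [hit _ ζ hζK, h.apply_eq_zero hker hζ, smul_zero] at hs
  exact hs.unique hasSum_zero

/-- In the coordinate w = 1/ζ the function extends analytically by 0 to w = 0. Were it not 0 near
there, its leading coefficient would contradict closedness of A. -/
theorem CauchyRep.eventually_cobounded (hA : A.IsClosed) [CompleteSpace X]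
    (h : CauchyRep A G 0 K R) : ∀ᶠ z in Bornology.cobounded ℂ, R 0 z = 0 := by
  set Q : ℂ → X := Function.update (fun w => R 0 w⁻¹) 0 0 with hQ
  have hQne {w : ℂ} (hw : w ≠ 0) : Q w = R 0 w⁻¹ := Function.update_of_ne hw _ _
  have hK : ∀ᶠ w in 𝓝[≠] (0 : ℂ), w⁻¹ ∉ K :=
    tendsto_inv₀_nhdsNE_zero.eventually (Bornology.isBounded_def.1 h.compact.isBounded)
  have hne : ∀ᶠ w in 𝓝[≠] (0 : ℂ), w ≠ 0 := eventually_mem_nhdsWithin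
  have hQc : ContinuousAt Q 0 :=
    continuousAt_update_same.2 (h.tendsto.comp tendsto_inv₀_nhdsNE_zero)
  have hQd : ∀ᶠ w in 𝓝[≠] (0 : ℂ), DifferentiableAt ℂ Q w := by
    filter_upwards [hK, hne] with w hw hw0
    have h1 : DifferentiableAt ℂ (fun w => R 0 w⁻¹) w :=
      DifferentiableAt.comp w (h.deriv 0 _ hw).differentiableAt (differentiableAt_inv hw0)
    exact h1.congr_of_eventuallyEq ((eventually_ne_nhds hw0).mono fun z hz => hQne hz)
  have hQa : AnalyticAt ℂ Q 0 :=
    Complex.analyticAt_of_differentiable_on_punctured_nhds_of_continuousAt hQd hQc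
  have hQg : ∀ᶠ w in 𝓝[≠] (0 : ℂ), (Q w, w⁻¹ • Q w) ∈ A.graph := by
    filter_upwards [hK, hne] with w hw hw0
    simpa [hQne hw0] using h.zero _ hw
  have hQ0 : ∀ᶠ w in 𝓝 (0 : ℂ), Q w = 0 := by
    by_contra hcon
    obtain ⟨n, P, hPa, hP0, hP⟩ := hQa.exists_eventuallyEq_pow_smul_nonzero_iff.2 hcon
    -- With Q = w^n P and P(0) ≠ 0, scaling (Q, w⁻¹ Q) by w·w^(-n) puts (w P, P) in the graph; in
    -- the limit (0, P(0)) lies in it.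
    have hPg : ∀ᶠ w in 𝓝[≠] (0 : ℂ), (w • P w, P w) ∈ A.graph := by
      filter_upwards [hQg, hne, hP.filter_mono nhdsWithin_le_nhds] with w hw hw0 hwP
      convert! A.graph.smul_mem (w * (w ^ n)⁻¹) hw using 1
      simp only [sub_zero] at hwP
      rw [hwP, Prod.smul_mk, Prod.mk.injEq]
      have hn : w ^ n ≠ 0 := pow_ne_zero n hw0
      constructor
      · rw [smul_smul, mul_assoc, inv_mul_cancel₀ hn, mul_one]
      · rw [smul_smul, smul_smul, show w * (w ^ n)⁻¹ * w⁻¹ * w ^ n = 1 by field_simp, one_smul]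
    have hlim : Tendsto (fun w => (w • P w, P w)) (𝓝[≠] (0 : ℂ)) (𝓝 ((0 : ℂ) • P 0, P 0)) :=
      (((continuousAt_id.smul hPa.continuousAt).prodMk hPa.continuousAt).tendsto).mono_left
        nhdsWithin_le_nhds
    have hmem : ((0 : ℂ) • P 0, P 0) ∈ A.graph :=
      IsClosed.mem_of_tendsto hA hlim hPg
    rw [zero_smul] at hmem
    exact hP0 (A.graph_fst_eq_zero_snd hmem rfl)
  filter_upwards [(tendsto_inv₀_cobounded (α := ℂ)).eventually hQ0,
    Bornology.isBounded_def.1 (Bornology.isBounded_singleton (x := (0 : ℂ)))] with z hz hz0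
  rwa [hQne (inv_ne_zero hz0), inv_inv] at hz

/-- A Cauchy representation of 0 vanishes off a compact subset L of G. Take a cutoff equal to 1 near
K ∪ L: its ∂̄-derivative vanishes on L and R vanishes off L, so the integral that gives y is 0. -/
theorem IsCalcValue.eq_zero (hA : A.IsClosed) [CompleteSpace X] (hG : IsOpen G)
    (hker : ∀ ζ ∉ G, ∀ v : A.domain, (v : X) ∈ expSubmodule A G → A v = ζ • (v : X) → v = 0)
    (h : IsCalcValue A G b 0 y) : y = 0 := by
  obtain ⟨K, R, hR, hy⟩ := h
  set L : Set ℂ := {ζ | R 0 =ᶠ[𝓝 ζ] 0}ᶜ with hL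
  have hLc : IsClosed L := isOpen_compl_iff.1 (by
    rw [hL, compl_compl]
    exact isOpen_setOfPred_eventually_nhds)
  have hLG : L ⊆ G := fun ζ hζ => by
    by_contra hζG
    exact hζ (hR.eventually_eq_zero hker hζG)
  have hLb : Bornology.IsBounded L := by
    have h0 := hR.eventually_cobounded hA
    obtain ⟨ρ, -, hρ⟩ := (Metric.hasBasis_cobounded_compl_closedBall (0 : ℂ)).eventually_iff.1 h0
    refine (Metric.isBounded_closedBall (x := (0 : ℂ)) (r := ρ)).subset fun ζ hζ => ?_
    by_contra hζρ
    exact hζ (eventually_of_mem (Metric.isClosed_closedBall.isOpen_compl.mem_nhds hζρ)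
      fun z hz => hρ hz)
  obtain ⟨χ, hχ⟩ := exists_isCutoff hG
    (hR.compact.union (Metric.isCompact_of_isClosed_isBounded hLc hLb))
    (union_subset hR.subset hLG)
  have h0 : ∫ ζ, dbar χ ζ • b ζ • R 0 ζ = 0 := by
    refine integral_eq_zero_of_ae (Eventually.of_forall fun ζ => ?_)
    by_cases hζ : ζ ∈ L
    · simp [dbar_eq_zero (hχ.one ζ (Or.inr hζ))]
    · have : R 0 =ᶠ[𝓝 ζ] 0 := not_not.1 hζ
      simp [this.self_of_nhds]
  have h1 := hy χ (hχ.mono subset_union_left)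
  rw [h0, eq_comm, neg_eq_zero, smul_eq_zero] at h1
  exact h1.resolve_left (by positivity)

variable [CompleteSpace X] [hA : Fact A.IsClosed]

/-- The operator `b (A)` on a space of orbits. -/
def orbitCalc (b : ℂ → ℂ) (c : ℂ) (ν : ℝ) : orbitSpace A c ν →L[ℂ] orbitSpace A c ν :=
  powerCalc b c (orbitShift A c ν)

theorem orbitOp_mul_resolvent {ζ : ℂ} (hν : 0 ≤ ν) (hζ : ζ ∉ Metric.closedBall c ν) :
    orbitOp A c ν * resolvent (orbitOp A c ν) ζ =
      ζ • resolvent (orbitOp A c ν) ζ - 1 := by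
  rw [mem_closedBall_iff_norm, not_le] at hζ
  have hu : IsUnit (algebraMap ℂ _ ζ - orbitOp A c ν) :=
    mem_resolventSet_add norm_one_orbitSpace_le ((norm_orbitShift_le hν).trans_lt hζ)
  have h := Ring.mul_inverse_cancel _ hu
  rw [sub_mul, Algebra.algebraMap_eq_smul_one, smul_mul_assoc, one_mul, sub_eq_iff_eq_add] at h
  rw [resolvent, Algebra.algebraMap_eq_smul_one, eq_sub_iff_add_eq', h]

/-- Evaluation of an operator on a space of orbits. -/
def orbitApply (x : orbitSpace A c ν) :
    (orbitSpace A c ν →L[ℂ] orbitSpace A c ν) →L[ℂ] X :=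
  (orbitEval A c ν 0).comp (ContinuousLinearMap.apply ℂ (orbitSpace A c ν) x)

theorem orbitApply_apply (x : orbitSpace A c ν)
    (T : orbitSpace A c ν →L[ℂ] orbitSpace A c ν) :
    orbitApply x T = orbitEval A c ν 0 (T x) :=
  rfl

theorem orbitApply_mem_graph (x : orbitSpace A c ν)
    (T : orbitSpace A c ν →L[ℂ] orbitSpace A c ν) :
    (orbitApply x T, orbitApply x (orbitOp A c ν * T)) ∈ A.graph :=
  orbitEval_orbitOp_mem (T x)

/-- The resolvent of the bounded operator A on the space of orbits exists off the closed disc of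
radius ν, and its powers, up to (-1)^n n!, are its derivatives. Its values remain heads of orbits,
hence stay in Exp. -/
theorem cauchyRep_orbit (h : Admissible G c ν) (hG : IsOpen G) (x : orbitSpace A c ν) :
    CauchyRep A G (orbitEval A c ν 0 x) (Metric.closedBall c ν) fun n ζ =>
      orbitApply x (((-1) ^ n * (n.factorial : ℂ)) • resolvent (orbitOp A c ν) ζ ^ (n + 1)) where
  compact := isCompact_closedBall c ν
  subset := by
    obtain ⟨r, hr, hrG⟩ := h.exists_closedBall_subset hG
    exact (Metric.closedBall_subset_closedBall hr.le).trans hrG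
  deriv n ζ hζ := by
    rw [mem_closedBall_iff_norm, not_le] at hζ
    have h1 := (hasDerivAt_resolvent_pow norm_one_orbitSpace_le
      ((norm_orbitShift_le (A := A) (c := c) h.2.1.le).trans_lt hζ) n).const_smul
      ((-1) ^ n * (n.factorial : ℂ))
    refine ((orbitApply x).hasFDerivAt.comp_hasDerivAt ζ h1).congr_deriv ?_
    rw [smul_smul, Nat.factorial_succ]
    congr 2
    push_cast
    ring
  mem n ζ _ := by
    rw [orbitApply_apply]
    exact orbitEval_mem_expSubmodule h _
  zero ζ hζ := by
    convert! orbitApply_mem_graph x (resolvent (orbitOp A c ν) ζ) using 1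
    rw [orbitOp_mul_resolvent h.2.1.le hζ]
    simp only [Nat.factorial_zero, Nat.cast_one, pow_zero, mul_one, one_smul, zero_add, pow_one,
      map_sub, map_smul]
    rfl
  succ n ζ hζ := by
    convert! orbitApply_mem_graph x (((-1) ^ (n + 1) * ((n + 1).factorial : ℂ)) •
      resolvent (orbitOp A c ν) ζ ^ (n + 1 + 1)) using 1
    rw [mul_smul_comm, pow_succ' _ (n + 1), ← mul_assoc, orbitOp_mul_resolvent h.2.1.le hζ, sub_mul,
      one_mul, Nat.factorial_succ, smul_mul_assoc, ← pow_succ']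
    rw [← map_smul, ← map_smul, ← map_add]
    congr 2
    push_cast
    module
  tendsto := by
    have h1 := ((orbitApply x).continuous.tendsto 0).comp
      (spectrum.resolvent_tendsto_cobounded (𝕜 := ℂ) (orbitOp A c ν))
    rw [map_zero] at h1
    simpa using! h1

theorem circleIntegral_orbitCalc {Y : Type*} [NormedAddCommGroup Y] [NormedSpace ℂ Y]
    [CompleteSpace Y] (l : (orbitSpace A c ν →L[ℂ] orbitSpace A c ν) →L[ℂ] Y) (hν : 0 ≤ ν) {ρ : ℝ}
    (hρ : ν < ρ) (hρG : Metric.closedBall c ρ ⊆ G) (hb : DifferentiableOn ℂ b G) :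
    (∮ z in C(c, ρ), b z • l (resolvent (orbitOp A c ν) z)) =
      (2 * Real.pi * Complex.I : ℂ) • l (orbitCalc b c ν) := by
  have hi : CircleIntegrable (fun z => b z • resolvent (orbitOp A c ν) z) c ρ :=
    (((hb.mono hρG).continuousOn.mono Metric.sphere_subset_closedBall).smul
      (continuousOn_resolvent norm_one_orbitSpace_le (norm_orbitShift_le hν)
        hρ)).circleIntegrable (hν.trans hρ.le)
  have h1 : (∮ z in C(c, ρ), b z • resolvent (orbitOp A c ν) z) =
      (2 * Real.pi * Complex.I : ℂ) • orbitCalc b c ν :=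
    circleIntegral_smul_resolvent norm_one_orbitSpace_le
      (norm_orbitShift_le (A := A) (c := c) hν) hρ hb hρG
  have h2 := congrArg l h1
  rw [circleIntegral, ← ContinuousLinearMap.intervalIntegral_comp_comm _ hi.out, map_smul] at h2
  rw [← h2, circleIntegral]
  simp only [map_smul]

theorem isCalcValue_orbit (h : Admissible G c ν) (hG : IsOpen G) (hb : DifferentiableOn ℂ b G)
    (x : orbitSpace A c ν) :
    IsCalcValue A G b (orbitEval A c ν 0 x) (orbitEval A c ν 0 (orbitCalc b c ν x)) := by
  obtain ⟨r, hr, hrG⟩ := h.exists_closedBall_subset hG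
  have hR := cauchyRep_orbit h hG x
  refine ⟨_, _, hR, fun χ hχ => ?_⟩
  refine hχ.integral_dbar_smul_eq_of_circleIntegral hG h.2.1.le hr hrG
    (hR.differentiableOn hG hb) fun ρ hρ hρr => ?_
  simp only [Nat.factorial_zero, Nat.cast_one, pow_zero, mul_one, one_smul, zero_add, pow_one]
  exact circleIntegral_orbitCalc (orbitApply x) h.2.1.le hρ
    ((Metric.closedBall_subset_closedBall hρr.le).trans hrG) hb

/-! ### From values on single vectors to the operator b(A) -/

section Operator

variable (hG : IsOpen G)
  (hker : ∀ ζ ∉ G, ∀ v : A.domain, (v : X) ∈ expSubmodule A G → A v = ζ • (v : X) → v = 0)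
  (hb : DifferentiableOn ℂ b G)

include hG hb in
theorem exists_isCalcValue (u : ExpSpace A G) :
    ∃ w : ExpSpace A G, IsCalcValue A G b (val A G u) (val A G w) := by
  refine expSpace_induction (p := fun u => ∃ w, IsCalcValue A G b (val A G u) (val A G w))
    (fun u v => ?_) ?_ (fun c ν h x => ?_) u
  · rintro ⟨w, hw⟩ ⟨w', hw'⟩
    exact ⟨w + w', by simpa only [map_add] using hw.add hG hb hw'⟩
  · refine ⟨0, ∅, fun _ _ => 0, ⟨isCompact_empty, empty_subset _, fun n ζ _ => ?_, fun n ζ _ => ?_,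
      fun ζ _ => ?_, fun n ζ _ => ?_, tendsto_const_nhds⟩, fun χ _ => ?_⟩
    · exact hasDerivAt_const ζ 0
    · exact zero_mem _
    · simp
    · simp
    · simp
  · exact ⟨toExp h (orbitCalc b c ν x), isCalcValue_orbit h hG hb x⟩

include hA hG hker hb in
-- Subtracting two Cauchy representations of the same vector represents 0, on possibly different
-- compact sets.
theorem IsCalcValue.unique (h : IsCalcValue A G b x y) (h' : IsCalcValue A G b x y') :
    y = y' := by
  have h1 := h.add hG hb (h'.smul (-1))
  rw [neg_one_smul, neg_one_smul, add_neg_cancel, ← sub_eq_add_neg] at h1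
  exact sub_eq_zero.1 (h1.eq_zero hA.out hG hker)

include hG hker hb in
-- Uniqueness of the values makes an arbitrary choice linear; on orbits it is the power series, and
-- the inductive limit topology gives continuity.
theorem exists_operator : ∃ T : ExpSpace A G →L[ℂ] ExpSpace A G,
    ∀ c ν, ∀ h : Admissible G c ν, ∀ x : orbitSpace A c ν,
      T (toExp h x) = toExp h (orbitCalc b c ν x) := by
  choose T hT using exists_isCalcValue (A := A) hG hb
  let L : ExpSpace A G →ₗ[ℂ] ExpSpace A G :=
    { toFun := T
      map_add' := fun u v => val_injective (by
        have := (hT u).add hG hb (hT v)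
        rw [← map_add, ← map_add] at this
        exact (hT (u + v)).unique hG hker hb this)
      map_smul' := fun a u => val_injective (by
        have := (hT u).smul a
        rw [← map_smul, ← map_smul] at this
        exact (hT (a • u)).unique hG hker hb this) }
  have hL (c ν) (h : Admissible G c ν) (x : orbitSpace A c ν) :
      L (toExp h x) = toExp h (orbitCalc b c ν x) :=
    val_injective ((hT (toExp h x)).unique hG hker hb (isCalcValue_orbit h hG hb x))
  refine ⟨⟨L, continuous_expSpace_of_orbits L fun c ν h => ?_⟩, hL⟩
  simp only [hL]
  exact (toExp h).continuous.comp (orbitCalc b c ν).continuous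

theorem hasSum_orbitCalc (h : Admissible G c ν) (hG : IsOpen G) (hb : DifferentiableOn ℂ b G)
    (x : orbitSpace A c ν) :
    HasSum (fun n => taylorCoeff b c n • (ν : ℂ) ^ n • orbitEval A c ν n x)
      (orbitEval A c ν 0 (orbitCalc b c ν x)) := by
  obtain ⟨r, hr, hrG⟩ := h.exists_closedBall_subset hG
  have h1 := (hasSum_powerCalc norm_one_orbitSpace_le (norm_orbitShift_le (A := A) (c := c) h.2.1.le) hr hb
    hrG).mapL (orbitApply x)
  simpa only [map_smul, orbitApply_apply, orbitEval_orbitShift_pow, zero_add, orbitCalc] using h1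

include hG hker hb in
theorem isFunCalc_funCalc : IsFunCalc A G b (funCalc A G b) := by
  have : ∃ T, IsFunCalc A G b T := by
    obtain ⟨T, hT⟩ := exists_operator (A := A) hG hker hb
    refine ⟨T, fun c ν C w h hw hC u hu => ?_⟩
    obtain ⟨x, hx, -⟩ := exists_orbit_of_isOrbit h.2.1 hw hC
    have hux : u = toExp h x := val_injective (by
      rw [hu, val_toExp, hx 0, pow_zero, one_smul])
    rw [hux, hT, val_toExp]
    simp only [hx]
    exact hasSum_orbitCalc h hG hb x
  rw [funCalc, dif_pos this]
  exact this.choose_spec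

include hG hker hb in
theorem funCalc_toExp (h : Admissible G c ν) (x : orbitSpace A c ν) :
    funCalc A G b (toExp h x) = toExp h (orbitCalc b c ν x) := by
  refine val_injective ((isFunCalc_funCalc hG hker hb c ν ‖x‖ _ h (isOrbit_orbitEval x)
    (fun k => ?_) (toExp h x) (by simp [val_toExp])).unique (hasSum_orbitCalc h hG hb x))
  rw [norm_smul, norm_pow, Complex.norm_real, Real.norm_of_nonneg h.2.1.le, mul_comm]
  exact mul_le_mul_of_nonneg_right (norm_orbitEval_le x k) (pow_nonneg h.2.1.le k)

end Operator

end Calculus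

/-! ### Fractional derivatives and primitives of scalar functions -/

section Scalar

theorem eq_of_hasDerivAt_eq {x y d : ℝ → ℂ} (hx : ContinuousOn x (Ici 0))
    (hy : ContinuousOn y (Ici 0)) (hxd : ∀ t > 0, HasDerivAt x (d t) t)
    (hyd : ∀ t > 0, HasDerivAt y (d t) t) (h0 : x 0 = y 0) {t : ℝ} (ht : 0 ≤ t) : x t = y t := by
  have h := intervalIntegral.integral_eq_sub_of_hasDerivAt_of_le (f := fun s => x s - y s)
    (f' := fun _ => 0) ht ((hx.sub hy).mono Icc_subset_Ici_self)
    (fun s hs => by simpa using! (hxd s hs.1).sub (hyd s hs.1)) (by simp)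
  simpa [h0, sub_eq_zero, eq_comm] using h

/-- The function `y` on `t > 0`, extended by `0`. -/
def posPart (y : ℝ → ℂ) (t : ℝ) : ℂ :=
  (Ioi (0 : ℝ)).indicator y t

theorem posPart_of_pos (y : ℝ → ℂ) {t : ℝ} (ht : 0 < t) : posPart y t = y t :=
  indicator_of_mem (mem_Ioi.2 ht) y

theorem mild_of_bound {V : Type*} [NormedAddCommGroup V] {y : ℝ → V} (h0 : ∀ t ≤ 0, y t = 0)
    (hc : ContinuousOn y (Ioi 0)) (hb : ∀ T, ∃ C, ∀ t ∈ Ioc 0 T, ‖y t‖ ≤ C) : Mild y :=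
  ⟨h0, hc, 1, one_pos, fun T => (hb T).imp fun C hC t ht => by simpa using hC t ht⟩

theorem mild_indicator {V : Type*} [NormedAddCommGroup V] {y : ℝ → V}
    (hy : ContinuousOn y (Ici 0)) : Mild ((Ioi (0 : ℝ)).indicator y) := by
  refine mild_of_bound (fun t ht => indicator_of_notMem (by simpa using ht) y) ?_ fun T => ?_
  · exact (hy.mono Ioi_subset_Ici_self).congr fun t ht => indicator_of_mem ht y
  · obtain ⟨C, hC⟩ := (isCompact_Icc (a := 0) (b := T)).exists_bound_of_continuousOn
      (hy.mono Icc_subset_Ici_self)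
    exact ⟨C, fun t ht => by
      rw [indicator_of_mem (mem_Ioi.2 ht.1)]
      exact hC t ⟨ht.1.le, ht.2⟩⟩

theorem mild_posPart {y : ℝ → ℂ} (hy : ContinuousOn y (Ici 0)) : Mild (posPart y) :=
  mild_indicator hy

/-- In the norm with weight e^(-σt) the fractional integral J^γ has norm at most σ^(-γ), the Laplace
transform of its kernel at σ. -/
theorem norm_fint_le {γ σ M t : ℝ} (hγ : 0 ≤ γ) (hσ : 0 < σ) (ht : 0 < t)
    {x : ℝ → ℂ} (hx : Mild x) (hb : ∀ s ∈ Ioc 0 t, ‖x s‖ ≤ M * Real.exp (σ * s)) :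
    ‖fint γ x t‖ ≤ M * σ ^ (-γ) * Real.exp (σ * t) := by
  have hM : 0 ≤ M := nonneg_of_mul_nonneg_left ((norm_nonneg _).trans (hb t ⟨ht, le_rfl⟩))
    (Real.exp_pos _)
  rcases hγ.eq_or_lt with rfl | hγ
  · rw [fint_zero]
    simpa using hb t ⟨ht, le_rfl⟩
  rw [fint_of_pos hγ, pk_cv_apply hx γ ht.le]
  have hG := Real.Gamma_pos_of_pos hγ
  set K : ℝ → ℝ := fun s =>
    M * Real.exp (σ * t) * (Real.Gamma γ)⁻¹ * expPow γ σ (t - s) with hK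
  have hKi : Integrable K := ((integrable_expPow hγ hσ).comp_sub_left t).const_mul _
  refine (intervalIntegral.norm_integral_le_of_norm_le ht.le (g := K) ?_
    hKi.intervalIntegrable).trans ?_
  · have hne : ∀ᵐ s : ℝ, s ≠ t := Measure.ae_ne volume t
    filter_upwards [hne] with s hst hs
    have hts : 0 < t - s := sub_pos.2 (lt_of_le_of_ne hs.2 hst)
    rw [norm_smul, Real.norm_of_nonneg (powKer_nonneg hγ _), powKer_of_pos hts, hK]
    simp only
    rw [expPow_of_pos hts]
    refine (mul_le_mul_of_nonneg_left (hb s hs) (by positivity)).trans_eq ?_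
    rw [show σ * s = σ * t + -(σ * (t - s)) by ring, Real.exp_add]
    field_simp
  · rw [intervalIntegral.integral_of_le ht.le]
    have hK0 : 0 ≤ K := fun s => mul_nonneg (by positivity) (expPow_nonneg _ _ _)
    refine (setIntegral_le_integral hKi (Eventually.of_forall hK0)).trans_eq ?_
    rw [hK, integral_const_mul, integral_sub_left_eq_self (expPow γ σ) volume t,
      integral_expPow hγ hσ, one_div, Real.inv_rpow hσ.le, Real.rpow_neg hσ.le]
    field_simp

theorem continuousWithinAt_fint {γ : ℝ} (hγ : 0 < γ) {x : ℝ → ℂ} (hx : Mild x)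
    (hb : ∃ C, ∀ s ∈ Ioc (0 : ℝ) 1, ‖x s‖ ≤ C) : ContinuousWithinAt (fint γ x) (Ici 0) 0 := by
  obtain ⟨C, hC⟩ := hb
  have hM := hx.fint hγ.le
  have h0 : fint γ x 0 = 0 := hM.zero 0 le_rfl
  rw [Metric.continuousWithinAt_iff]
  intro ε hε
  have hC0 : 0 ≤ C := (norm_nonneg _).trans (hC 1 ⟨one_pos, le_rfl⟩)
  -- choose the weight so large that the bound at `t ≤ 1 / σ` is small
  have hlim : Tendsto (fun σ : ℝ => C * σ ^ (-γ) * Real.exp 1) atTop (𝓝 (C * 0 * Real.exp 1)) :=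
    ((tendsto_rpow_neg_atTop hγ).const_mul C).mul_const _
  simp only [mul_zero, zero_mul] at hlim
  obtain ⟨σ, hσ, hσ1⟩ := ((hlim.eventually (gt_mem_nhds hε)).and (eventually_ge_atTop 1)).exists
  have hσ0 : 0 < σ := by linarith
  refine ⟨σ⁻¹, by positivity, fun t ht htd => ?_⟩
  rw [h0, dist_zero_right]
  rw [Real.dist_eq, sub_zero] at htd
  rcases (mem_Ici.1 ht).eq_or_lt with rfl | ht
  · rwa [h0, norm_zero]
  rw [abs_of_pos ht] at htd
  have ht1 : t ≤ 1 := htd.le.trans (inv_le_one_of_one_le₀ hσ1)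
  refine (norm_fint_le hγ.le hσ0 ht hx (M := C) fun s hs => ?_).trans_lt (lt_of_le_of_lt ?_ hσ)
  · refine (hC s ⟨hs.1, hs.2.trans ht1⟩).trans (le_mul_of_one_le_right hC0 (Real.one_le_exp ?_))
    have := hs.1
    positivity
  · refine mul_le_mul_of_nonneg_left (Real.exp_le_exp.2 ?_) (by positivity)
    have h1 := mul_le_mul_of_nonneg_left htd.le hσ0.le
    rwa [mul_inv_cancel₀ hσ0.ne'] at h1

theorem fint_congr_pos {γ : ℝ} {x y : ℝ → ℂ} (hx : Mild x) (hy : Mild y)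
    (h : ∀ t > 0, x t = y t) : fint γ x = fint γ y := by
  have : x = y := funext fun t => by
    rcases le_or_gt t 0 with ht | ht
    · rw [hx.zero t ht, hy.zero t ht]
    · exact h t ht
  rw [this]

theorem eq_of_fint_one_eq {x y : ℝ → ℂ} (hx : Mild x) (hy : Mild y)
    (h : ∀ t > 0, fint 1 x t = fint 1 y t) {t : ℝ} (ht : 0 < t) : x t = y t := by
  have h1 := hasDerivAt_fint hx le_rfl ht
  have h2 := hasDerivAt_fint hy le_rfl ht
  simp only [zero_add, fint_zero] at h1 h2
  refine h1.unique (h2.congr_of_eventuallyEq ?_)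
  filter_upwards [lt_mem_nhds ht] with s hs using h s hs

theorem continuousOn_fint {γ : ℝ} (hγ : 0 < γ) {x : ℝ → ℂ} (hx : ContinuousOn x (Ici 0)) :
    ContinuousOn (fint γ (posPart x)) (Ici 0) := by
  have hm := mild_posPart hx
  intro t ht
  rcases (mem_Ici.1 ht).eq_or_lt with rfl | ht
  · refine continuousWithinAt_fint hγ hm ?_
    obtain ⟨C, hC⟩ := (isCompact_Icc (a := 0) (b := 1)).exists_bound_of_continuousOn
      (hx.mono Icc_subset_Ici_self)
    exact ⟨C, fun s hs => by
      rw [posPart_of_pos x hs.1]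
      exact hC s ⟨hs.1.le, hs.2⟩⟩
  · exact ((hm.fint hγ.le).cont.continuousAt (Ioi_mem_nhds ht)).continuousWithinAt

/-- A continuous function is recovered from its Riemann--Liouville derivative of order `β < 1`. -/
theorem eq_fint_of_hasDerivAt {β : ℝ} (hβ : 0 ≤ β) (hβ1 : β < 1) {h g : ℝ → ℂ}
    (hh : ContinuousOn h (Ici 0)) (hg : ContinuousOn g (Ici 0))
    (hd : ∀ t > 0, HasDerivAt (fracIntegral (1 - β) h) (g t) t) {t : ℝ} (ht : 0 < t) :
    h t = fint β (posPart g) t := by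
  have hβ' : 0 < 1 - β := by linarith
  have mh := mild_posPart hh
  have mg := mild_posPart hg
  have e1 (s : ℝ) (hs : 0 ≤ s) : fracIntegral (1 - β) h s = fint (1 - β) (posPart h) s :=
    fracIntegral_eq hβ' mh hs fun r hr => (posPart_of_pos h hr.1).symm
  -- J^(1-β) h and J^1 g have the same derivative on t > 0 and both vanish continuously at 0.
  -- Applying J^β gives J^1 h = J^1 J^β g, and J^1 is injective.
  have key (s : ℝ) (hs : 0 ≤ s) : fint (1 - β) (posPart h) s = fint 1 (posPart g) s := by
    refine eq_of_hasDerivAt_eq (d := g) (continuousOn_fint hβ' hh)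
      (continuousOn_fint one_pos hg) (fun r hr => ?_) (fun r hr => ?_) ?_ hs
    · refine (hd r hr).congr_of_eventuallyEq ?_
      filter_upwards [lt_mem_nhds hr] with a ha using (e1 a ha.le).symm
    · have := hasDerivAt_fint mg le_rfl hr
      rwa [zero_add, fint_zero, posPart_of_pos g hr] at this
    · rw [(mh.fint hβ'.le).zero 0 le_rfl, (mg.fint zero_le_one).zero 0 le_rfl]
  rw [← posPart_of_pos h ht]
  refine eq_of_fint_one_eq mh (mg.fint hβ) (fun s _ => ?_) ht
  rw [fint_fint mg zero_le_one hβ, add_comm, ← fint_fint mg hβ zero_le_one,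
    ← fint_congr_pos (mh.fint hβ'.le) (mg.fint zero_le_one) fun r hr => key r hr.le,
    fint_fint mh hβ hβ'.le, add_sub_cancel]

/-- The factor (T - s)^(1-β) is continuous and cancels the weight. Thus the mere existence of the
fractional integral makes a derivative, possibly unbounded near 0, integrable. -/
theorem intervalIntegrable_of_weighted {β T : ℝ} (hβ1 : β ≤ 1) (hT : 0 ≤ T) {e : ℝ → ℂ}
    (hi : IntervalIntegrable (fun s => ((T - s) ^ (β - 1) : ℝ) • e s) volume 0 T) :
    IntervalIntegrable e volume 0 T := by
  have hc : Continuous fun s : ℝ => (T - s) ^ (1 - β) :=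
    (continuous_const.sub continuous_id).rpow_const fun _ => Or.inr (by linarith)
  refine (hi.continuousOn_smul hc.continuousOn).congr_ae ?_
  rw [uIoc_of_le hT]
  filter_upwards [ae_restrict_mem measurableSet_Ioc,
    (Measure.ae_ne volume T).filter_mono (ae_mono Measure.restrict_le_self)] with s hs hsT
  have hts : 0 < T - s := sub_pos.2 (lt_of_le_of_ne hs.2 hsT)
  rw [smul_smul, ← Real.rpow_add hts, show 1 - β + (β - 1) = 0 by ring, Real.rpow_zero, one_smul]

/-- The primitive of the fractional integral of an integrable function. -/
theorem integral_fracIntegral {β T : ℝ} (hβ : 0 < β) (hT : 0 ≤ T) {e : ℝ → ℂ}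
    (he : IntervalIntegrable e volume 0 T) :
    ∫ s in (0 : ℝ)..T, fracIntegral β e s = ∫ r in (0 : ℝ)..T, powKer (β + 1) (T - r) • e r := by
  have hm := mild_powKer hβ
  set E : ℝ → ℂ := (Ioc 0 T).indicator e with hE
  have hEi : Integrable E := by
    rw [intervalIntegrable_iff, uIoc_of_le hT] at he
    exact he.integrable_indicator measurableSet_Ioc
  set P : ℝ → ℝ := (Ioc 0 T).indicator (powKer β) with hP
  have hPi : Integrable P := by
    have := hm.intervalIntegrable 0 T
    rw [intervalIntegrable_iff, uIoc_of_le hT] at this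
    exact this.integrable_indicator measurableSet_Ioc
  -- Cut off to (0, T], both functions are integrable on the line, so the Fubini hypothesis is that
  -- of an ordinary convolution.
  have hprod : Integrable (fun p : ℝ × ℝ => P (p.1 - p.2) • E p.2) (volume.prod volume) :=
    hEi.convolution_integrand (ContinuousLinearMap.lsmul ℝ ℝ).flip hPi
  have hleft (s : ℝ) (hs : s ∈ Ioc 0 T) : fracIntegral β e s = ∫ r, P (s - r) • E r := by
    rw [fracIntegral, ← intervalIntegral.integral_smul, intervalIntegral.integral_of_le hs.1.le,
      integral_Ioc_eq_integral_Ioo, ← integral_indicator measurableSet_Ioo]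
    refine integral_congr_ae (Eventually.of_forall fun r => ?_)
    simp only
    by_cases hr : r ∈ Ioo 0 s
    · rw [indicator_of_mem hr, hP, hE, indicator_of_mem (show s - r ∈ Ioc 0 T from
        ⟨sub_pos.2 hr.2, by linarith [hr.1, hs.2]⟩), indicator_of_mem (show r ∈ Ioc 0 T from
        ⟨hr.1, hr.2.le.trans hs.2⟩), powKer_of_pos (sub_pos.2 hr.2), smul_smul, one_div,
        inv_mul_eq_div]
    · rw [indicator_of_notMem hr]
      by_cases h0 : 0 < r
      · rw [hP, indicator_of_notMem (fun h => hr ⟨h0, sub_pos.1 h.1⟩), zero_smul]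
      · rw [hE, indicator_of_notMem (fun h => h0 h.1), smul_zero]
  have hinner (r : ℝ) (hr : r ∈ Ioc 0 T) :
      ∫ s in Ioc 0 T, P (s - r) = powKer (β + 1) (T - r) := by
    have h1 : ∫ s in Ioc 0 T, P (s - r) = ∫ s in (0 : ℝ)..T, powKer β (s - r) := by
      rw [intervalIntegral.integral_of_le hT]
      refine setIntegral_congr_fun measurableSet_Ioc fun s hs => ?_
      simp only [hP]
      by_cases h : s - r ∈ Ioc 0 T
      · rw [indicator_of_mem h]
      · rw [indicator_of_notMem h, powKer_of_nonpos]
        by_contra h0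
        exact h ⟨not_le.1 h0, by linarith [hs.2, hr.1]⟩
    have h2 : ∫ s in (0 : ℝ)..0 - r, powKer β s = 0 := by
      rw [← pk_one_cv (𝓐 := ℝ) hm, ((mild_pk (𝓐 := ℝ) one_pos).cv hm).zero _ (by linarith [hr.1])]
    rw [h1, intervalIntegral.integral_comp_sub_right (powKer β) r,
      ← intervalIntegral.integral_interval_sub_left (a := 0) (hm.intervalIntegrable _ _)
        (hm.intervalIntegrable _ _), h2, sub_zero, ← pk_one_cv (𝓐 := ℝ) hm]
    have h3 := congrFun (cv_pk (𝓐 := ℝ) one_pos hβ) (T - r)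
    rw [add_comm 1 β] at h3
    exact h3
  calc ∫ s in (0 : ℝ)..T, fracIntegral β e s = ∫ s in Ioc 0 T, ∫ r, P (s - r) • E r := by
        rw [intervalIntegral.integral_of_le hT]
        exact setIntegral_congr_fun measurableSet_Ioc hleft
    _ = ∫ r, ∫ s in Ioc 0 T, P (s - r) • E r := by
        refine integral_integral_swap ?_
        have := hprod.restrict (s := Ioc 0 T ×ˢ univ)
        rwa [← Measure.prod_restrict, Measure.restrict_univ] at this
    _ = ∫ r in Ioc 0 T, powKer (β + 1) (T - r) • e r := by
        rw [← integral_indicator measurableSet_Ioc]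
        refine integral_congr_ae (Eventually.of_forall fun r => ?_)
        simp only
        rw [integral_smul_const]
        by_cases hr : r ∈ Ioc 0 T
        · rw [indicator_of_mem hr, hinner r hr, hE, indicator_of_mem hr]
        · rw [indicator_of_notMem hr, hE, indicator_of_notMem hr, smul_zero]
    _ = _ := (intervalIntegral.integral_of_le hT).symm

/-- Integration by parts in the fractional integral of a derivative. -/
theorem integral_powKer_smul_deriv {β T : ℝ} (hβ : 0 < β) (hT : 0 < T) {D e : ℝ → ℂ}
    (hD : ContinuousOn D (Ici 0)) (hD0 : D 0 = 0) (hDe : ∀ t > 0, HasDerivAt D (e t) t)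
    (he : IntervalIntegrable e volume 0 T) :
    ∫ r in (0 : ℝ)..T, powKer (β + 1) (T - r) • e r = fint β (posPart D) T := by
  have hm := mild_posPart hD
  set u : ℝ → ℝ := fun r => (T - r) ^ β / Real.Gamma (β + 1) with hu
  have huc : Continuous u :=
    ((continuous_const.sub continuous_id).rpow_const fun _ => Or.inr hβ.le).div_const _
  have hupos {r : ℝ} (hr : r < T) : powKer (β + 1) (T - r) = u r := by
    rw [powKer_of_pos (sub_pos.2 hr), add_sub_cancel_right]
  have hud : ∀ r ∈ Ioo (min 0 T) (max 0 T), HasDerivAt u (-powKer β (T - r)) r := by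
    intro r hr
    rw [min_eq_left hT.le, max_eq_right hT.le] at hr
    have h1 := (hasDerivAt_powKer hβ (sub_pos.2 hr.2)).comp r
      ((hasDerivAt_const r T).sub (hasDerivAt_id r))
    simp only [zero_sub, mul_neg, mul_one] at h1
    refine h1.congr_of_eventuallyEq ?_
    filter_upwards [gt_mem_nhds hr.2] with s hs using (hupos hs).symm
  have hpi : IntervalIntegrable (fun r => -powKer β (T - r)) volume 0 T := by
    have := ((mild_powKer hβ).intervalIntegrable T 0).comp_sub_left T
    simpa using! this.neg
  have h := intervalIntegral.integral_smul_deriv_eq_deriv_smul_of_hasDerivAt (a := 0) (b := T)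
    huc.continuousOn (by rw [uIcc_of_le hT.le]; exact hD.mono Icc_subset_Ici_self) hud
    (fun r hr => hDe r (by rw [min_eq_left hT.le] at hr; exact hr.1)) hpi he
  have huT : u T = 0 := by
    rw [hu]
    simp [Real.zero_rpow hβ.ne']
  rw [huT, zero_smul, hD0, smul_zero, sub_zero, zero_sub] at h
  rw [fint_of_pos hβ, pk_cv_apply hm β hT.le]
  rw [intervalIntegral.integral_of_le hT.le, integral_Ioc_eq_integral_Ioo,
    setIntegral_congr_fun measurableSet_Ioo fun r hr => by rw [hupos hr.2],
    ← integral_Ioc_eq_integral_Ioo, ← intervalIntegral.integral_of_le hT.le, h,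
    ← intervalIntegral.integral_neg]
  simp only [neg_smul, neg_neg]
  rw [intervalIntegral.integral_of_le hT.le, intervalIntegral.integral_of_le hT.le]
  exact setIntegral_congr_fun measurableSet_Ioc fun r hr => by
    simp only [posPart_of_pos D hr.1]

/-- If the fractional integral of order `β < 1` of `D'` is `W`, then `D = J ^ (1 - β) W`. -/
theorem eq_fint_of_fracIntegral_deriv {β : ℝ} (hβ : 0 ≤ β) (hβ1 : β < 1) {D e W : ℝ → ℂ}
    (hD : ContinuousOn D (Ici 0)) (hD0 : D 0 = 0) (hDe : ∀ t > 0, HasDerivAt D (e t) t)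
    (hW : Mild W) (h0 : β = 0 → ∀ t > 0, e t = W t)
    (hpos : 0 < β → ∀ t > 0,
      IntervalIntegrable (fun s => ((t - s) ^ (β - 1) : ℝ) • e s) volume 0 t ∧
        fracIntegral β e t = W t) {t : ℝ} (ht : 0 < t) :
    D t = fint (1 - β) W t := by
  have hm := mild_posPart hD
  have hβ' : 0 < 1 - β := by linarith
  -- Integrating J^β D' = W once and then by parts, with D(0) = 0, gives J^β D = J^1 W; applying
  -- J^(1-β) and cancelling J^1 finishes.
  have key (s : ℝ) (hs : 0 < s) : fint β (posPart D) s = fint 1 W s := by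
    rcases hβ.eq_or_lt with rfl | hβp
    · rw [fint_zero, posPart_of_pos D hs]
      refine eq_of_hasDerivAt_eq (d := e) hD ?_ hDe (fun r hr => ?_) ?_ hs.le
      · have := (continuous_fint hW 0).continuousOn (s := Ici 0)
        simpa using this
      · have := hasDerivAt_fint hW le_rfl hr
        rwa [zero_add, fint_zero, ← h0 rfl r hr] at this
      · rw [hD0, (hW.fint zero_le_one).zero 0 le_rfl]
    · have hi := intervalIntegrable_of_weighted hβ1.le hs.le (hpos hβp s hs).1
      rw [← integral_powKer_smul_deriv hβp hs hD hD0 hDe hi, ← integral_fracIntegral hβp hs.le hi,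
        fint_of_pos one_pos, pk_one_cv hW, intervalIntegral.integral_of_le hs.le,
        intervalIntegral.integral_of_le hs.le]
      exact setIntegral_congr_fun measurableSet_Ioc fun r hr => (hpos hβp r hr.1).2
  rw [← posPart_of_pos D ht]
  refine eq_of_fint_one_eq hm (hW.fint hβ'.le) (fun s _ => ?_) ht
  rw [fint_fint hW zero_le_one hβ'.le, add_comm, ← fint_fint hW hβ'.le zero_le_one,
    ← fint_congr_pos (hm.fint hβ) (hW.fint zero_le_one) key,
    fint_fint hm hβ'.le hβ, sub_add_cancel]

end Scalar

/-! ### Families of functionals -/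

section Functionals

variable {E : Type*} [NormedAddCommGroup E] [NormedSpace ℂ E] [CompleteSpace E]

theorem exists_norm_le_of_continuousOn {L : ℝ → E →L[ℂ] ℂ} {K : Set ℝ} (hK : IsCompact K)
    (h : ∀ x, ContinuousOn (fun t => L t x) K) : ∃ C ≥ 0, ∀ t ∈ K, ‖L t‖ ≤ C := by
  obtain ⟨C, hC⟩ := banach_steinhaus (g := fun t : K => L t) fun x =>
    (hK.exists_bound_of_continuousOn (h x)).imp fun C hC t => hC t t.2
  exact ⟨max C 0, le_max_right _ _, fun t ht => (hC ⟨t, ht⟩).trans (le_max_left _ _)⟩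

/-- Pointwise continuity in t gives norm bounds on compact time intervals by Banach–Steinhaus, hence
joint continuity. -/
theorem continuous_apply_of_continuous {L : ℝ → E →L[ℂ] ℂ} (h : ∀ x, Continuous fun t => L t x) :
    Continuous fun p : ℝ × E => L p.1 p.2 := by
  rw [continuous_iff_continuousAt]
  rintro ⟨t, x⟩
  obtain ⟨C, -, hC⟩ := exists_norm_le_of_continuousOn (isCompact_Icc (a := t - 1) (b := t + 1))
    fun x => (h x).continuousOn
  have hb : ∀ᶠ p : ℝ × E in 𝓝 (t, x), ‖L p.1 (p.2 - x)‖ ≤ C * ‖p.2 - x‖ := by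
    have : ∀ᶠ s in 𝓝 t, s ∈ Icc (t - 1) (t + 1) := Icc_mem_nhds (by linarith) (by linarith)
    filter_upwards [continuous_fst.continuousAt.eventually this] with p hp
    exact (L p.1).le_of_opNorm_le (hC _ hp) _
  have h0 : Tendsto (fun p : ℝ × E => C * ‖p.2 - x‖) (𝓝 (t, x)) (𝓝 0) := by
    have : Continuous fun p : ℝ × E => C * ‖p.2 - x‖ := by fun_prop
    simpa using this.tendsto (t, x)
  have h1 := squeeze_zero_norm' hb h0
  have h2 : Tendsto (fun p : ℝ × E => L p.1 x) (𝓝 (t, x)) (𝓝 (L t x)) :=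
    ((h x).comp continuous_fst).tendsto (t, x)
  simpa [ContinuousAt] using h1.add h2

end Functionals

section OrbitFunctionals

variable {X : Type*} [NormedAddCommGroup X] [NormedSpace ℂ X] [CompleteSpace X] {A : X →ₗ.[ℂ] X}
  [hA : Fact A.IsClosed] {G : Set ℂ} {c : ℂ} {ν r : ℝ} {b b₁ b₂ : ℂ → ℂ}

/-- A pointwise limit of functionals is continuous on each Banach space of orbits by
Banach–Steinhaus, hence on the inductive limit. Applied to difference quotients, it keeps
derivatives in Exp'. -/
theorem exists_expDual_of_tendsto {ι : Type*} {l : Filter ι} [l.IsCountablyGenerated] [l.NeBot]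
    {T : ι → ExpDual A G} {f : ExpSpace A G → ℂ}
    (h : ∀ v, Tendsto (fun i => T i v) l (𝓝 (f v))) : ∃ S : ExpDual A G, ∀ v, S v = f v := by
  let F : ExpSpace A G →ₗ[ℂ] ℂ :=
    { toFun := f
      map_add' := fun u v => tendsto_nhds_unique (h (u + v)) (by
        simpa only [map_add] using (h u).add (h v))
      map_smul' := fun a v => tendsto_nhds_unique (h (a • v)) (by
        simpa only [map_smul, RingHom.id_apply] using (h v).const_smul a) }
  refine ⟨StrongDual.toWeakDual ⟨F, continuous_of_orbits F fun c ν hc => ?_⟩, fun v => rfl⟩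
  exact (continuousLinearMapOfTendsto (l := l)
    (fun i => (WeakDual.toStrongDual (T i)).comp (toExp hc)) (f := fun x => f (toExp hc x))
    (tendsto_pi_nhds.2 fun x => h (toExp hc x))).continuous

theorem exists_expDual_of_hasDerivAt {T : ℝ → ExpDual A G} {f : ExpSpace A G → ℂ} {t : ℝ}
    (h : ∀ v, HasDerivAt (fun s => T s v) (f v) t) : ∃ S : ExpDual A G, ∀ v, S v = f v := by
  refine exists_expDual_of_tendsto (l := 𝓝[≠] t)
    (T := fun s => ((s - t)⁻¹ : ℂ) • (T s - T t)) fun v => ?_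
  have := hasDerivAt_iff_tendsto_slope.1 (h v)
  refine this.congr fun s => ?_
  rw [slope_def_module, Complex.real_smul]
  push_cast
  rfl

/-! ### Properties of the operator calculus -/

theorem orbitCalc_mul (h : Admissible G c ν) (hG : IsOpen G) (hb₁ : DifferentiableOn ℂ b₁ G)
    (hb₂ : DifferentiableOn ℂ b₂ G) (x : orbitSpace A c ν) :
    orbitCalc (fun z => b₁ z * b₂ z) c ν x = orbitCalc b₁ c ν (orbitCalc b₂ c ν x) := by
  obtain ⟨r, hr, hrG⟩ := h.exists_closedBall_subset hG
  have := powerCalc_mul norm_one_orbitSpace_le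
    (norm_orbitShift_le (A := A) (c := c) h.2.1.le) hr hb₁ hb₂ hrG
  exact congrArg (fun T : orbitSpace A c ν →L[ℂ] orbitSpace A c ν => T x) this

theorem orbitCalc_one (x : orbitSpace A c ν) : orbitCalc (fun _ => 1) c ν x = x := by
  rw [orbitCalc, powerCalc, tsum_eq_single 0 fun n hn => by
    rw [taylorCoeff, iteratedDeriv_const, if_neg hn, zero_div, zero_smul]]
  simp [taylorCoeff]

theorem orbitCalc_id (x : orbitSpace A c ν) : orbitCalc id c ν x = orbitOp A c ν x := by
  rw [orbitCalc, powerCalc, tsum_eq_sum (s := Finset.range 2) fun n hn => by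
    have hn : 2 ≤ n := not_lt.1 fun h => hn (Finset.mem_range.2 h)
    rw [taylorCoeff, iteratedDeriv_id, if_neg (by omega), if_neg (by omega), zero_div, zero_smul]]
  simp [taylorCoeff, Finset.sum_range_succ, orbitOp_apply, iteratedDeriv_id]

section Calculus

variable (hG : IsOpen G)
  (hker : ∀ ζ ∉ G, ∀ v : A.domain, (v : X) ∈ expSubmodule A G → A v = ζ • (v : X) → v = 0)

include hG hker in
theorem weakExt_id_restrictDual {x y : X →L[ℂ] ℂ} (hxy : ∀ v : A.domain, y v = x (A v)) :
    weakExt A G id (restrictDual A G x) = restrictDual A G y := by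
  refine DFunLike.ext _ _ fun v => ?_
  change x (val A G (funCalc A G id v)) = y (val A G v)
  refine expSpace_induction (p := fun v => x (val A G (funCalc A G id v)) = y (val A G v))
    (fun u v hu hv => by simp only [map_add, hu, hv]) (by simp only [map_zero])
    (fun c ν h z => ?_) v
  rw [funCalc_toExp hG hker differentiableOn_id h, val_toExp, val_toExp, orbitCalc_id]
  obtain ⟨v, hv, hAv⟩ := (LinearPMap.mem_graph_iff A).1 (orbitEval_orbitOp_mem z)
  simp only at hv hAv
  rw [← hAv, ← hv, hxy]

end Calculus

theorem injective_restrictDual (hd : Dense (expSubmodule A G : Set X)) :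
    Function.Injective (restrictDual A G) := by
  intro x y hxy
  refine DFunLike.coe_injective (Continuous.ext_on hd x.continuous y.continuous fun v hv => ?_)
  exact DFunLike.congr_fun hxy (⟨v, hv⟩ : expSubmodule A G)

/-! ### The Cauchy integral as a functional on the continuous functions on a circle -/

theorem continuous_circle_integrand (hr : 0 ≤ r) (b : C(Metric.sphere c r, ℂ)) :
    Continuous fun θ => deriv (circleMap c r) θ * b ⟨circleMap c r θ, circleMap_mem_sphere c hr θ⟩ := by
  refine Continuous.mul ?_ (b.continuous.comp
    ((continuous_circleMap c r).subtype_mk fun θ => circleMap_mem_sphere c hr θ))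
  rw [show deriv (circleMap c r) = fun θ => circleMap 0 r θ * Complex.I from
    funext fun θ => deriv_circleMap c r θ]
  exact (continuous_circleMap 0 r).mul continuous_const

/-- The functional `b ↦ (2 π i)⁻¹ ∮ b(z) dz`. -/
def sphereInt (hr : 0 ≤ r) : C(Metric.sphere c r, ℂ) →L[ℝ] ℂ :=
  LinearMap.mkContinuous
    { toFun := fun b => (2 * Real.pi * Complex.I)⁻¹ * ∫ θ in (0 : ℝ)..2 * Real.pi,
        deriv (circleMap c r) θ * b ⟨circleMap c r θ, circleMap_mem_sphere c hr θ⟩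
      map_add' := fun a b => by
        rw [← mul_add, ← intervalIntegral.integral_add
          ((continuous_circle_integrand hr a).intervalIntegrable _ _)
          ((continuous_circle_integrand hr b).intervalIntegrable _ _)]
        simp only [ContinuousMap.add_apply, mul_add]
      map_smul' := fun a b => by
        simp only [ContinuousMap.smul_apply, mul_smul_comm, intervalIntegral.integral_smul,
          RingHom.id_apply] }
    (‖(2 * Real.pi * Complex.I : ℂ)⁻¹‖ * (r * |2 * Real.pi - 0|)) fun b => by
      change ‖(2 * Real.pi * Complex.I)⁻¹ * _‖ ≤ _
      rw [norm_mul, mul_assoc _ (r * _), mul_right_comm r]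
      refine mul_le_mul_of_nonneg_left ?_ (norm_nonneg _)
      refine intervalIntegral.norm_integral_le_of_norm_le_const fun θ _ => ?_
      rw [norm_mul, deriv_circleMap, norm_mul, norm_circleMap_zero, Complex.norm_I, mul_one,
        abs_of_nonneg hr]
      exact mul_le_mul_of_nonneg_left (b.norm_coe_le_norm _) hr

theorem sphereInt_eq (hr : 0 ≤ r) {b : C(Metric.sphere c r, ℂ)} {f : ℂ → ℂ}
    (hb : ∀ z : Metric.sphere c r, b z = f z) :
    sphereInt hr b = (2 * Real.pi * Complex.I)⁻¹ * ∮ z in C(c, r), f z := by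
  change (2 * Real.pi * Complex.I)⁻¹ * _ = _
  simp only [hb]
  rfl

/-- The symbol `z ↦ l (z - A)⁻¹ x` on a circle. -/
def resSymb (hν : 0 ≤ ν) (hr : ν < r) (l : orbitSpace A c ν →L[ℂ] ℂ) (x : orbitSpace A c ν) :
    C(Metric.sphere c r, ℂ) where
  toFun z := l (resolvent (orbitOp A c ν) (z : ℂ) x)
  continuous_toFun := (l.comp (ContinuousLinearMap.apply ℂ (orbitSpace A c ν) x)).continuous.comp
    (continuousOn_resolvent norm_one_orbitSpace_le
      (norm_orbitShift_le (A := A) (c := c) hν) hr).domRestrict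

/-- The bridge to the algebra of functions on a circle: b ↦ l (b(A) x) is multiplication by one
fixed symbol followed by one fixed functional. -/
theorem sphereInt_mul_resSymb (hν : 0 ≤ ν) (hr : ν < r) (hrG : Metric.closedBall c r ⊆ G)
    (hb : DifferentiableOn ℂ b G) {B : C(Metric.sphere c r, ℂ)}
    (hB : ∀ z : Metric.sphere c r, B z = b z)
    (l : orbitSpace A c ν →L[ℂ] ℂ) (x : orbitSpace A c ν) :
    sphereInt (hν.trans hr.le) (B * resSymb hν hr l x) = l (orbitCalc b c ν x) := by
  rw [sphereInt_eq (hν.trans hr.le) (f := fun z => b z • l (resolvent (orbitOp A c ν) z x))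
    fun z => by rw [ContinuousMap.mul_apply, hB]; rfl]
  have h := circleIntegral_orbitCalc (A := A)
    (l.comp (ContinuousLinearMap.apply ℂ (orbitSpace A c ν) x)) hν hr hrG hb
  simp only [ContinuousLinearMap.comp_apply, ContinuousLinearMap.apply_apply] at h
  rw [h, smul_eq_mul, inv_mul_cancel_left₀ Complex.two_pi_I_ne_zero]

/-- Although t ↦ L t is only weakly continuous, the symbols vary continuously in the supremum norm,
since a circle is compact and the evaluation is jointly continuous. -/
theorem continuous_resSymb (hν : 0 ≤ ν) (hr : ν < r) {L : ℝ → orbitSpace A c ν →L[ℂ] ℂ}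
    (hL : ∀ x, Continuous fun t => L t x) (x : orbitSpace A c ν) :
    Continuous fun t => resSymb hν hr (L t) x := by
  have h1 : Continuous fun z : Metric.sphere c r => resolvent (orbitOp A c ν) (z : ℂ) x :=
    (ContinuousLinearMap.apply ℂ (orbitSpace A c ν) x).continuous.comp
      (continuousOn_resolvent norm_one_orbitSpace_le
        (norm_orbitShift_le (A := A) (c := c) hν) hr).domRestrict
  have h2 : Continuous fun p : ℝ × Metric.sphere c r =>
      L p.1 (resolvent (orbitOp A c ν) (p.2 : ℂ) x) :=
    (continuous_apply_of_continuous hL).comp (continuous_fst.prodMk (h1.comp continuous_snd))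
  exact (ContinuousMap.curry ⟨_, h2⟩).continuous

end OrbitFunctionals

/-! ### Functions with a Taylor representation -/

section Taylor

variable {m : ℕ}

/-- `y` has on `t ≥ 0` the Taylor representation with initial values `φ` and `m`-th
derivative `w`. -/
structure IsTaylor (y : ℝ → ℂ) (φ : Fin m → ℂ) (w : ℝ → ℂ) : Prop where
  mild : Mild w
  eq : ∀ t ≥ 0, y t = solTaylor φ w 0 t

variable {y y' : ℝ → ℂ} {φ φ' : Fin m → ℂ} {w w' : ℝ → ℂ}

theorem solTaylor_add (hw : Mild w) (hw' : Mild w') {n : ℕ} (hn : n ≤ m) (t : ℝ) :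
    solTaylor (fun k => φ k + φ' k) (fun s => w s + w' s) n t =
      solTaylor φ w n t + solTaylor φ' w' n t := by
  have hn' : (0 : ℝ) ≤ m - n := sub_nonneg.2 (by exact_mod_cast hn)
  unfold solTaylor
  rw [fint_add hw hw' hn', add_add_add_comm, ← Finset.sum_add_distrib]
  congr 1
  refine Finset.sum_congr rfl fun k _ => ?_
  split_ifs
  · rw [mul_add]
  · rw [add_zero]

theorem solCaputo_add (hw : Mild w) (hw' : Mild w') {α : ℝ} (hα : α ≤ m) (t : ℝ) :
    solCaputo (fun k => φ k + φ' k) (fun s => w s + w' s) α t =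
      solCaputo φ w α t + solCaputo φ' w' α t := by
  unfold solCaputo
  rw [fint_add hw hw' (sub_nonneg.2 hα), add_add_add_comm, ← Finset.sum_add_distrib]
  congr 1
  refine Finset.sum_congr rfl fun k _ => ?_
  split_ifs
  · rw [mul_add]
  · rw [add_zero]

theorem IsTaylor.add (h : IsTaylor y φ w) (h' : IsTaylor y' φ' w') :
    IsTaylor (fun t => y t + y' t) (fun k => φ k + φ' k) fun t => w t + w' t where
  mild := h.mild.add h'.mild
  eq t ht := by rw [h.eq t ht, h'.eq t ht, solTaylor_add h.mild h'.mild (Nat.zero_le m)]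

theorem IsTaylor.eq_solCaputo (h : IsTaylor y φ w) (t : ℝ) (ht : 0 < t) :
    y t = solCaputo φ w 0 t := by
  rw [h.eq t ht.le, solTaylor_eq_solCaputo φ w 0 ht, Nat.cast_zero]

theorem IsTaylor.caputo_eq (h : IsTaylor y φ w) {α : ℝ} (hα : α ≤ m) {t : ℝ} (ht : 0 < t) :
    caputo α y t = solCaputo φ w α t :=
  caputo_eq_solCaputo φ h.mild h.eq_solCaputo hα ht

theorem IsTaylor.caputo_add (h : IsTaylor y φ w) (h' : IsTaylor y' φ' w') {α : ℝ} (hα : α ≤ m)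
    {t : ℝ} (ht : 0 < t) : caputo α (fun t => y t + y' t) t = caputo α y t + caputo α y' t := by
  rw [(h.add h').caputo_eq hα ht, h.caputo_eq hα ht, h'.caputo_eq hα ht,
    solCaputo_add h.mild h'.mild hα]

theorem IsTaylor.iteratedDeriv_eq (h : IsTaylor y φ w) {n : ℕ} (hn : n ≤ m) {t : ℝ} (ht : 0 < t) :
    iteratedDeriv n y t = solCaputo φ w n t :=
  iteratedDeriv_eq_solCaputo φ h.mild h.eq_solCaputo hn ht

theorem hasDerivAt_solTaylor (hw : Mild w) {n : ℕ} (hn : n < m) {t : ℝ} (ht : 0 < t) :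
    HasDerivAt (solTaylor φ w n) (solTaylor φ w (n + 1) t) t := by
  rw [solTaylor_eq_solCaputo φ w _ ht]
  refine (hasDerivAt_solCaputo φ hw hn ht).congr_of_eventuallyEq ?_
  filter_upwards [lt_mem_nhds ht] with s hs using solTaylor_eq_solCaputo φ w n hs

theorem solTaylor_self (φ : Fin m → ℂ) (w : ℝ → ℂ) (t : ℝ) : solTaylor φ w m t = w t := by
  unfold solTaylor
  rw [sub_self, fint_zero, Finset.sum_eq_zero fun k _ => if_neg (not_le.2 k.2), zero_add]

variable {𝓐 : Type*} [NormedCommRing 𝓐] [NormedAlgebra ℝ 𝓐] [CompleteSpace 𝓐]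

theorem map_pk_mul (L : 𝓐 →L[ℝ] ℂ) (γ t : ℝ) (a : 𝓐) : L (pk 𝓐 γ t * a) = pk ℂ γ t * L a := by
  rw [pk_mul, pk_mul, map_smul]

theorem map_solCaputo (L : 𝓐 →L[ℝ] ℂ) (φ : Fin m → 𝓐) {w : ℝ → 𝓐} (hw : Mild w) {α : ℝ}
    (hα : α ≤ m) (t : ℝ) :
    L (solCaputo φ w α t) = solCaputo (fun k => L (φ k)) (fun s => L (w s)) α t := by
  unfold solCaputo
  rw [map_add, map_sum, map_fint L hw (sub_nonneg.2 hα)]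
  congr 1
  refine Finset.sum_congr rfl fun k _ => ?_
  split_ifs
  · exact map_pk_mul L _ _ _
  · exact map_zero L

theorem map_taylor (L : 𝓐 →L[ℝ] ℂ) (φ : Fin m → 𝓐) {w : ℝ → 𝓐} (hw : Mild w) (t : ℝ) :
    L ((∑ k : Fin m, algebraMap ℝ 𝓐 (t ^ (k : ℕ) / (k : ℕ).factorial) * φ k) + fint m w t) =
      solTaylor (fun k => L (φ k)) (fun s => L (w s)) 0 t := by
  unfold solTaylor
  rw [map_add, map_sum, map_fint L hw (Nat.cast_nonneg m), Nat.cast_zero, sub_zero]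
  congr 1
  refine Finset.sum_congr rfl fun k _ => ?_
  rw [if_pos (Nat.zero_le _), Nat.sub_zero, Algebra.algebraMap_eq_smul_one, smul_one_mul, map_smul,
    Algebra.algebraMap_eq_smul_one, smul_one_mul]

theorem exists_continuous_solFun {lam : Measure ℝ} [IsFiniteMeasure lam] {F : ℝ → 𝓐} {μ : ℝ}
    {q : ℝ → 𝓐} (hF : Continuous F) (hm : 1 ≤ m) (hμ : μ ∈ Ioc ((m : ℝ) - 1) m)
    (hq : IsResKer lam F (m - 1) μ q) {k : ℕ} (hk : k < m) :
    ∃ s : ℝ → 𝓐, Continuous s ∧ ∀ t ≥ 0, solFun lam F m μ q k t = s t := by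
  refine ⟨_, ?_, fun t ht => solFun_eq hF hm hμ hq hk ht⟩
  obtain ⟨n, rfl⟩ : ∃ n, m = n + 1 := ⟨m - 1, by omega⟩
  refine Continuous.sub ((algebraMapCLM ℝ 𝓐).continuous.comp (by fun_prop)) ?_
  have := continuous_pk_nat_cv (mild_initRes (lam := lam) hF hμ hq.mild k) n
  exact_mod_cast this

end Taylor

/-! ### The solution formula -/

section SolutionFormula

variable {X : Type*} [NormedAddCommGroup X] [NormedSpace ℂ X] [CompleteSpace X] {A : X →ₗ.[ℂ] X}
  [hA : Fact A.IsClosed] {G : Set ℂ} {c : ℂ} {ν r : ℝ} {b : ℂ → ℂ}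
  {m : ℕ} {μ : ℝ} {lam : Measure ℝ} [IsFiniteMeasure lam] {f : ℝ → ℂ → ℂ}

/-- A functional on `Exp_{A, G}(X)` as a functional on a space of orbits. -/
def dualOrbit (h : Admissible G c ν) (T : ExpDual A G) : orbitSpace A c ν →L[ℂ] ℂ :=
  (WeakDual.toStrongDual T).comp (toExp h)

theorem dualOrbit_apply (h : Admissible G c ν) (T : ExpDual A G) (x : orbitSpace A c ν) :
    dualOrbit h T x = T (toExp h x) :=
  rfl

/-- The right hand side of the solution formula. -/
def solVal (A : X →ₗ.[ℂ] X) (G : Set ℂ) (m : ℕ) (μ : ℝ) (lam : Measure ℝ) (f : ℝ → ℂ → ℂ)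
    (φ : Fin m → ExpDual A G) (g : ℝ → ExpDual A G) (t : ℝ) (v : ExpSpace A G) : ℂ :=
  ∑ k : Fin m, weakExt A G (solSymbol m μ lam f k t) (φ k) v +
    ∫ τ in (0 : ℝ)..t, weakExt A G (solSymbol m μ lam f (m - 1) (t - τ)) (g τ) v

section Solution

variable (hG : IsOpen G)
  (hker : ∀ ζ ∉ G, ∀ v : A.domain, (v : X) ∈ expSubmodule A G → A v = ζ • (v : X) → v = 0)
  (hm : 1 ≤ m) (hμ : μ ∈ Ioc ((m : ℝ) - 1) m)
  (hf : ContinuousOn (fun p : ℝ × ℂ => f p.1 p.2) (Icc (0 : ℝ) (m - 1) ×ˢ G))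
  (hf_an : ∀ α ∈ Icc (0 : ℝ) (m - 1), DifferentiableOn ℂ (f α) G)

variable (lam) in
include hm hμ hf in
theorem exists_sphere_family (hK : Metric.sphere c r ⊆ G) :
    ∃ (F : ℝ → C(Metric.sphere c r, ℂ)) (q : ℝ → C(Metric.sphere c r, ℂ)), Continuous F ∧
      IsResKer lam F (m - 1) μ q ∧ ∀ α ∈ Icc (0 : ℝ) (m - 1), ∀ z, F α z = f α z := by
  have hM : (0 : ℝ) ≤ m - 1 := sub_nonneg.2 (by exact_mod_cast hm)
  have : CompactSpace (Metric.sphere c r) := isCompact_iff_compactSpace.1 (isCompact_sphere c r)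
  obtain ⟨F, hF⟩ := exists_continuous_family hM hf hK
  obtain ⟨q, hq⟩ := exists_isResKer (lam := lam) F.continuous hM hμ.1 (by linarith [hμ.2])
  exact ⟨F, q, F.continuous, hq, fun α hα z => by rw [hF, projIcc_of_mem hM hα]⟩

include hG hker in
theorem weakExt_funCalc_toExp (h : Admissible G c ν) (hr : ν < r)
    (hrG : Metric.closedBall c r ⊆ G) {b₁ : ℂ → ℂ} (hb₁ : DifferentiableOn ℂ b₁ G)
    (hb : DifferentiableOn ℂ b G) {B₁ B : C(Metric.sphere c r, ℂ)}
    (hB₁ : ∀ z : Metric.sphere c r, B₁ z = b₁ z) (hB : ∀ z : Metric.sphere c r, B z = b z)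
    (T : ExpDual A G) (x : orbitSpace A c ν) :
    weakExt A G b₁ T (funCalc A G b (toExp h x)) =
      (sphereInt (h.2.1.le.trans hr.le)).comp (ContinuousLinearMap.mul ℝ _ B)
        (B₁ * resSymb h.2.1.le hr (dualOrbit h T) x) := by
  change T (funCalc A G b₁ (funCalc A G b (toExp h x))) = _
  rw [funCalc_toExp hG hker hb, funCalc_toExp hG hker hb₁, ← orbitCalc_mul h hG hb₁ hb,
    ← dualOrbit_apply, ← sphereInt_mul_resSymb h.2.1.le hr hrG (b := fun z => b₁ z * b z) (hb₁.mul hb)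
      (B := B₁ * B)
      (fun z => by rw [ContinuousMap.mul_apply, hB₁, hB])]
  rw [ContinuousLinearMap.comp_apply, ContinuousLinearMap.mul_apply', mul_comm B₁ B, mul_assoc]

include hG hker in
theorem apply_funCalc_toExp (h : Admissible G c ν) (hr : ν < r)
    (hrG : Metric.closedBall c r ⊆ G) (hb : DifferentiableOn ℂ b G) {B : C(Metric.sphere c r, ℂ)}
    (hB : ∀ z : Metric.sphere c r, B z = b z) (T : ExpDual A G) (x : orbitSpace A c ν) :
    T (funCalc A G b (toExp h x)) =
      (sphereInt (h.2.1.le.trans hr.le)).comp (ContinuousLinearMap.mul ℝ _ B)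
        (resSymb h.2.1.le hr (dualOrbit h T) x) := by
  rw [funCalc_toExp hG hker hb, ← dualOrbit_apply,
    ← sphereInt_mul_resSymb h.2.1.le hr hrG hb hB]
  rfl

include hG hker in
theorem funCalc_one_toExp (h : Admissible G c ν) (x : orbitSpace A c ν) :
    funCalc A G (fun _ => 1) (toExp h x) = toExp h x := by
  rw [funCalc_toExp hG hker (differentiableOn_const 1), orbitCalc_one]

variable {φ : Fin m → ExpDual A G} {g : ℝ → ExpDual A G} (hg : ContinuousOn g (Ici 0))

/-- The symbol of a source term, on a circle. -/
def sourceSymb (h : Admissible G c ν) (hr : ν < r) (g : ℝ → ExpDual A G) (x : orbitSpace A c ν)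
    (t : ℝ) : C(Metric.sphere c r, ℂ) :=
  resSymb h.2.1.le hr (dualOrbit h (g (max t 0))) x

include hg in
-- The clamp `max t 0` freezes g at g(0) for negative times, where nothing is assumed about it.
theorem continuous_sourceSymb (h : Admissible G c ν) (hr : ν < r) (x : orbitSpace A c ν) :
    Continuous (sourceSymb h hr g x) := by
  refine continuous_resSymb h.2.1.le hr (fun y => ?_) x
  exact (WeakDual.eval_continuous (toExp h y)).comp
    (hg.comp_continuous (continuous_id.max continuous_const) fun t => mem_Ici.2 (le_max_right _ _))

/-- The `m`-th derivative of the solution, on a circle. -/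
def solSymb (h : Admissible G c ν) (hr : ν < r) (m : ℕ) (μ : ℝ) (lam : Measure ℝ)
    (F q : ℝ → C(Metric.sphere c r, ℂ)) (φ : Fin m → ExpDual A G) (g : ℝ → ExpDual A G)
    (x : orbitSpace A c ν) : ℝ → C(Metric.sphere c r, ℂ) :=
  solDeriv lam F m μ q (fun k => resSymb h.2.1.le hr (dualOrbit h (φ k)) x)
    ((Ioi (0 : ℝ)).indicator (sourceSymb h hr g x))

include hG hker hm hμ hf hf_an hg in
-- The operator b(A) enters only through the functional, circle integral after multiplication by B.
-- So one function `solSymb` on the circle serves both for b = 1, the solution itself, and for b =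
-- f(α, ·), the lower order terms.
theorem solVal_funCalc_toExp (h : Admissible G c ν) (hr : ν < r)
    (hrG : Metric.closedBall c r ⊆ G) {F q : ℝ → C(Metric.sphere c r, ℂ)} (hF : Continuous F)
    (hq : IsResKer lam F (m - 1) μ q)
    (hFf : ∀ α ∈ Icc (0 : ℝ) (m - 1), ∀ z, F α z = f α z)
    (hb : DifferentiableOn ℂ b G) {B : C(Metric.sphere c r, ℂ)}
    (hB : ∀ z : Metric.sphere c r, B z = b z) (x : orbitSpace A c ν) :
    (∀ t ≥ 0, ContinuousOn (fun τ => weakExt A G (solSymbol m μ lam f (m - 1) (t - τ)) (g τ)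
      (funCalc A G b (toExp h x))) (Icc 0 t)) ∧
    IsTaylor (fun t => solVal A G m μ lam f φ g t (funCalc A G b (toExp h x)))
      (fun k => φ k (funCalc A G b (toExp h x)))
      fun t => (sphereInt (h.2.1.le.trans hr.le)).comp (ContinuousLinearMap.mul ℝ _ B)
        (solSymb h hr m μ lam F q φ g x t) := by
  set L := (sphereInt (c := c) (h.2.1.le.trans hr.le)).comp (ContinuousLinearMap.mul ℝ _ B) with hL
  have hγ := continuous_sourceSymb hg h hr x
  have mg : Mild ((Ioi (0 : ℝ)).indicator (sourceSymb h hr g x)) := mild_indicator hγ.continuousOn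
  have mw : Mild (solSymb h hr m μ lam F q φ g x) := mild_solDeriv hF hμ hq.mild _ mg
  have hS (k : ℕ) {t : ℝ} (ht : 0 ≤ t) (z : Metric.sphere c r) :
      solFun lam F m μ q k t z = solSymbol m μ lam f k t z :=
    (solSymbol_eq hF hm hμ hq (evalHom z) (fun α hα => hFf α hα z) k ht).symm
  have hSd (k : ℕ) {t : ℝ} (ht : 0 ≤ t) := differentiableOn_solSymbol hG hm hμ (lam := lam) hf hf_an k ht
  have hint {t : ℝ} : ∀ τ ∈ Icc 0 t, weakExt A G (solSymbol m μ lam f (m - 1) (t - τ)) (g τ)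
      (funCalc A G b (toExp h x)) =
      L (solFun lam F m μ q (m - 1) (t - τ) * sourceSymb h hr g x τ) := fun τ hτ => by
    have ht : 0 ≤ t - τ := sub_nonneg.2 hτ.2
    rw [weakExt_funCalc_toExp hG hker h hr hrG (hSd _ ht) hb (hS _ ht) hB, sourceSymb,
      max_eq_left hτ.1]
  -- s is continuous on all of ℝ and agrees with `solFun` on t ≥ 0, which is where the arguments t -
  -- τ lie.
  obtain ⟨s, hs, hse⟩ := exists_continuous_solFun (lam := lam) (k := m - 1) hF hm hμ hq (by omega)
  have hsc (t : ℝ) : Continuous fun τ => s (t - τ) * sourceSymb h hr g x τ :=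
    (hs.comp (continuous_const.sub continuous_id)).mul hγ
  have hse' {t : ℝ} : ∀ τ ∈ Icc 0 t, solFun lam F m μ q (m - 1) (t - τ) * sourceSymb h hr g x τ =
      s (t - τ) * sourceSymb h hr g x τ := fun τ hτ => by rw [hse _ (sub_nonneg.2 hτ.2)]
  refine ⟨fun t ht => ?_, mw.clm L, fun t ht => ?_⟩
  · refine (L.continuous.comp (hsc t)).continuousOn.congr fun τ hτ => ?_
    rw [hint τ hτ, hse' τ hτ]
    rfl
  · have e := sum_solFun_add_integral hF hm hμ hq
      (fun k => resSymb h.2.1.le hr (dualOrbit h (φ k)) x) mg (g' := sourceSymb h hr g x)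
      (fun t ht => indicator_of_mem (mem_Ioi.2 ht) _) ht
    have e2 := (congrArg L e).trans (map_taylor L _ mw t)
    rw [solVal]
    have h0 (k : Fin m) : φ k (funCalc A G b (toExp h x)) =
        L (resSymb h.2.1.le hr (dualOrbit h (φ k)) x) :=
      apply_funCalc_toExp hG hker h hr hrG hb hB _ _
    simp only [h0]
    refine Eq.trans ?_ e2
    rw [map_add, map_sum]
    congr 1
    · exact Finset.sum_congr rfl fun k _ =>
        weakExt_funCalc_toExp hG hker h hr hrG (hSd _ ht) hb (hS _ ht) hB _ _
    · rw [intervalIntegral.integral_congr (g := fun τ => s (t - τ) * sourceSymb h hr g x τ)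
        (by rw [uIcc_of_le ht]; exact hse'),
        ← L.intervalIntegral_comp_comm ((hsc t).intervalIntegrable _ _)]
      refine intervalIntegral.integral_congr ?_
      rw [uIcc_of_le ht]
      exact fun τ hτ => (hint τ hτ).trans (congrArg L (hse' τ hτ))

end Solution

end SolutionFormula

/-! ### Existence of the solution -/

theorem fint_fun_zero (β : ℝ) : fint β (fun _ => (0 : ℂ)) = fun _ => 0 := by
  unfold fint
  split_ifs
  · rfl
  · funext t
    simp [cv_apply]

theorem isTaylor_zero {m : ℕ} : IsTaylor (fun _ => 0) (fun _ : Fin m => 0) fun _ => 0 where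
  mild := mild_zero
  eq t _ := by simp [solTaylor, fint_fun_zero]

theorem IsTaylor.congr {m : ℕ} {y y' w : ℝ → ℂ} {φ : Fin m → ℂ} (h : IsTaylor y φ w)
    (hy : ∀ t ≥ 0, y' t = y t) : IsTaylor y' φ w where
  mild := h.mild
  eq t ht := (hy t ht).trans (h.eq t ht)

theorem Mild.intervalIntegrable_weighted {w : ℝ → ℂ} (hw : Mild w) {β : ℝ} (hβ : 0 < β) (t : ℝ) :
    IntervalIntegrable (fun s => ((t - s) ^ (β - 1) : ℝ) • w s) volume 0 t := by
  rcases le_or_gt t 0 with ht | ht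
  · refine (intervalIntegrable_const (c := (0 : ℂ))).congr fun s hs => ?_
    rw [uIoc_of_ge ht] at hs
    simp [hw.zero s hs.2]
  have h1 := (((mild_pk (𝓐 := ℂ) hβ).integrable_cv hw t).comp_sub_left t).const_mul
    (Real.Gamma β : ℂ)
  rw [intervalIntegrable_iff, uIoc_of_le ht.le]
  refine IntegrableOn.congr_fun_ae (h1.integrableOn (s := Ioc 0 t)) ?_
  filter_upwards [ae_restrict_mem measurableSet_Ioc,
    (Measure.ae_ne volume t).filter_mono (ae_mono Measure.restrict_le_self)] with s hs hst
  have hts : 0 < t - s := sub_pos.2 (lt_of_le_of_ne hs.2 hst)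
  have hG := (Real.Gamma_pos_of_pos hβ).ne'
  rw [pk_mul, powKer_of_pos hts, sub_sub_cancel, ← Complex.real_smul, smul_smul,
    mul_div_cancel₀ _ hG]

section Existence

variable {X : Type*} [NormedAddCommGroup X] [NormedSpace ℂ X] [CompleteSpace X] {A : X →ₗ.[ℂ] X}
  [hA : Fact A.IsClosed] {G : Set ℂ} {c : ℂ} {ν r : ℝ} {b : ℂ → ℂ}
  {m : ℕ} {μ : ℝ} {lam : Measure ℝ} [IsFiniteMeasure lam] {f : ℝ → ℂ → ℂ}

variable (hG : IsOpen G)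
  (hker : ∀ ζ ∉ G, ∀ v : A.domain, (v : X) ∈ expSubmodule A G → A v = ζ • (v : X) → v = 0)
  (hm : 1 ≤ m) (hμ : μ ∈ Ioc ((m : ℝ) - 1) m)
  (hf : ContinuousOn (fun p : ℝ × ℂ => f p.1 p.2) (Icc (0 : ℝ) (m - 1) ×ˢ G))
  (hf_an : ∀ α ∈ Icc (0 : ℝ) (m - 1), DifferentiableOn ℂ (f α) G)
  {φ : Fin m → ExpDual A G} {g h : ℝ → ExpDual A G} (hg : ContinuousOn g (Ici 0))

include hG hker hm hμ hf hf_an hg in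
theorem solVal_toExp (ha : Admissible G c ν) (x : orbitSpace A c ν) :
    (∀ t ≥ 0, ContinuousOn (fun τ => weakExt A G (solSymbol m μ lam f (m - 1) (t - τ)) (g τ)
      (toExp ha x)) (Icc 0 t)) ∧
    ∃ w, IsTaylor (fun t => solVal A G m μ lam f φ g t (toExp ha x)) (fun k => φ k (toExp ha x))
      w := by
  obtain ⟨r, hr, hrG⟩ := ha.exists_closedBall_subset hG
  obtain ⟨F, q, hF, hq, hFf⟩ := exists_sphere_family lam hm hμ hf
    (Metric.sphere_subset_closedBall.trans hrG)
  have := solVal_funCalc_toExp hG hker hm hμ hf hf_an hg (φ := φ) ha hr hrG hF hq hFf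
    (differentiableOn_const 1) (B := 1) (fun z => rfl) x
  rw [funCalc_one_toExp hG hker] at this
  exact ⟨this.1, _, this.2⟩

include hG hker hm hμ hf hf_an hg in
theorem intervalIntegrable_solVal (v : ExpSpace A G) : ∀ t ≥ 0, IntervalIntegrable
    (fun τ => weakExt A G (solSymbol m μ lam f (m - 1) (t - τ)) (g τ) v) volume 0 t := by
  refine expSpace_induction (p := fun v => ∀ t ≥ 0, IntervalIntegrable
    (fun τ => weakExt A G (solSymbol m μ lam f (m - 1) (t - τ)) (g τ) v) volume 0 t)
    (fun u v hu hv t ht => ?_) (fun t _ => ?_) (fun c ν ha x t ht => ?_) v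
  · simpa only [map_add] using (hu t ht).add (hv t ht)
  · simp only [map_zero]
    exact IntervalIntegrable.zero
  · have hc := (solVal_toExp (φ := fun _ => 0) (lam := lam) hG hker hm hμ hf hf_an hg ha x).1 t ht
    rw [← uIcc_of_le ht] at hc
    exact hc.intervalIntegrable

include hG hker hm hμ hf hf_an hg in
theorem solVal_add (u v : ExpSpace A G) {t : ℝ} (ht : 0 ≤ t) :
    solVal A G m μ lam f φ g t (u + v) =
      solVal A G m μ lam f φ g t u + solVal A G m μ lam f φ g t v := by
  have hi := intervalIntegrable_solVal (lam := lam) hG hker hm hμ hf hf_an hg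
  simp only [solVal, map_add]
  rw [Finset.sum_add_distrib, intervalIntegral.integral_add (hi u t ht) (hi v t ht)]
  ring

theorem solVal_smul (a : ℂ) (v : ExpSpace A G) (t : ℝ) :
    solVal A G m μ lam f φ g t (a • v) = a * solVal A G m μ lam f φ g t v := by
  simp only [solVal, map_smul, smul_eq_mul]
  rw [← Finset.mul_sum, intervalIntegral.integral_const_mul, mul_add]

theorem solVal_zero (t : ℝ) : solVal A G m μ lam f φ g t 0 = 0 := by
  simp [solVal]

include hG hker hm hμ hf hf_an hg in
theorem exists_isTaylor (v : ExpSpace A G) :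
    ∃ w, IsTaylor (fun t => solVal A G m μ lam f φ g t v) (fun k => φ k v) w := by
  refine expSpace_induction (p := fun v => ∃ w,
    IsTaylor (fun t => solVal A G m μ lam f φ g t v) (fun k => φ k v) w) ?_ ?_ ?_ v
  · rintro u v ⟨w, hw⟩ ⟨w', hw'⟩
    have := (hw.add hw').congr fun t ht => solVal_add hG hker hm hμ hf hf_an hg u v ht
    exact ⟨fun t => w t + w' t, by simpa only [map_add] using this⟩
  · refine ⟨fun _ => 0, ?_⟩
    simpa only [map_zero, solVal_zero] using isTaylor_zero
  · exact fun c ν ha x => (solVal_toExp hG hker hm hμ hf hf_an hg ha x).2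

include hG hker hm hμ hf hf_an hg in
-- Banach–Steinhaus over τ ∈ [0, t] bounds the integrand uniformly on a space of orbits; this is the
-- continuity of the value of the solution as a functional.
theorem norm_solVal_toExp_le (ha : Admissible G c ν) {t : ℝ} (ht : 0 ≤ t) :
    ∃ K ≥ 0, ∀ x : orbitSpace A c ν,
      ‖solVal A G m μ lam f φ g t (toExp ha x)‖ ≤ K * ‖x‖ := by
  have hc (x : orbitSpace A c ν) := (solVal_toExp (φ := φ) (lam := lam) hG hker hm hμ hf hf_an hg
    ha x).1 t ht
  obtain ⟨C, hC0, hC⟩ := exists_norm_le_of_continuousOn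
    (L := fun τ => dualOrbit ha (weakExt A G (solSymbol m μ lam f (m - 1) (t - τ)) (g τ)))
    isCompact_Icc hc
  refine ⟨∑ k : Fin m, ‖dualOrbit ha (weakExt A G (solSymbol m μ lam f k t) (φ k))‖ +
    C * |t - 0|, by positivity, fun x => ?_⟩
  refine (norm_add_le _ _).trans ?_
  rw [add_mul, Finset.sum_mul, mul_right_comm]
  refine add_le_add ((norm_sum_le _ _).trans (Finset.sum_le_sum fun k _ =>
    (dualOrbit ha (weakExt A G (solSymbol m μ lam f k t) (φ k))).le_opNorm x)) ?_
  refine intervalIntegral.norm_integral_le_of_norm_le_const fun τ hτ => ?_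
  rw [uIoc_of_le ht] at hτ
  exact ContinuousLinearMap.le_of_opNorm_le _ (hC τ ⟨hτ.1.le, hτ.2⟩) x

include hG hker hm hμ hf hf_an hg in
theorem exists_expDual_solVal {t : ℝ} (ht : 0 ≤ t) :
    ∃ S : ExpDual A G, ∀ v, S v = solVal A G m μ lam f φ g t v := by
  let L : ExpSpace A G →ₗ[ℂ] ℂ :=
    { toFun := solVal A G m μ lam f φ g t
      map_add' := fun u v => solVal_add hG hker hm hμ hf hf_an hg u v ht
      map_smul' := fun a v => solVal_smul a v t }
  have hL : Continuous L := by
    refine continuous_of_step A G L fun c ν ha => ?_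
    obtain ⟨K, hK0, hK⟩ := norm_solVal_toExp_le (φ := φ) (lam := lam) hG hker hm hμ hf hf_an hg ha ht
    refine ⟨K, fun C u hu => ?_⟩
    obtain ⟨x, rfl, hx⟩ := exists_toExp_eq ha hu
    exact (hK x).trans (mul_le_mul_of_nonneg_left hx hK0)
  exact ⟨StrongDual.toWeakDual ⟨L, hL⟩, fun v => rfl⟩

/-- For t > 0 each derivative is a pointwise limit of difference quotients of functionals; t = 0 is
treated apart, by the initial values. -/
theorem exists_expDual_solTaylor {w : ExpSpace A G → ℝ → ℂ}
    (hw : ∀ v, Mild (w v))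
    (h0 : ∀ t ≥ 0, ∃ S : ExpDual A G, ∀ v, S v = solTaylor (fun k => φ k v) (w v) 0 t) :
    ∀ n ≤ m, ∀ t ≥ 0, ∃ S : ExpDual A G, ∀ v, S v = solTaylor (fun k => φ k v) (w v) n t := by
  intro n
  induction n with
  | zero => exact fun _ => h0
  | succ n ih =>
    intro hn t ht
    have hn' : n < m := hn
    choose! T hT using ih hn'.le
    rcases ht.eq_or_lt with rfl | ht
    · rcases hn.eq_or_lt with rfl | hn
      -- The order m at t = 0: mild functions vanish there by convention, and no continuity at 0 is
      -- claimed for this order.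
      · exact ⟨0, fun v => by rw [solTaylor_self, (hw v).zero 0 le_rfl]; rfl⟩
      · exact ⟨φ ⟨n + 1, hn⟩, fun v =>
          (solTaylor_zero_right (fun k => φ k v) (hw v) ⟨n + 1, hn⟩).symm⟩
    · refine exists_expDual_of_hasDerivAt (T := T) (t := t) fun v => ?_
      refine (hasDerivAt_solTaylor (hw v) hn' ht).congr_of_eventuallyEq ?_
      filter_upwards [lt_mem_nhds ht] with s hs using hT s hs.le v

include hG hker hm hμ hf hf_an hg in
theorem caputo_solVal (ha : Admissible G c ν) (hr : ν < r)
    (hrG : Metric.closedBall c r ⊆ G) {F q : ℝ → C(Metric.sphere c r, ℂ)} (hF : Continuous F)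
    (hq : IsResKer lam F (m - 1) μ q)
    (hFf : ∀ α ∈ Icc (0 : ℝ) (m - 1), ∀ z, F α z = f α z)
    (hb : DifferentiableOn ℂ b G) {B : C(Metric.sphere c r, ℂ)}
    (hB : ∀ z : Metric.sphere c r, B z = b z) (x : orbitSpace A c ν) {α t : ℝ} (hα : α ≤ m)
    (ht : 0 < t) :
    caputo α (fun t => solVal A G m μ lam f φ g t (funCalc A G b (toExp ha x))) t =
      sphereInt (ha.2.1.le.trans hr.le) (B * solCaputo
        (fun k => resSymb ha.2.1.le hr (dualOrbit ha (φ k)) x)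
        (solSymb ha hr m μ lam F q φ g x) α t) := by
  have mw : Mild (solSymb ha hr m μ lam F q φ g x) := mild_solDeriv hF hμ hq.mild _
    (mild_indicator (continuous_sourceSymb hg ha hr x).continuousOn)
  rw [(solVal_funCalc_toExp hG hker hm hμ hf hf_an hg ha hr hrG hF hq hFf hb hB x).2.caputo_eq hα
    ht]
  have h0 (k : Fin m) := apply_funCalc_toExp hG hker ha hr hrG hb hB (φ k) x
  simp only [h0]
  rw [← map_solCaputo _ _ mw hα]
  rfl

include hG hker hm hμ hf hf_an hg in
-- On a space of orbits, f(α, A) is multiplication by F(α) under the circle integral, so both the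
-- integrability in α and the equation are images of the statements in the algebra under a
-- continuous functional.
theorem solVal_equation (v : ExpSpace A G) {t : ℝ} (ht : 0 < t) :
    IntegrableOn (fun α => caputo α
      (fun s => solVal A G m μ lam f φ g s (funCalc A G (f α) v)) t) (Icc (0 : ℝ) (m - 1)) lam ∧
    caputo μ (fun s => solVal A G m μ lam f φ g s v) t + ∫ α in Icc (0 : ℝ) (m - 1), caputo α
      (fun s => solVal A G m μ lam f φ g s (funCalc A G (f α) v)) t ∂lam =
      fint (m - μ) (posPart fun s => g s v) t := by
  have hT := exists_isTaylor (φ := φ) (lam := lam) hG hker hm hμ hf hf_an hg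
  have hsum (u v : ExpSpace A G) {α : ℝ} (hα : α ≤ m) :
      caputo α (fun s => solVal A G m μ lam f φ g s (u + v)) t =
        caputo α (fun s => solVal A G m μ lam f φ g s u) t +
          caputo α (fun s => solVal A G m μ lam f φ g s v) t := by
    obtain ⟨w, hw⟩ := hT u
    obtain ⟨w', hw'⟩ := hT v
    rw [← hw.caputo_add hw' hα ht]
    exact (((hw.add hw').congr fun t ht =>
      solVal_add hG hker hm hμ hf hf_an hg u v ht).caputo_eq hα ht).trans
      ((hw.add hw').caputo_eq hα ht).symm
  have hle {α : ℝ} (hα : α ∈ Icc (0 : ℝ) (m - 1)) : α ≤ m := hα.2.trans (sub_le_self _ zero_le_one)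
  have h0 (α : ℝ) (hα : α ≤ m) : caputo α (fun _ => (0 : ℂ)) t = 0 := by
    -- By additivity the derivative of 0 is twice itself.
    have e := isTaylor_zero.caputo_add (isTaylor_zero (m := m)) hα ht
    rw [add_zero] at e
    exact left_eq_add.1 e
  refine expSpace_induction (p := fun v => IntegrableOn (fun α => caputo α
      (fun s => solVal A G m μ lam f φ g s (funCalc A G (f α) v)) t) (Icc (0 : ℝ) (m - 1)) lam ∧
    caputo μ (fun s => solVal A G m μ lam f φ g s v) t + ∫ α in Icc (0 : ℝ) (m - 1), caputo α
      (fun s => solVal A G m μ lam f φ g s (funCalc A G (f α) v)) t ∂lam =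
      fint (m - μ) (posPart fun s => g s v) t) ?_ ?_ ?_ v
  · rintro u v ⟨iu, eu⟩ ⟨iv, ev⟩
    have hs : EqOn (fun α => caputo α
        (fun s => solVal A G m μ lam f φ g s (funCalc A G (f α) (u + v))) t)
        (fun α => caputo α (fun s => solVal A G m μ lam f φ g s (funCalc A G (f α) u)) t +
          caputo α (fun s => solVal A G m μ lam f φ g s (funCalc A G (f α) v)) t)
        (Icc (0 : ℝ) (m - 1)) := fun α hα => by
      simp only [map_add]
      exact hsum _ _ (hle hα)
    refine ⟨(iu.add iv).congr_fun hs.symm measurableSet_Icc, ?_⟩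
    rw [setIntegral_congr_fun measurableSet_Icc hs, integral_add iu iv, hsum u v hμ.2,
      add_add_add_comm, eu, ev]
    have hgc (v : ExpSpace A G) : ContinuousOn (fun s => g s v) (Ici 0) :=
      (WeakDual.eval_continuous v).comp_continuousOn hg
    have := congrFun (fint_add (mild_posPart (hgc u)) (mild_posPart (hgc v))
      (sub_nonneg.2 hμ.2)) t
    rw [← this]
    congr 1
    funext s
    simp only [posPart, indicator, map_add]
    split_ifs
    · rfl
    · rw [add_zero]
  · have hs : EqOn (fun α => caputo α
        (fun s => solVal A G m μ lam f φ g s (funCalc A G (f α) 0)) t) (fun _ => 0)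
        (Icc (0 : ℝ) (m - 1)) := fun α hα => by
      simp only [map_zero, solVal_zero]
      exact h0 α (hle hα)
    refine ⟨integrableOn_zero.congr_fun hs.symm measurableSet_Icc, ?_⟩
    rw [setIntegral_congr_fun measurableSet_Icc hs]
    simp only [map_zero, solVal_zero]
    rw [h0 μ hμ.2, integral_zero, show (posPart fun _ => (0 : ℂ)) = fun _ => 0 from
      indicator_zero _ _, fint_fun_zero, add_zero]
  · intro c ν ha x
    obtain ⟨r, hr, hrG⟩ := ha.exists_closedBall_subset hG
    obtain ⟨F, q, hF, hq, hFf⟩ := exists_sphere_family lam hm hμ hf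
      (Metric.sphere_subset_closedBall.trans hrG)
    have hγ := continuous_sourceSymb hg ha hr x
    have mg : Mild ((Ioi (0 : ℝ)).indicator (sourceSymb ha hr g x)) :=
      mild_indicator hγ.continuousOn
    have mw : Mild (solSymb ha hr m μ lam F q φ g x) := mild_solDeriv hF hμ hq.mild _ mg
    have hs : EqOn (fun α => caputo α
        (fun s => solVal A G m μ lam f φ g s (funCalc A G (f α) (toExp ha x))) t)
        (fun α => sphereInt (ha.2.1.le.trans hr.le) (F α * solCaputo
          (fun k => resSymb ha.2.1.le hr (dualOrbit ha (φ k)) x)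
          (solSymb ha hr m μ lam F q φ g x) α t))
        (Icc (0 : ℝ) (m - 1)) := fun α hα =>
      caputo_solVal hG hker hm hμ hf hf_an hg ha hr hrG hF hq hFf (hf_an α hα) (hFf α hα) x (hle hα)
        ht
    have hi := (integrableOn_mul_solCaputo (lam := lam) hF hm
      (fun k => resSymb ha.2.1.le hr (dualOrbit ha (φ k)) x) mw t).1
    have h1 := caputo_solVal (φ := φ) hG hker hm hμ hf hf_an hg ha hr hrG hF hq hFf
      (differentiableOn_const 1) (B := 1) (fun z => rfl) x hμ.2 ht
    rw [funCalc_one_toExp hG hker, one_mul] at h1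
    refine ⟨IntegrableOn.congr_fun ((sphereInt _).integrable_comp hi) hs.symm measurableSet_Icc, ?_⟩
    rw [setIntegral_congr_fun measurableSet_Icc hs, (sphereInt _).integral_comp_comm hi, h1,
      ← map_add, solSymb, solCaputo_equation hF hm hμ hq _ mg t,
      map_fint _ mg (sub_nonneg.2 hμ.2)]
    congr 1
    funext s
    by_cases hs : s ∈ Ioi (0 : ℝ)
    · rw [posPart, indicator_of_mem hs, indicator_of_mem hs]
      have := apply_funCalc_toExp hG hker ha hr hrG (differentiableOn_const 1) (B := 1)
        (fun z => rfl) (g s) x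
      rw [funCalc_one_toExp hG hker] at this
      rw [this, ContinuousLinearMap.comp_apply, ContinuousLinearMap.mul_apply', one_mul, sourceSymb,
        max_eq_left (le_of_lt hs)]
    · rw [posPart, indicator_of_notMem hs, indicator_of_notMem hs, map_zero]

include hG hker hm hμ hf hf_an in
theorem exists_isWeakSolution (hh : ∀ v, ContinuousOn (fun t => h t v) (Ici 0))
    (hgd : IsRLDeriv A G (m - μ) h g) :
    ∃ u : ℝ → ExpDual A G, IsWeakSolution A G m μ lam f φ h u ∧
      ∀ t ≥ 0, ∀ v, u t v = solVal A G m μ lam f φ g t v := by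
  obtain ⟨hg, hd⟩ := hgd
  choose w hw using exists_isTaylor (φ := φ) (lam := lam) hG hker hm hμ hf hf_an hg
  have h0 : ∀ t ≥ 0, ∃ S : ExpDual A G, ∀ v, S v = solTaylor (fun k => φ k v) (w v) 0 t :=
    fun t ht => by
      obtain ⟨S, hS⟩ := exists_expDual_solVal (φ := φ) (lam := lam) hG hker hm hμ hf hf_an hg ht
      exact ⟨S, fun v => (hS v).trans ((hw v).eq t ht)⟩
  choose! D hD using exists_expDual_solTaylor (fun v => (hw v).mild) h0
  have hu : ∀ t ≥ 0, ∀ v, D 0 t v = solVal A G m μ lam f φ g t v := fun t ht v =>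
    (hD 0 (Nat.zero_le m) t ht v).trans ((hw v).eq t ht).symm
  have hT (v : ExpSpace A G) : IsTaylor (fun t => D 0 t v) (fun k => φ k v) (w v) :=
    (hw v).congr fun t ht => hu t ht v
  have hcap (v : ExpSpace A G) {α : ℝ} (hα : α ≤ m) {t : ℝ} (ht : 0 < t) :
      caputo α (fun t => D 0 t v) t = caputo α (fun t => solVal A G m μ lam f φ g t v) t := by
    rw [(hT v).caputo_eq hα ht, (hw v).caputo_eq hα ht]
  have hcont {n : ℕ} {s : Set ℝ} (hc : ∀ v, ContinuousOn (fun t => D n t v) s) :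
      ContinuousOn (D n) s := by
    rw [continuousOn_iff_continuous_domRestrict]
    exact WeakDual.continuous_of_continuous_eval fun v =>
      continuousOn_iff_continuous_domRestrict.1 (hc v)
  refine ⟨D 0, ⟨⟨D, rfl, fun k hk => hcont fun v => ?_, hcont fun v => ?_, fun k hk t ht v => ?_,
    fun k => ?_⟩, fun t ht v => ⟨fun hμm => ?_, ?_⟩⟩, hu⟩
  · exact (continuous_solTaylor (fun k => φ k v) (hw v).mild hk).continuousOn.congr
      fun t ht => hD k hk.le t ht v
  · exact (hw v).mild.cont.congr fun t ht => by
      rw [hD m le_rfl t (le_of_lt ht) v, solTaylor_self]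
  · rw [hD (k + 1) hk t ht.le v]
    refine (hasDerivAt_solTaylor (hw v).mild hk ht).congr_of_eventuallyEq ?_
    filter_upwards [lt_mem_nhds ht] with s hs using hD k hk.le s hs.le v
  · exact DFunLike.ext _ _ fun v => (hD k k.2.le 0 le_rfl v).trans
      (solTaylor_zero_right (fun k => φ k v) (hw v).mild k)
  · refine ((hw v).mild.intervalIntegrable_weighted (sub_pos.2 hμm) t).congr fun s hs => ?_
    rw [uIoc_of_le ht.le] at hs
    rw [(hT v).iteratedDeriv_eq le_rfl hs.1, ← solTaylor_eq_solCaputo _ _ m hs.1, solTaylor_self]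
  · have hle {α : ℝ} (hα : α ∈ Icc (0 : ℝ) (m - 1)) : α ≤ m :=
      hα.2.trans (sub_le_self _ zero_le_one)
    have hs : EqOn (fun α => caputo α (fun s => weakExt A G (f α) (D 0 s) v) t)
        (fun α => caputo α (fun s => solVal A G m μ lam f φ g s (funCalc A G (f α) v)) t)
        (Icc (0 : ℝ) (m - 1)) := fun α hα => hcap (funCalc A G (f α) v) (hle hα) ht
    obtain ⟨hi, he⟩ := solVal_equation (φ := φ) (lam := lam) hG hker hm hμ hf hf_an hg v ht
    refine ⟨hi.congr_fun hs.symm measurableSet_Icc, ?_⟩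
    rw [setIntegral_congr_fun measurableSet_Icc hs, hcap v hμ.2 ht, he]
    -- The right-hand side produced so far is J^(m-μ) g; it equals h because g is the
    -- Riemann–Liouville derivative of the continuous function h.
    exact (eq_fint_of_hasDerivAt (sub_nonneg.2 hμ.2) (by linarith [hμ.1]) (hh v)
      ((WeakDual.eval_continuous v).comp_continuousOn hg) (hd v) ht).symm

end Existence

/-! ### Uniqueness of the solution -/

section Scalar

variable {N : ℕ} {d d₁ d₂ : ℕ → ℝ → ℂ} {y y₁ y₂ : ℝ → ℂ}

theorem caputo_eq_fint (h0 : ∀ t > 0, y t = d 0 t)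
    (hd : ∀ n < N, ∀ t > 0, HasDerivAt (d n) (d (n + 1) t) t)
    (hc : ∀ n ≤ N, ContinuousOn (d n) (Ici 0)) {α : ℝ} (hα : α ≤ N) {t : ℝ} (ht : 0 < t) :
    caputo α y t = fint (⌈α⌉₊ - α) (posPart (d ⌈α⌉₊)) t := by
  have hn : ⌈α⌉₊ ≤ N := Nat.ceil_le.2 hα
  have hit := iteratedDeriv_eq_of_hasDerivAt h0 hd _ hn
  unfold caputo
  split_ifs with h
  · rw [← h, sub_self, fint_zero, hit t ht, posPart_of_pos _ ht]
  · have hlt : 0 < (⌈α⌉₊ : ℝ) - α := sub_pos.2 (lt_of_le_of_ne (Nat.le_ceil α) h)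
    refine fracIntegral_eq hlt (mild_posPart (hc _ hn)) ht.le fun s hs => ?_
    rw [hit s hs.1, posPart_of_pos _ hs.1]

theorem eq_fint_of_chain (hd : ∀ n < N, ∀ t > 0, HasDerivAt (d n) (d (n + 1) t) t)
    (hc : ∀ n ≤ N, ContinuousOn (d n) (Ici 0)) (hz : ∀ n < N, d n 0 = 0) (k : ℕ) :
    ∀ n, n + k = N → ∀ t > 0, d n t = fint k (posPart (d N)) t := by
  have hm := mild_posPart (hc N le_rfl)
  induction k with
  | zero =>
    rintro n rfl t ht
    rw [Nat.cast_zero, fint_zero, add_zero, posPart_of_pos _ ht]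
  | succ k ih =>
    intro n hn t ht
    have hnN : n < N := by omega
    have hm' := mild_posPart (hc (n + 1) hnN)
    have e : fint 1 (posPart (d (n + 1))) = fint 1 (fint k (posPart (d N))) :=
      fint_congr_pos hm' (hm.fint k.cast_nonneg) fun s hs => by
        rw [posPart_of_pos _ hs, ih (n + 1) (by omega) s hs]
    rw [fint_fint hm zero_le_one k.cast_nonneg] at e
    rw [Nat.cast_succ, add_comm, ← e]
    refine eq_of_hasDerivAt_eq (d := d (n + 1)) (hc n hnN.le)
      (continuousOn_fint one_pos (hc (n + 1) hnN)) (hd n hnN) (fun s hs => ?_) ?_ ht.le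
    · have := hasDerivAt_fint hm' le_rfl hs
      rwa [zero_add, fint_zero, posPart_of_pos _ hs] at this
    · rw [hz n hnN, (hm'.fint zero_le_one).zero 0 le_rfl]

theorem posPart_sub (x y : ℝ → ℂ) :
    (posPart fun s => x s - y s) = fun s => posPart x s - posPart y s := by
  funext s
  simp only [posPart, indicator]
  split_ifs
  · rfl
  · rw [sub_zero]

/-- With equal initial values, D_*^α of the difference is J^(N-α) of its derivative of order N. In
the application N = m - 1: that derivative is continuous up to 0, whereas the one of order m may be
unbounded there. -/
theorem caputo_sub_eq_fint (h₁ : ∀ t > 0, y₁ t = d₁ 0 t) (h₂ : ∀ t > 0, y₂ t = d₂ 0 t)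
    (hd₁ : ∀ n < N, ∀ t > 0, HasDerivAt (d₁ n) (d₁ (n + 1) t) t)
    (hd₂ : ∀ n < N, ∀ t > 0, HasDerivAt (d₂ n) (d₂ (n + 1) t) t)
    (hc₁ : ∀ n ≤ N, ContinuousOn (d₁ n) (Ici 0)) (hc₂ : ∀ n ≤ N, ContinuousOn (d₂ n) (Ici 0))
    (hz : ∀ n < N, d₁ n 0 = d₂ n 0) {α : ℝ} (hα : α ≤ N) {t : ℝ} (ht : 0 < t) :
    caputo α y₁ t - caputo α y₂ t = fint (N - α) (posPart fun s => d₁ N s - d₂ N s) t := by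
  have hn : ⌈α⌉₊ ≤ N := Nat.ceil_le.2 hα
  have hlt : 0 ≤ (⌈α⌉₊ : ℝ) - α := sub_nonneg.2 (Nat.le_ceil α)
  have hc (n : ℕ) (hn : n ≤ N) : ContinuousOn (fun s => d₁ n s - d₂ n s) (Ici 0) :=
    (hc₁ n hn).sub (hc₂ n hn)
  have hm := mild_posPart (hc N le_rfl)
  rw [caputo_eq_fint h₁ hd₁ hc₁ hα ht, caputo_eq_fint h₂ hd₂ hc₂ hα ht]
  have e1 := congrFun (fint_sub (mild_posPart (hc₁ _ hn)) (mild_posPart (hc₂ _ hn)) hlt) t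
  rw [← posPart_sub] at e1
  rw [← e1]
  have e2 := eq_fint_of_chain (d := fun n s => d₁ n s - d₂ n s)
    (fun n hn t ht => (hd₁ n hn t ht).sub (hd₂ n hn t ht)) hc (fun n hn => sub_eq_zero.2 (hz n hn))
    (N - ⌈α⌉₊) ⌈α⌉₊ (by omega)
  have e3 := fint_congr_pos (γ := ⌈α⌉₊ - α) (mild_posPart (hc _ hn))
    (hm.fint (N - ⌈α⌉₊ : ℕ).cast_nonneg) fun s hs => by rw [posPart_of_pos _ hs, e2 s hs]
  rw [e3, fint_fint hm hlt (Nat.cast_nonneg _), Nat.cast_sub hn]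
  congr 1
  ring

theorem fracIntegral_sub {β t : ℝ} (ht : 0 ≤ t) {e x y : ℝ → ℂ}
    (hx : IntervalIntegrable (fun s => ((t - s) ^ (β - 1) : ℝ) • x s) volume 0 t)
    (hy : IntervalIntegrable (fun s => ((t - s) ^ (β - 1) : ℝ) • y s) volume 0 t)
    (he : ∀ s > 0, e s = x s - y s) :
    IntervalIntegrable (fun s => ((t - s) ^ (β - 1) : ℝ) • e s) volume 0 t ∧
      fracIntegral β e t = fracIntegral β x t - fracIntegral β y t := by
  have h : EqOn (fun s => ((t - s) ^ (β - 1) : ℝ) • x s - ((t - s) ^ (β - 1) : ℝ) • y s)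
      (fun s => ((t - s) ^ (β - 1) : ℝ) • e s) (Ioc 0 t) := fun s hs => by
    simp only [he s hs.1, smul_sub]
  refine ⟨(hx.sub hy).congr (by rwa [uIoc_of_le ht]), ?_⟩
  unfold fracIntegral
  rw [← smul_sub, ← intervalIntegral.integral_sub hx hy, intervalIntegral.integral_of_le ht,
    intervalIntegral.integral_of_le ht, setIntegral_congr_fun measurableSet_Ioc h]

end Scalar

/-! ### A homogeneous Volterra equation in an exponentially weighted norm -/

section Volterra

variable {E : Type*} [NormedAddCommGroup E] [NormedSpace ℂ E] [CompleteSpace E]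
  {L : ℝ → E →L[ℂ] ℂ} (hc : ∀ x, ContinuousOn (fun t => L t x) (Ici 0))
  {lam : Measure ℝ} [IsFiniteMeasure lam] {S : Set ℝ} (hS : MeasurableSet S) {M K β : ℝ}
  (hSM : ∀ α ∈ S, α ≤ M) {B : ℝ → E →L[ℂ] E} (hK : 0 ≤ K) (hB : ∀ α ∈ S, ‖B α‖ ≤ K)
  (hi : ∀ x, ∀ t > 0, IntegrableOn
    (fun α => fint (M - α) (posPart fun s => L s (B α x)) t) S lam)

include hc hSM hK hB in
-- The inner integral of order M - α costs σ^(-(M-α)), at most 1 for σ ≥ 1, so the bound is uniform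
-- in α.
theorem norm_fint_apply_le {C σ T : ℝ} (hC : 0 ≤ C) (hσ : 1 ≤ σ)
    (hb : ∀ s ∈ Ioc 0 T, ∀ x, ‖L s x‖ ≤ C * Real.exp (σ * s) * ‖x‖) {t : ℝ} (ht : t ∈ Ioc 0 T)
    {α : ℝ} (hα : α ∈ S) (x : E) :
    ‖fint (M - α) (posPart fun s => L s (B α x)) t‖ ≤ C * K * ‖x‖ * Real.exp (σ * t) := by
  have hMα := sub_nonneg.2 (hSM α hα)
  have h1 : ‖fint (M - α) (posPart fun s => L s (B α x)) t‖ ≤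
      C * K * ‖x‖ * σ ^ (-(M - α)) * Real.exp (σ * t) := by
    refine norm_fint_le hMα (by linarith) ht.1 (mild_posPart (hc _)) fun s hs => ?_
    rw [posPart_of_pos _ hs.1]
    refine (hb s ⟨hs.1, hs.2.trans ht.2⟩ _).trans ?_
    have h2 := (B α).le_of_opNorm_le (hB α hα) x
    refine (mul_le_mul_of_nonneg_left h2 (by positivity)).trans_eq ?_
    ring
  refine h1.trans (mul_le_mul_of_nonneg_right (mul_le_of_le_one_right (by positivity) ?_)
    (Real.exp_pos _).le)
  exact Real.rpow_le_one_of_one_le_of_nonpos hσ (neg_nonpos.2 hMα)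

include hc hS hSM hK hB in
theorem norm_integral_fint_le {C σ T : ℝ} (hC : 0 ≤ C) (hσ : 1 ≤ σ)
    (hb : ∀ s ∈ Ioc 0 T, ∀ x, ‖L s x‖ ≤ C * Real.exp (σ * s) * ‖x‖) {t : ℝ} (ht : t ∈ Ioc 0 T)
    (x : E) : ‖-∫ α in S, fint (M - α) (posPart fun s => L s (B α x)) t ∂lam‖ ≤
      C * K * ‖x‖ * lam.real S * Real.exp (σ * t) := by
  rw [norm_neg]
  refine (norm_setIntegral_le_of_norm_le_const (measure_lt_top lam S) fun α hα =>
    norm_fint_apply_le hc hSM hK hB hC hσ hb ht hα x).trans_eq ?_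
  ring

include hc in
theorem exists_exp_bound {σ : ℝ} (hσ : 0 ≤ σ) (T : ℝ) :
    ∃ C ≥ 0, ∀ s ∈ Ioc 0 T, ∀ x, ‖L s x‖ ≤ C * Real.exp (σ * s) * ‖x‖ := by
  obtain ⟨C, hC0, hC⟩ := exists_norm_le_of_continuousOn (isCompact_Icc (a := 0) (b := T))
    fun x => (hc x).mono Icc_subset_Ici_self
  refine ⟨C, hC0, fun s hs x => (L s).le_of_opNorm_le ((hC s ⟨hs.1.le, hs.2⟩).trans ?_) x⟩
  exact le_mul_of_one_le_right hC0 (Real.one_le_exp (mul_nonneg hσ hs.1.le))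

include hc hS hSM hK hB hi in
theorem mild_integral_fint (x : E) :
    Mild fun t => -∫ α in S, fint (M - α) (posPart fun s => L s (B α x)) t ∂lam := by
  have hm (α : ℝ) (hα : α ∈ S) : Mild (fint (M - α) (posPart fun s => L s (B α x))) :=
    (mild_posPart (hc _)).fint (sub_nonneg.2 (hSM α hα))
  refine mild_of_bound (fun t ht => ?_) (fun t ht => ?_) fun T => ?_
  · rw [setIntegral_congr_fun hS fun α hα => (hm α hα).zero t ht, integral_zero, neg_zero]
  · obtain ⟨C, hC0, hC⟩ := exists_exp_bound hc zero_le_one (t + 1)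
    have ht' : ∀ᶠ s in 𝓝 t, s ∈ Ioo 0 (t + 1) := Ioo_mem_nhds ht (by linarith)
    refine (ContinuousAt.neg (continuousAt_of_dominated
      (bound := fun _ => C * K * ‖x‖ * Real.exp (1 * (t + 1))) ?_ ?_ ?_ ?_)).continuousWithinAt
    · filter_upwards [ht'] with s hs using (hi x s hs.1).1
    · filter_upwards [ht'] with s hs
      filter_upwards [ae_restrict_mem hS] with α hα
      refine (norm_fint_apply_le hc hSM hK hB hC0 le_rfl hC ⟨hs.1, hs.2.le⟩ hα x).trans ?_
      refine mul_le_mul_of_nonneg_left (Real.exp_le_exp.2 ?_) (by positivity)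
      linarith [hs.2]
    · exact integrable_const _
    · filter_upwards [ae_restrict_mem hS] with α hα
      exact (hm α hα).cont.continuousAt (Ioi_mem_nhds ht)
  · obtain ⟨C, hC0, hC⟩ := exists_exp_bound hc zero_le_one T
    refine ⟨C * K * ‖x‖ * lam.real S * Real.exp (1 * T), fun t ht => ?_⟩
    refine (norm_integral_fint_le hc hS hSM hK hB hC0 le_rfl hC ht x).trans ?_
    exact mul_le_mul_of_nonneg_left (Real.exp_le_exp.2 (by linarith [ht.2])) (by positivity)

include hc hS hSM hK hB hi in
/-- Uniqueness for a linear Volterra equation of order `1 - β > 0`. -/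
theorem eq_zero_of_volterra (hβ : β < 1) (hL : ∀ x, ∀ t > 0, L t x = fint (1 - β)
      (fun t => -∫ α in S, fint (M - α) (posPart fun s => L s (B α x)) t ∂lam) t)
    {t : ℝ} (ht : 0 < t) (x : E) : L t x = 0 := by
  have hβ' : 0 < 1 - β := by linarith
  -- The gain comes from the outer integral of order 1 - β: its factor σ^(-(1-β)) makes the total
  -- factor less than 1/2.
  have hlim : Tendsto (fun σ : ℝ => K * lam.real S * σ ^ (-(1 - β))) atTop (𝓝 0) := by
    simpa using (tendsto_rpow_neg_atTop hβ').const_mul (K * lam.real S)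
  obtain ⟨σ, hσ, hσ1⟩ := ((hlim.eventually (gt_mem_nhds (by norm_num : (0 : ℝ) < 1 / 2))).and
    (eventually_ge_atTop 1)).exists
  have hσ0 : 0 < σ := by linarith
  obtain ⟨C, hC0, hC⟩ := exists_exp_bound hc hσ0.le t
  have key (n : ℕ) : ∀ s ∈ Ioc 0 t, ∀ x, ‖L s x‖ ≤ C * (1 / 2) ^ n * Real.exp (σ * s) * ‖x‖ := by
    induction n with
    | zero => simpa using hC
    | succ n ih =>
      intro s hs x
      have hCn : 0 ≤ C * (1 / 2) ^ n := by positivity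
      rw [hL x s hs.1]
      refine (norm_fint_le hβ'.le hσ0 hs.1 (mild_integral_fint hc hS hSM hK hB hi x) fun r hr =>
        norm_integral_fint_le hc hS hSM hK hB hCn hσ1 ih ⟨hr.1, hr.2.trans hs.2⟩ x).trans ?_
      have h1 : C * (1 / 2) ^ n * Real.exp (σ * s) * ‖x‖ * (K * lam.real S * σ ^ (-(1 - β))) ≤
          C * (1 / 2) ^ n * Real.exp (σ * s) * ‖x‖ * (1 / 2) :=
        mul_le_mul_of_nonneg_left hσ.le (by positivity)
      refine le_trans (le_of_eq ?_) (h1.trans_eq ?_) <;> ring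
  have hlim2 : Tendsto (fun n : ℕ => C * (1 / 2) ^ n * Real.exp (σ * t) * ‖x‖) atTop (𝓝 0) := by
    have := tendsto_pow_atTop_nhds_zero_of_lt_one (r := (1 / 2 : ℝ)) (by norm_num) (by norm_num)
    simpa using ((this.const_mul C).mul_const (Real.exp (σ * t))).mul_const ‖x‖
  exact norm_le_zero_iff.1 (ge_of_tendsto' hlim2 fun n => key n t ⟨ht, le_rfl⟩ x)

end Volterra

/-! ### Uniqueness of the weak solution -/

section Uniqueness

variable {X : Type*} [NormedAddCommGroup X] [NormedSpace ℂ X] [CompleteSpace X] {A : X →ₗ.[ℂ] X}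
  [hA : Fact A.IsClosed] {G : Set ℂ} {c : ℂ} {ν r : ℝ} {b : ℂ → ℂ}
  {m : ℕ} {μ : ℝ} {lam : Measure ℝ} [IsFiniteMeasure lam] {f : ℝ → ℂ → ℂ}

variable (hG : IsOpen G)
  (hker : ∀ ζ ∉ G, ∀ v : A.domain, (v : X) ∈ expSubmodule A G → A v = ζ • (v : X) → v = 0)
  (hm : 1 ≤ m) (hμ : μ ∈ Ioc ((m : ℝ) - 1) m)
  (hf : ContinuousOn (fun p : ℝ × ℂ => f p.1 p.2) (Icc (0 : ℝ) (m - 1) ×ˢ G))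
  (hf_an : ∀ α ∈ Icc (0 : ℝ) (m - 1), DifferentiableOn ℂ (f α) G)
  {φ : Fin m → ExpDual A G} {h u₁ u₂ : ℝ → ExpDual A G}

include hG hf hf_an in
-- Write f(α, A) as a contour integral: f is bounded on the compact set [0, m-1] × circle, and the
-- resolvent on the circle.
theorem exists_norm_orbitCalc_le (ha : Admissible G c ν) :
    ∃ K ≥ 0, ∀ α ∈ Icc (0 : ℝ) (m - 1), ‖(orbitCalc (f α) c ν :
      orbitSpace A c ν →L[ℂ] orbitSpace A c ν)‖ ≤ K := by
  obtain ⟨r, hr, hrG⟩ := ha.exists_closedBall_subset hG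
  have hr0 : 0 ≤ r := ha.2.1.le.trans hr.le
  obtain ⟨C₁, hC₁⟩ := (isCompact_sphere c r).exists_bound_of_continuousOn
    (continuousOn_resolvent norm_one_orbitSpace_le
      (norm_orbitShift_le (A := A) (c := c) ha.2.1.le) hr)
  obtain ⟨C₂, hC₂⟩ := ((isCompact_Icc (a := (0 : ℝ)) (b := m - 1)).prod
    (isCompact_sphere c r)).exists_bound_of_continuousOn
      (hf.mono (prod_mono_right (Metric.sphere_subset_closedBall.trans hrG)))
  refine ⟨r * (max C₂ 0 * max C₁ 0), by positivity, fun α hα => ?_⟩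
  have e := circleIntegral_orbitCalc (A := A) (ContinuousLinearMap.id ℂ _) ha.2.1.le hr hrG
    (hf_an α hα)
  simp only [ContinuousLinearMap.id_apply] at e
  have hle := circleIntegral.norm_two_pi_i_inv_smul_integral_le_of_norm_le_const
    (f := fun z => f α z • resolvent (orbitOp A c ν) z) (c := c) (C := max C₂ 0 * max C₁ 0) hr0
    fun z hz => by
      rw [norm_smul]
      exact mul_le_mul ((hC₂ (α, z) ⟨hα, hz⟩).trans (le_max_left _ _))
        ((hC₁ z hz).trans (le_max_left _ _)) (norm_nonneg _) (le_max_right _ _)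
  rwa [e, inv_smul_smul₀ Complex.two_pi_I_ne_zero] at hle

include hG hker hm hμ hf hf_an in
-- With N = m - 1, let D be the difference of the derivatives of order N. Subtracting the equations
-- gives J^(m-μ) D' = -∫ J^(N-α) (f(α, A*) D) λ(dα), hence a Volterra equation D = J^(1-(m-μ))(⋯) on
-- each space of orbits.
theorem IsWeakSolution.unique (h₁ : IsWeakSolution A G m μ lam f φ h u₁)
    (h₂ : IsWeakSolution A G m μ lam f φ h u₂) {t : ℝ} (ht : 0 ≤ t) : u₁ t = u₂ t := by
  obtain ⟨⟨d₁, rfl, hc₁, -, hd₁, hi₁⟩, e₁⟩ := h₁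
  obtain ⟨⟨d₂, rfl, hc₂, -, hd₂, hi₂⟩, e₂⟩ := h₂
  obtain ⟨N, rfl⟩ : ∃ N, m = N + 1 := ⟨m - 1, by omega⟩
  have hN : ((N + 1 : ℕ) : ℝ) - 1 = N := by push_cast; ring
  rw [hN] at hμ hf hf_an e₁ e₂
  have h0 (n : ℕ) (hn : n < N + 1) : d₁ n 0 = d₂ n 0 := (hi₁ ⟨n, hn⟩).trans (hi₂ ⟨n, hn⟩).symm
  have ev {d : ℕ → ℝ → ExpDual A G} (hc : ∀ k < N + 1, ContinuousOn (d k) (Ici 0))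
      (v : ExpSpace A G) : ∀ n ≤ N, ContinuousOn (fun s => d n s v) (Ici 0) := fun n hn =>
    (WeakDual.eval_continuous v).comp_continuousOn (hc n (by omega))
  have e0 (n : ℕ) (hn : n < N + 1) (v : ExpSpace A G) : d₁ n 0 v = d₂ n 0 v := by rw [h0 n hn]
  have hcap (v : ExpSpace A G) {α : ℝ} (hα : α ≤ N) {t : ℝ} (ht : 0 < t) :
      caputo α (fun s => d₁ 0 s v) t - caputo α (fun s => d₂ 0 s v) t =
        fint (N - α) (posPart fun s => d₁ N s v - d₂ N s v) t :=
    caputo_sub_eq_fint (d₁ := fun n s => d₁ n s v) (d₂ := fun n s => d₂ n s v) (fun _ _ => rfl)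
      (fun _ _ => rfl) (fun n hn t ht => hd₁ n (by omega) t ht v)
      (fun n hn t ht => hd₂ n (by omega) t ht v) (ev hc₁ v) (ev hc₂ v)
      (fun n hn => e0 n (by omega) v) hα ht
  have hit {d : ℕ → ℝ → ExpDual A G} (hd : ∀ k < N + 1, ∀ t > 0, ∀ v : ExpSpace A G,
      HasDerivAt (fun s => d k s v) (d (k + 1) t v) t) (v : ExpSpace A G) :
      ∀ t > 0, iteratedDeriv (N + 1) (fun s => d 0 s v) t = d (N + 1) t v :=
    iteratedDeriv_eq_of_hasDerivAt (d := fun n s => d n s v) (fun _ _ => rfl)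
      (fun n hn t ht => hd n hn t ht v) (N + 1) le_rfl
  -- Since μ ∈ (N, N + 1], the leading Caputo derivative is J^(m-μ) of the derivative of order m, or
  -- that derivative itself when μ = m.
  have hceil : ⌈μ⌉₊ = N + 1 := (Nat.ceil_eq_iff (by omega)).2 ⟨by simpa using hμ.1, hμ.2⟩
  have horb {c : ℂ} {ν : ℝ} (ha : Admissible G c ν) (x : orbitSpace A c ν) {t : ℝ} (ht : 0 < t) :
      d₁ N t (toExp ha x) - d₂ N t (toExp ha x) = 0 := by
    obtain ⟨K, hK, hB⟩ := exists_norm_orbitCalc_le (A := A) (m := N + 1) hG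
      (by rwa [hN]) (by rwa [hN]) ha
    rw [hN] at hB
    have hcL (x : orbitSpace A c ν) :
        ContinuousOn (fun t => dualOrbit ha (d₁ N t - d₂ N t) x) (Ici 0) :=
      (ev hc₁ (toExp ha x) N le_rfl).sub (ev hc₂ (toExp ha x) N le_rfl)
    have hfx {α : ℝ} (hα : α ∈ Icc (0 : ℝ) N) (x : orbitSpace A c ν) {t : ℝ} (ht : 0 < t) :
        caputo α (fun s => weakExt A G (f α) (d₁ 0 s) (toExp ha x)) t -
          caputo α (fun s => weakExt A G (f α) (d₂ 0 s) (toExp ha x)) t =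
        fint (N - α) (posPart fun s => dualOrbit ha (d₁ N s - d₂ N s) (orbitCalc (f α) c ν x)) t := by
      refine (hcap (funCalc A G (f α) (toExp ha x)) hα.2 ht).trans ?_
      rw [funCalc_toExp hG hker (hf_an α hα) ha x]
      rfl
    have hi (x : orbitSpace A c ν) (t : ℝ) (ht : t > 0) : IntegrableOn (fun α => fint (N - α)
        (posPart fun s => dualOrbit ha (d₁ N s - d₂ N s) (orbitCalc (f α) c ν x)) t)
        (Icc 0 (N : ℝ)) lam :=
      ((e₁ t ht (toExp ha x)).2.1.sub (e₂ t ht (toExp ha x)).2.1).congr_fun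
        (fun α hα => hfx hα x ht) measurableSet_Icc
    have hdiff (x : orbitSpace A c ν) (t : ℝ) (ht : t > 0) :
        caputo μ (fun s => d₁ 0 s (toExp ha x)) t - caputo μ (fun s => d₂ 0 s (toExp ha x)) t =
          -∫ α in Icc 0 (N : ℝ), fint (N - α)
            (posPart fun s => dualOrbit ha (d₁ N s - d₂ N s) (orbitCalc (f α) c ν x)) t ∂lam := by
      have i₁ := (e₁ t ht (toExp ha x)).2
      have i₂ := (e₂ t ht (toExp ha x)).2
      rw [← setIntegral_congr_fun measurableSet_Icc fun α hα => hfx hα x ht,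
        integral_sub i₁.1 i₂.1]
      linear_combination i₁.2 - i₂.2
    have hβ : (0 : ℝ) ≤ (N + 1 : ℕ) - μ := sub_nonneg.2 hμ.2
    have hβ1 : ((N + 1 : ℕ) : ℝ) - μ < 1 := by
      have := hμ.1
      push_cast
      linarith
    refine eq_zero_of_volterra hcL measurableSet_Icc (fun α hα => hα.2) hK hB hi hβ1
      (fun x t ht => ?_) ht x
    refine eq_fint_of_fracIntegral_deriv hβ hβ1
      (e := fun s => d₁ (N + 1) s (toExp ha x) - d₂ (N + 1) s (toExp ha x)) (hcL x)
      (sub_eq_zero.2 (e0 N (by omega) _))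
      (fun t ht => (hd₁ N (by omega) t ht _).sub (hd₂ N (by omega) t ht _))
      (mild_integral_fint hcL measurableSet_Icc (fun α hα => hα.2) hK hB hi x)
      (fun h s hs => ?_) (fun h s hs => ?_) ht
    · rw [← hdiff x s hs, caputo, caputo, hceil, if_pos (by linarith), if_pos (by linarith),
        hit hd₁ _ s hs, hit hd₂ _ s hs]
    · have hlt : μ < (N + 1 : ℕ) := sub_pos.1 h
      rw [← hdiff x s hs, caputo, caputo, hceil, if_neg hlt.ne, if_neg hlt.ne]
      exact fracIntegral_sub hs.le ((e₁ s hs (toExp ha x)).1 hlt) ((e₂ s hs (toExp ha x)).1 hlt)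
        fun r hr => by rw [hit hd₁ _ r hr, hit hd₂ _ r hr]
  have hall (v : ExpSpace A G) {t : ℝ} (ht : 0 < t) : d₁ N t v - d₂ N t v = 0 := by
    refine expSpace_induction (p := fun v => d₁ N t v - d₂ N t v = 0) (fun u v hu hv => ?_) ?_
      (fun c ν ha x => horb ha x ht) v
    · rw [map_add, map_add, add_sub_add_comm, hu, hv, add_zero]
    · rw [map_zero, map_zero, sub_zero]
  rcases ht.eq_or_lt with rfl | ht
  · exact h0 0 (by omega)
  refine DFunLike.ext _ _ fun v => sub_eq_zero.1 ?_
  -- The difference of the solutions is the N-fold integral of D, as all initial values agree; and D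
  -- = 0.
  have e := eq_fint_of_chain (N := N) (d := fun n s => d₁ n s v - d₂ n s v)
    (fun n hn t ht => (hd₁ n (by omega) t ht v).sub (hd₂ n (by omega) t ht v))
    (fun n hn => (ev hc₁ v n hn).sub (ev hc₂ v n hn))
    (fun n hn => sub_eq_zero.2 (e0 n (by omega) v)) N 0 (zero_add N) t ht
  rw [e, show (posPart fun s => d₁ N s v - d₂ N s v) = fun _ => 0 from funext fun s => ?_,
    fint_fun_zero]
  rcases le_or_gt s 0 with hs | hs
  · exact indicator_of_notMem (by simpa using hs) _
  · rw [posPart_of_pos _ hs, hall v hs]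

end Uniqueness

end FracCauchy

end

/-! ### The theorem assembled -/

theorem mainTheorem8 {X : Type*} [NormedAddCommGroup X] [NormedSpace ℂ X] [CompleteSpace X]
    (A : X →ₗ.[ℂ] X) (hA_closed : A.IsClosed) (hA_dense : Dense (A.domain : Set X))
    (G : Set ℂ) (hG : IsOpen G)
    (hExp_dense : Dense (FracCauchy.expSubmodule A G : Set X))
    (hker : ∀ ζ ∉ G, ∀ v : A.domain,
      (v : X) ∈ FracCauchy.expSubmodule A G → A v = ζ • (v : X) → v = 0)
    (m : ℕ) (hm : 1 ≤ m) (μ : ℝ) (hμ : μ ∈ Set.Ioc ((m : ℝ) - 1) m)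
    (lam : MeasureTheory.Measure ℝ) [MeasureTheory.IsFiniteMeasure lam]
    (hlam : lam (Set.Icc (0 : ℝ) (m - 1))ᶜ = 0)
    (f : ℝ → ℂ → ℂ)
    (hf_cont : ContinuousOn (fun p : ℝ × ℂ => f p.1 p.2) (Set.Icc (0 : ℝ) (m - 1) ×ˢ G))
    (hf_an : ∀ α ∈ Set.Icc (0 : ℝ) (m - 1), DifferentiableOn ℂ (f α) G)
    (φ : Fin m → FracCauchy.ExpDual A G)
    (h g : ℝ → FracCauchy.ExpDual A G)
    (hh : ∀ T > 0, ∀ v : FracCauchy.ExpSpace A G,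
      AbsolutelyContinuousOnInterval (fun t => h t v) 0 T)
    (hg : FracCauchy.IsRLDeriv A G (m - μ) h g) :
    -- the operators `b(A)` and their weak extensions are well defined
    (∀ b : ℂ → ℂ, DifferentiableOn ℂ b G →
      FracCauchy.IsFunCalc A G b (FracCauchy.funCalc A G b)) ∧
    -- `X*` embeds in `Exp'`, and there `b(A*)` with `b(z) = z` extends the adjoint of `A`
    Function.Injective (FracCauchy.restrictDual A G) ∧
    (∀ x y : X →L[ℂ] ℂ, (∀ v : A.domain, y v = x (A v)) →
      FracCauchy.weakExt A G id (FracCauchy.restrictDual A G x) =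
        FracCauchy.restrictDual A G y) ∧
    -- the symbols `c_β(t, z)` and `S_k(t, z)` are well defined, and `S_k(t, ·)` is analytic
    (∀ β ≤ μ - 1, ∀ z ∈ G, FracCauchy.IsInvLaplace
      (fun s => ((s ^ β : ℝ) : ℂ) / FracCauchy.charFun m μ lam f s z)
      (fun t => FracCauchy.cFun m μ lam f β t z)) ∧
    (∀ k < m, ∀ t ≥ 0, ∀ z ∈ G, MeasureTheory.IntegrableOn
      (fun α => f α z * FracCauchy.cFun m μ lam f (α - k - 1) t z)
      (Set.Ioc (k : ℝ) (m - 1)) lam) ∧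
    (∀ k < m, ∀ t ≥ 0, DifferentiableOn ℂ (FracCauchy.solSymbol m μ lam f k t) G) ∧
    -- there is a unique weak solution, and it is given by the representation formula
    ∃ u : ℝ → FracCauchy.ExpDual A G,
      FracCauchy.IsWeakSolution A G m μ lam f φ h u ∧
      (∀ u' : ℝ → FracCauchy.ExpDual A G, FracCauchy.IsWeakSolution A G m μ lam f φ h u' →
        ∀ t ≥ 0, u' t = u t) ∧
      ∀ t ≥ 0, ∀ v : FracCauchy.ExpSpace A G,
        IntervalIntegrable (fun τ => FracCauchy.weakExt A G
          (FracCauchy.solSymbol m μ lam f (m - 1) (t - τ)) (g τ) v)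
          MeasureTheory.volume 0 t ∧
        u t v = ∑ k : Fin m, FracCauchy.weakExt A G
            (FracCauchy.solSymbol m μ lam f k t) (φ k) v +
          ∫ τ in (0 : ℝ)..t, FracCauchy.weakExt A G
            (FracCauchy.solSymbol m μ lam f (m - 1) (t - τ)) (g τ) v := by
  have : Fact A.IsClosed := ⟨hA_closed⟩
  have hhc (v : FracCauchy.ExpSpace A G) : ContinuousOn (fun t => h t v) (Set.Ici 0) := by
    intro t ht
    have ht' : (0 : ℝ) ≤ t := ht
    -- Within [0, ∞) the interval [0, t + 1] is a neighbourhood of t, the endpoint t = 0 included.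
    have hc := (hh (t + 1) (by linarith) v).continuousOn
    rw [Set.uIcc_of_le (by linarith)] at hc
    have hn : Set.Iio (t + 1) ∈ nhds t := Iio_mem_nhds (by linarith)
    refine ((hc t ⟨ht', by linarith⟩).mono_of_mem_nhdsWithin ?_)
    filter_upwards [self_mem_nhdsWithin, mem_nhdsWithin_of_mem_nhds hn] with s hs hst
    exact ⟨hs, le_of_lt hst⟩
  refine ⟨fun b hb => FracCauchy.isFunCalc_funCalc hG hker hb,
    FracCauchy.injective_restrictDual hExp_dense,
    fun x y hxy => FracCauchy.weakExt_id_restrictDual hG hker hxy,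
    fun β hβ z hz => FracCauchy.isInvLaplace_cFun hm hμ hf_cont hz hβ,
    fun k _ t ht z hz => FracCauchy.integrableOn_symbol hm hμ hf_cont hz k ht,
    fun k _ t ht => FracCauchy.differentiableOn_solSymbol hG hm hμ hf_cont hf_an k ht, ?_⟩
  obtain ⟨u, hu, hur⟩ := FracCauchy.exists_isWeakSolution (φ := φ) (lam := lam)
    hG hker hm hμ hf_cont hf_an hhc hg
  exact ⟨u, hu, fun u' hu' t ht => hu'.unique hG hker hm hμ hf_cont hf_an hu ht,
    fun t ht v => ⟨FracCauchy.intervalIntegrable_solVal hG hker hm hμ hf_cont hf_an hg.1 v t ht,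
      hur t ht v⟩⟩
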